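/- Conventions. Let $d\ge 1$, let $\|\cdot\|$ be the Euclidean norm on $\mathbb R^d$ and $B_2$ its closed unit ball. Write $\widehat f(\xi)=(2\pi)^{-d/2}\int_{\mathbb R^d}f(x)e^{-i\langle\xi,x\rangle}\,dx$, and let $\mathcal F$ be its isometric extension to $L_2(\mathbb R^d)$. For bounded measurable $S\subset\mathbb R^d$ let $PW_S=\{f\in L_2(\mathbb R^d):\mathcal F[f]=0\text{ a.e. outside }S\}$; each $f\in PW_S$ is identified with its continuous representative. A symmetric convex body is a compact convex set $Z\subset\mathbb R^d$ with non-empty interior and $Z=-Z$. A sequence $X=(x_j)_{j\in\mathbb N}$ in $\mathbb R^d$ is a Riesz-basis sequence for $L_2(Z)$ if the functions $e^{-i\langle x_j,\cdot\rangle}$ form a Riesz basis of $L_2(Z)$: each element has a unique expansion with square-summable coefficients, and for some $R_b>0$ all $(c_j)\in\ell_2$ satisfy $R_b^{-1}\|c\|_{\ell_2}\le\|\sum_j c_je^{-i\langle x_j,\cdot\rangle}\|_{L_2(Z)}\le R_b\|c\|_{\ell_2}$. A function $\phi:\mathbb R^d\to\mathbb R$ is a $d$-dimensional interpolator for $PW_Z$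 if (I1) $\phi\in L_1\cap C(\mathbb R^d)$ and $\widehat\phi\in L_1$; (I2) $\widehat\phi\ge 0$, and $\widehat\phi\ge\varepsilon$ on $Z$ for some $\varepsilon>0$; (I3) $\sum_{j\ge1}2^{jd/2}M_j<\infty$, where $M_j=\sup_{u\in Z\setminus\frac12Z}|\widehat\phi(2^ju)|$. Let $\delta B_2\subset Z\subset B_2$, $\beta>0$, and let $A\subset(0,\infty)$ be unbounded. A family $(\phi_\alpha)_{\alpha\in A}$ of $d$-dimensional interpolators for $PW_Z$ is regular for $PW_{\beta B_2}$ if (R1) there is a constant $C$ with $\sum_{j\ge1}2^{jd/2}M_j(\alpha)\le C M_\alpha$ for all sufficiently large $\alpha\in A$, where $M_j(\alpha)$ is $M_j$ for $\phi_\alpha$ and $M_\alpha=\sup_{u\in B_2\setminus\delta B_2}|\widehat{\phi_\alpha}(u)|$; (R2) $M_\alpha^3/(m_\alpha(\beta)\gamma_\alpha^2)\to0$ as $\alpha\to\infty$, where $m_\alpha(\beta)=\inf_{\beta B_2}|\widehat{\phi_\alpha}|$ and $\gamma_\alpha=\inf_{B_2}|\widehat{\phi_\alpha}|$. Theorem.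 Let $p>0$, $\delta\in\left((2/3)^{1/p},1\right)$ and $0<\beta<(3\delta^p-2)^{1/p}$. Let $Z\subset\mathbb R^d$ be a symmetric convex body with $\delta B_2\subset Z\subset B_2$. For $\alpha>0$ put $$g_\alpha(x)=(2\pi)^{-d/2}\int_{\mathbb R^d}e^{-\alpha\|\xi\|^p}e^{i\langle x,\xi\rangle}\,d\xi,\qquad x\in\mathbb R^d.$$ Then $(g_\alpha)_{\alpha\in(0,\infty)}$ is a family of $d$-dimensional interpolators for $PW_Z$ that is regular for $PW_{\beta B_2}$. Moreover, let $X=(x_j)_{j\in\mathbb N}$ be a Riesz-basis sequence for $L_2(Z)$. For every $\alpha>0$ and $f\in PW_Z$ there is a unique $(a_j)\in\ell_2$ with $\sum_j a_jg_\alpha(x_k-x_j)=f(x_k)$ for all $k\in\mathbb N$; the series $\mathcal I_\alpha f(x)=\sum_j a_jg_\alpha(x-x_j)$ converges absolutely for every $x\in\mathbb R^d$, and $\mathcal I_\alpha f\in L_2(\mathbb R^d)$. For every $f\in PW_{\beta B_2}$ one has $\mathcal I_\alpha f\to f$ as $\alpha\to\infty$, both in $L_2(\mathbb R^d)$ and uniformly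 on $\mathbb R^d$. Finally, there is a constant $C>0$, independent of $\alpha$ and $f$, such that for all $\alpha>0$ and all $f\in PW_{\beta B_2}$, $$\max\left\{\|\mathcal I_\alpha f-f\|_{L_2(\mathbb R^d)},\ \|\mathcal I_\alpha f-f\|_{L_\infty(\mathbb R^d)}\right\}\le C\,e^{\alpha(\beta^p+2-3\delta^p)}\,\|f\|_{L_2(\mathbb R^d)}.$$ -/

import Mathlib

open Set Filter Topology MeasureTheory
open scoped ENNReal NNReal Pointwise FourierTransform

noncomputable section

/-- The space `ℝ^d` with its Euclidean norm. -/
abbrev Rd (d : ℕ) : Type := EuclideanSpace ℝ (Fin d)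

/-- The Fourier transform of an integrable function,
`(2π)^(-d/2) ∫ f(x) exp(-i⟨ξ, x⟩) dx`. -/
def fourierHat {d : ℕ} (f : Rd d → ℂ) (ξ : Rd d) : ℂ :=
  (((2 * Real.pi) ^ (-(d : ℝ) / 2) : ℝ) : ℂ) *
    ∫ x, f x * Complex.exp (-Complex.I * ((inner ℝ ξ x : ℝ) : ℂ))

/-- The Fourier transform on `L₂(ℝ^d)` in the normalization of `fourierHat`: Mathlib's transform
uses the phase `exp(-2πi⟨ξ, x⟩)` and no prefactor, so `ξ` is rescaled by `1/(2π)`.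
The value is a representative of an almost-everywhere class. -/
def fourierL2 {d : ℕ} (f : Lp ℂ 2 (volume : Measure (Rd d))) (ξ : Rd d) : ℂ :=
  (((2 * Real.pi) ^ (-(d : ℝ) / 2) : ℝ) : ℂ) *
    ((𝓕 f : Lp ℂ 2 (volume : Measure (Rd d))) : Rd d → ℂ) ((2 * Real.pi)⁻¹ • ξ)

/-- The Paley-Wiener space of `S`: functions in `L₂(ℝ^d)` whose Fourier transform vanishes almost
everywhere outside `S`. For bounded `S` every such class has exactly one continuous
representative, and an element of the space is that representative, so that point values
make sense. -/
def PaleyWiener {d : ℕ} (S : Set (Rd d)) : Set (Rd d → ℂ) :=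
  {f | Continuous f ∧ ∃ h : MemLp f 2 volume, ∀ᵐ ξ, ξ ∉ S → fourierL2 (h.toLp f) ξ = 0}

/-- A Riesz basis of a Hilbert space: every element has a unique expansion with square-summable
coefficients, and the synthesis map is bounded above and below on all of `ℓ₂`. -/
structure IsRieszBasis {H : Type*} [NormedAddCommGroup H] [InnerProductSpace ℂ H]
    (φ : ℕ → H) : Prop where
  existsUnique_expansion : ∀ h : H, ∃! a : ℕ → ℂ,
    Summable (fun j => ‖a j‖ ^ 2) ∧ HasSum (fun j => a j • φ j) h
  bounds : ∃ R : ℝ, 0 < R ∧ ∀ c : ℕ → ℂ, Summable (fun j => ‖c j‖ ^ 2) →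
    Summable (fun j => c j • φ j) ∧
    1 / R * Real.sqrt (∑' j, ‖c j‖ ^ 2) ≤ ‖∑' j, c j • φ j‖ ∧
    ‖∑' j, c j • φ j‖ ≤ R * Real.sqrt (∑' j, ‖c j‖ ^ 2)

/-- A convex body that is symmetric about the origin. -/
structure IsSymmetricConvexBody {d : ℕ} (Z : Set (Rd d)) : Prop where
  isCompact : IsCompact Z
  convex : Convex ℝ Z
  symmetric : ∀ x ∈ Z, -x ∈ Z
  interior_nonempty : (interior Z).Nonempty

/-- `X` is a Riesz-basis sequence for `L₂(Z)`: the exponentials `exp(-i⟨x_j, ·⟩)`, as elements of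
`L₂(Z)`, form a Riesz basis of `L₂(Z)`. -/
def IsRieszBasisSequence {d : ℕ} (Z : Set (Rd d)) (X : ℕ → Rd d) : Prop :=
  ∃ e : ℕ → Lp ℂ 2 (volume.restrict Z),
    (∀ j, (e j : Rd d → ℂ) =ᵐ[volume.restrict Z]
      fun ξ => Complex.exp (-Complex.I * ((inner ℝ (X j) ξ : ℝ) : ℂ))) ∧
    IsRieszBasis e

/-- `M_j = sup { |φ̂(2^j u)| : u ∈ Z \ ½Z }`. -/
def dyadicSup {d : ℕ} (Z : Set (Rd d)) (φ : Rd d → ℂ) (j : ℕ) : ℝ≥0∞ :=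
  ⨆ u ∈ Z \ ((1 / 2 : ℝ) • Z), ‖fourierHat φ ((2 : ℝ) ^ j • u)‖ₑ

/-- `∑_{j ≥ 1} 2^(jd/2) M_j`. -/
def dyadicSum {d : ℕ} (Z : Set (Rd d)) (φ : Rd d → ℂ) : ℝ≥0∞ :=
  ∑' j : ℕ, (2 : ℝ≥0∞) ^ (((j + 1 : ℕ) : ℝ) * (d : ℝ) / 2) * dyadicSup Z φ (j + 1)

/-- A `d`-dimensional interpolator for the Paley-Wiener space of `Z`; the function is
real-valued. -/
structure IsInterpolator {d : ℕ} (Z : Set (Rd d)) (φ : Rd d → ℂ) : Prop where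
  real_valued : ∀ x, (φ x).im = 0
  integrable : Integrable φ
  continuous : Continuous φ
  integrable_hat : Integrable (fourierHat φ)
  hat_nonneg : ∀ ξ, 0 ≤ (fourierHat φ ξ).re ∧ (fourierHat φ ξ).im = 0
  hat_lower : ∃ ε : ℝ, 0 < ε ∧ ∀ ξ ∈ Z, ε ≤ (fourierHat φ ξ).re
  dyadic_summable : dyadicSum Z φ ≠ ∞

/-- `sup { |φ̂(u)| : u ∈ B₂ \ δB₂ }`. -/
def annulusSup {d : ℕ} (δ : ℝ) (φ : Rd d → ℂ) : ℝ≥0∞ :=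
  ⨆ u ∈ Metric.closedBall (0 : Rd d) 1 \ Metric.closedBall (0 : Rd d) δ, ‖fourierHat φ u‖ₑ

/-- `inf { |φ̂(u)| : u ∈ rB₂ }`. -/
def ballInf {d : ℕ} (r : ℝ) (φ : Rd d → ℂ) : ℝ≥0∞ :=
  ⨅ u ∈ Metric.closedBall (0 : Rd d) r, ‖fourierHat φ u‖ₑ

/-- A family `(φ_α)_{α ∈ A}` of `d`-dimensional interpolators for the Paley-Wiener space of `Z`
that is regular for the Paley-Wiener space of `βB₂`, where `δB₂ ⊆ Z ⊆ B₂`. -/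
structure IsRegularFamily {d : ℕ} (Z : Set (Rd d)) (δ β : ℝ) (A : Set ℝ)
    (φ : ℝ → Rd d → ℂ) : Prop where
  beta_pos : 0 < β
  index_pos : A ⊆ Ioi 0
  index_unbounded : ¬ BddAbove A
  interpolator : ∀ α ∈ A, IsInterpolator Z (φ α)
  sum_le : ∃ C : ℝ≥0, ∀ᶠ α in atTop, α ∈ A → dyadicSum Z (φ α) ≤ C * annulusSup δ (φ α)
  ratio_tendsto : Tendsto
    (fun α => annulusSup δ (φ α) ^ 3 / (ballInf β (φ α) * ballInf 1 (φ α) ^ 2))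
    (atTop ⊓ 𝓟 A) (𝓝 0)

/-- `a` is a square-summable solution of `∑_j a_j φ(x_k - x_j) = f(x_k)`, `k ∈ ℕ`. -/
def IsInterpolationCoeff {d : ℕ} (φ : Rd d → ℂ) (X : ℕ → Rd d) (f : Rd d → ℂ)
    (a : ℕ → ℂ) : Prop :=
  Summable (fun j => ‖a j‖ ^ 2) ∧ ∀ k, HasSum (fun j => a j * φ (X k - X j)) (f (X k))

/-- The coefficients of the interpolant, meaningful when a solution exists and is unique. -/
def interpolationCoeff {d : ℕ} (φ : Rd d → ℂ) (X : ℕ → Rd d) (f : Rd d → ℂ) : ℕ → ℂ :=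
  Classical.epsilon (IsInterpolationCoeff φ X f)

/-- The interpolant `∑_j a_j φ(· - x_j)` of `f` at `X`. -/
def interpolant {d : ℕ} (φ : Rd d → ℂ) (X : ℕ → Rd d) (f : Rd d → ℂ) (x : Rd d) : ℂ :=
  ∑' j, interpolationCoeff φ X f j * φ (x - X j)

/-- The kernel `g_α(x) = (2π)^(-d/2) ∫ exp(-α‖ξ‖^p) exp(i⟨x, ξ⟩) dξ`. -/
def stableKernel (d : ℕ) (p α : ℝ) (x : Rd d) : ℂ :=
  (((2 * Real.pi) ^ (-(d : ℝ) / 2) : ℝ) : ℂ) *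
    ∫ ξ : Rd d, ((Real.exp (-α * ‖ξ‖ ^ p) : ℝ) : ℂ) *
      Complex.exp (Complex.I * ((inner ℝ x ξ : ℝ) : ℂ))

end

/-!
The interpolation problem is solved in a Hilbert space. Let `F_α(ξ) = exp(-α‖ξ‖^p)` and let
`K = L₂(F_α dξ)` (`NativeSpace`), an element `w` of which stands for the function with Fourier
transform `F_α w` (`nativeHat`). In `K` the exponentials `E_x = exp(-i⟨x, ·⟩)` reproduce point
values, and up to the factor `(2π)^(-d/2)` the kernel `g_α(x - y)` is `⟨E_x, E_y⟩`. Hence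
interpolation at the points `x_j` is the Gram system of `(E_{x_j})`, and the interpolant of the
function represented by `u` is represented by the orthogonal projection `v` of `u` onto the closed
span of the `E_{x_j}`. Unique solvability in `ℓ₂` amounts to `(E_{x_j})` being a Riesz sequence in
`K` (`exists_gram_solution`, `exists_interpolation`). It is one since the Riesz bounds of
exponential sums on `Z` hold on all translates of `Z` with the same constant, and averaging over
the translates with densities dominated by, or dominating, `F_α` gives bounds with weight `F_α`
(`HasRieszBounds.lower_stable`, `HasRieszBounds.upper_stable`).

For the error put `w = v - u`, which is orthogonal to `v` and to all `E_{x_j}`. Three estimates are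
combined for `α ≥ 1`. If `f` is band-limited to `βB₂`, then `‖w‖² = -⟨w, u⟩` is at most
`exp(αβ^p) ‖F_α w‖ ‖f‖` (`native_enorm_sq_le`). Orthogonality to the exponentials bounds the part
of `F_α w` in `Z` by the part outside, where `F_α ≤ exp(-αδ^p)`, so that
`‖F_α w‖² ≤ C exp(-αδ^p) ‖w‖²` (`eLpNorm_nativeHat_sq_le_of_orthogonal`). Together they give
`‖F_α w‖ ≤ C exp(α(β^p - δ^p)) ‖f‖`, and Plancherel's theorem turns this into the `L₂` estimate;
the uniform estimate follows by the Cauchy-Schwarz inequality on `Z` and on its complement. As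
`δ ≤ 1`, the exponent is at most `β^p + 2 - 3δ^p`. For `α ≤ 1` the frame bounds control the
interpolant directly (`error_le_of_le_one`).

The integrability of `g_α` itself is not obvious, as the symbol need not be smooth at the origin.
It follows from writing `exp(-α‖ξ‖^p)` as a superposition of dilates of `(1 - ‖ξ‖²)_+^k`, with an
integrable density obtained from Taylor's formula at infinity for `exp(-α s^(p/2))`
(`exp_eq_integral_truncated_pow`): dilation preserves the `L₁` norm of the Fourier transform, and
for large `k` that of the truncated power is finite.
-/

/-! ### The inverse Fourier transform in the symmetric normalization -/

/-- The normalizing factor `(2π)^(-d/2)`. -/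
noncomputable def fourierConst (d : ℕ) : ℝ := (2 * Real.pi) ^ (-(d : ℝ) / 2)

/-- The inverse Fourier transform `(2π)^(-d/2) ∫ φ(ξ) exp(i⟨x, ξ⟩) dξ` of an integrable function,
inverse to `fourierHat`. -/
noncomputable def invHat {d : ℕ} (φ : Rd d → ℂ) (x : Rd d) : ℂ :=
  (fourierConst d : ℂ) * ∫ ξ, φ ξ * Complex.exp (Complex.I * ((inner ℝ x ξ : ℝ) : ℂ))

lemma fourierConst_pos (d : ℕ) : 0 < fourierConst d :=
  Real.rpow_pos_of_pos (by positivity) _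

lemma fourierConst_sq_mul (d : ℕ) : fourierConst d ^ 2 * (2 * Real.pi) ^ d = 1 := by
  have h : (0 : ℝ) < 2 * Real.pi := by positivity
  rw [fourierConst, ← Real.rpow_natCast, ← Real.rpow_mul h.le, ← Real.rpow_natCast _ d,
    ← Real.rpow_add h]
  norm_num

lemma invHat_eq_fourierInv {d : ℕ} (φ : Rd d → ℂ) (x : Rd d) :
    invHat φ x = (fourierConst d : ℂ) * 𝓕⁻ φ ((2 * Real.pi)⁻¹ • x) := by
  rw [invHat, Real.fourierInv_eq']
  congr 1
  refine integral_congr_ae (ae_of_all _ fun ξ => ?_)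
  have h : (Real.pi : ℂ) ≠ 0 := by exact_mod_cast Real.pi_ne_zero
  simp only [inner_smul_right, smul_eq_mul, real_inner_comm x ξ]
  rw [mul_comm]
  congr 2
  push_cast
  field_simp

lemma continuous_fourierInv {d : ℕ} {φ : Rd d → ℂ} (hφ : Integrable φ) : Continuous (𝓕⁻ φ) := by
  have h : Continuous (𝓕 φ) := VectorFourier.fourierIntegral_continuous
    Real.continuous_fourierChar (L := innerₗ (Rd d)) continuous_inner hφ
  have : 𝓕⁻ φ = fun x => 𝓕 φ (-x) := funext fun x => Real.fourierInv_eq_fourier_neg φ x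
  rw [this]
  exact h.comp continuous_neg

lemma continuous_invHat {d : ℕ} {φ : Rd d → ℂ} (hφ : Integrable φ) : Continuous (invHat φ) := by
  have : invHat φ = fun x => (fourierConst d : ℂ) * 𝓕⁻ φ ((2 * Real.pi)⁻¹ • x) :=
    funext (invHat_eq_fourierInv φ)
  rw [this]
  exact continuous_const.mul ((continuous_fourierInv hφ).comp (continuous_const_smul _))

lemma finrank_Rd (d : ℕ) : Module.finrank ℝ (Rd d) = d := by simp

/-- The square of the normalizing factor is the Jacobian of the change of variables by `2π`. -/
lemma fourierConst_sq_smul_integral {d : ℕ} (f : Rd d → ℂ) :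
    (fourierConst d : ℂ) ^ 2 * ∫ x, f ((2 * Real.pi)⁻¹ • x) = ∫ x, f x := by
  rw [Measure.integral_comp_inv_smul_of_nonneg _ _ (by positivity : (0 : ℝ) ≤ 2 * Real.pi),
    finrank_Rd, Complex.real_smul, ← mul_assoc]
  have := fourierConst_sq_mul d
  have h : ((fourierConst d : ℂ) ^ 2 * (((2 * Real.pi) ^ d : ℝ) : ℂ)) = 1 := by
    exact_mod_cast this
  rw [h, one_mul]

/-- Fourier inversion. -/
lemma fourierHat_invHat {d : ℕ} {φ : Rd d → ℂ} (hc : Continuous φ) (hi : Integrable φ)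
    (h : Integrable (𝓕 φ)) : fourierHat (invHat φ) = φ := by
  ext ξ
  have h1 := congrFun (hc.fourier_fourierInv_eq hi h) ξ
  rw [Real.fourier_eq'] at h1
  rw [← fourierConst_sq_smul_integral] at h1
  rw [fourierHat, ← h1, sq, mul_assoc, ← fourierConst,
    ← integral_const_mul (fourierConst d : ℂ) (fun x : Rd d => _ • _)]
  refine congrArg (fun t => (fourierConst d : ℂ) * t) ?_
  refine integral_congr_ae (ae_of_all _ fun x => ?_)
  have hp : (Real.pi : ℂ) ≠ 0 := by exact_mod_cast Real.pi_ne_zero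
  simp only [invHat_eq_fourierInv, inner_smul_left, smul_eq_mul, real_inner_comm x ξ]
  rw [mul_assoc, mul_comm (𝓕⁻ φ _)]
  congr 3
  simp
  field_simp

/-! ### Plancherel's theorem for square-integrable integrable functions -/

/-- For an integrable `L²` function, the `L²` inverse Fourier transform is given by the
integral. Both sides agree as tempered distributions. -/
lemma fourierInv_toLp_ae_eq {d : ℕ} {φ : Rd d → ℂ} (hi : Integrable φ) (h2 : MemLp φ 2 volume) :
    ((𝓕⁻ (h2.toLp φ) : Lp ℂ 2 (volume : Measure (Rd d))) : Rd d → ℂ) =ᵐ[volume] 𝓕⁻ φ := by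
  refine ae_eq_of_integral_contDiff_smul_eq
    ((Lp.memLp _).locallyIntegrable (by norm_num)) (continuous_fourierInv hi).locallyIntegrable ?_
  intro g g_smooth g_cpt
  have hg₁ : HasCompactSupport (Complex.ofRealCLM ∘ g) := g_cpt.comp_left rfl
  have hg₂ : ContDiff ℝ (⊤ : ℕ∞) (Complex.ofRealCLM ∘ g) :=
    Complex.ofRealCLM.contDiff.comp g_smooth
  set G : SchwartzMap (Rd d) ℂ := hg₁.toSchwartzMap hg₂
  have hG : ∀ x, G x = (g x : ℂ) := fun x => rfl
  have key := congrArg (fun T => T G)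
    (Lp.fourierInv_toTemperedDistribution_eq (h2.toLp φ))
  simp only [TemperedDistribution.fourierInv_apply, Lp.toTemperedDistribution_apply] at key
  calc ∫ x, g x • ((𝓕⁻ (h2.toLp φ) : Lp ℂ 2 (volume : Measure (Rd d))) : Rd d → ℂ) x
      = ∫ x, G x • ((𝓕⁻ (h2.toLp φ) : Lp ℂ 2 (volume : Measure (Rd d))) : Rd d → ℂ) x := by
        simp [hG]
    _ = ∫ x, (𝓕⁻ G) x • (h2.toLp φ : Rd d → ℂ) x := key.symm
    _ = ∫ x, (𝓕⁻ (G : Rd d → ℂ)) x • φ x := by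
        refine integral_congr_ae ?_
        filter_upwards [h2.coeFn_toLp] with x hx
        rw [hx, SchwartzMap.fourierInv_coe]
    _ = ∫ x, G x • 𝓕⁻ φ x := by
        have := VectorFourier.integral_fourierIntegral_smul_eq_flip (μ := volume) (ν := volume)
          (L := -innerₗ (Rd d)) (f := (G : Rd d → ℂ)) (g := φ)
          Real.continuous_fourierChar (by simpa using! continuous_inner.neg) G.integrable hi
        convert this using 1
        · refine integral_congr_ae (ae_of_all _ fun x => ?_)
          simp only [VectorFourier.fourierIntegral, Real.fourierInv_eq]
          simp
        · refine integral_congr_ae (ae_of_all _ fun x => ?_)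
          simp only [VectorFourier.fourierIntegral, Real.fourierInv_eq]
          simp [real_inner_comm]
    _ = _ := by simp [hG]

lemma lintegral_comp_smul {d : ℕ} (f : Rd d → ℝ≥0∞) {r : ℝ} (hr : 0 < r) :
    ∫⁻ x, f (r • x) = ENNReal.ofReal ((r ^ d)⁻¹) * ∫⁻ x, f x := by
  have h := lintegral_map_equiv (μ := volume) f
    (Homeomorph.smulOfNeZero r hr.ne' : Rd d ≃ₜ Rd d).toMeasurableEquiv
  change ∫⁻ x, f x ∂(Measure.map (r • ·) volume) = ∫⁻ x, f (r • x) at h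
  rw [← h, Measure.map_addHaar_smul _ hr.ne', lintegral_smul_measure, finrank_Rd,
    abs_of_pos (by positivity), smul_eq_mul]

/-- Plancherel's theorem, for the transform given by the integral. -/
lemma lintegral_enorm_invHat_sq {d : ℕ} {φ : Rd d → ℂ} (hi : Integrable φ)
    (h2 : MemLp φ 2 volume) : ∫⁻ x, ‖invHat φ x‖ₑ ^ 2 = ∫⁻ ξ, ‖φ ξ‖ₑ ^ 2 := by
  have h1 : eLpNorm (𝓕⁻ φ) 2 volume = eLpNorm φ 2 volume := by
    rw [← eLpNorm_congr_ae (fourierInv_toLp_ae_eq hi h2), ← Lp.enorm_def,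
      ← eLpNorm_congr_ae h2.coeFn_toLp, ← Lp.enorm_def, ← enorm_norm, ← enorm_norm (h2.toLp φ)]
    congr 1
    exact (Lp.fourierTransformₗᵢ (Rd d) ℂ).symm.norm_map _
  have h3 : ∫⁻ x, ‖𝓕⁻ φ x‖ₑ ^ 2 = ∫⁻ ξ, ‖φ ξ‖ₑ ^ 2 := by
    have e := fun g : Rd d → ℂ => eLpNorm_nnreal_pow_eq_lintegral (f := g) (μ := volume)
      (p := 2) (by norm_num)
    have := e φ
    have h' := e (𝓕⁻ φ)
    simp only [ENNReal.coe_ofNat, NNReal.coe_ofNat, ENNReal.rpow_ofNat] at this h'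
    rw [← this, ← h', h1]
  simp_rw [invHat_eq_fourierInv, enorm_mul, mul_pow]
  rw [lintegral_const_mul' _ _ (by finiteness),
    lintegral_comp_smul (fun x => ‖𝓕⁻ φ x‖ₑ ^ 2) (by positivity : (0 : ℝ) < (2 * Real.pi)⁻¹), h3,
    ← mul_assoc]
  have : ‖(fourierConst d : ℂ)‖ₑ ^ 2 * ENNReal.ofReal (((2 * Real.pi)⁻¹ ^ d)⁻¹) = 1 := by
    rw [inv_pow, inv_inv, ← ofReal_norm, ← ENNReal.ofReal_pow (norm_nonneg _),
      ← ENNReal.ofReal_mul (by positivity)]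
    simp [fourierConst_sq_mul]
  rw [this, one_mul]

lemma eLpNorm_two_sq {X : Type*} [MeasurableSpace X] {E : Type*} [NormedAddCommGroup E]
    (f : X → E) (μ : Measure X) : eLpNorm f 2 μ ^ 2 = ∫⁻ x, ‖f x‖ₑ ^ 2 ∂μ := by
  have := eLpNorm_nnreal_pow_eq_lintegral (f := f) (μ := μ) (p := 2) (by norm_num)
  simpa only [ENNReal.coe_ofNat, NNReal.coe_ofNat, ENNReal.rpow_ofNat] using this

lemma eLpNorm_invHat {d : ℕ} {φ : Rd d → ℂ} (hi : Integrable φ)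
    (h2 : MemLp φ 2 volume) : eLpNorm (invHat φ) 2 volume = eLpNorm φ 2 volume := by
  have := lintegral_enorm_invHat_sq hi h2
  rw [← eLpNorm_two_sq, ← eLpNorm_two_sq] at this
  exact (ENNReal.pow_right_strictMono two_ne_zero).injective this

lemma memLp_invHat {d : ℕ} {φ : Rd d → ℂ} (hi : Integrable φ)
    (h2 : MemLp φ 2 volume) : MemLp (invHat φ) 2 volume :=
  ⟨(continuous_invHat hi).aestronglyMeasurable, by rw [eLpNorm_invHat hi h2]; exact h2.2⟩

/-- Functions in the Paley-Wiener space of a bounded set are inverse Fourier transforms of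
integrable `L²` functions supported in that set. -/
lemma PaleyWiener.exists_invHat {d : ℕ} {S : Set (Rd d)} (hS : MeasurableSet S) {r : ℝ}
    (hr : S ⊆ Metric.closedBall 0 r) {f : Rd d → ℂ} (hf : f ∈ PaleyWiener S) :
    ∃ φ : Rd d → ℂ, MemLp φ 2 volume ∧ Integrable φ ∧ (∀ ξ, ξ ∉ S → φ ξ = 0) ∧
      f = invHat φ := by
  obtain ⟨hfc, h, hz⟩ := hf
  set g : Lp ℂ 2 (volume : Measure (Rd d)) := 𝓕 (h.toLp f) with hg
  have hpi : (0 : ℝ) < 2 * Real.pi := by positivity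
  have hc : (fourierConst d : ℂ) ≠ 0 := by exact_mod_cast (fourierConst_pos d).ne'
  set T : Set (Rd d) := (fun v => (2 * Real.pi) • v) ⁻¹' S with hT
  have hTm : MeasurableSet T := (measurable_const_smul _) hS
  -- the set where the transform might fail to vanish, in the coordinates of Mathlib's transform
  have hgT : (g : Rd d → ℂ) =ᵐ[volume] T.indicator g := by
    have hq : Measure.QuasiMeasurePreserving (fun v : Rd d => (2 * Real.pi) • v) volume volume :=
      ⟨measurable_const_smul _, by
        rw [Measure.map_addHaar_smul _ hpi.ne']
        exact Measure.smul_absolutelyContinuous⟩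
    filter_upwards [hq.ae hz] with v hv
    by_cases hvT : v ∈ T
    · simp [hvT]
    · rw [indicator_of_notMem hvT]
      have := hv hvT
      simp only [fourierL2, smul_smul, inv_mul_cancel₀ hpi.ne', one_smul] at this
      exact (mul_eq_zero.mp this).resolve_left hc
  have hTfin : volume T < ∞ := by
    refine (measure_mono ?_).trans_lt (measure_closedBall_lt_top (x := (0 : Rd d)) (r := r))
    intro v hv
    have := hr hv
    simp only [Metric.mem_closedBall, dist_zero_right, norm_smul, Real.norm_eq_abs,
      abs_of_pos hpi] at this ⊢
    have h1 : (1 : ℝ) ≤ 2 * Real.pi := by linarith [Real.pi_gt_three]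
    nlinarith [norm_nonneg v]
  have hG2 : MemLp (T.indicator (g : Rd d → ℂ)) 2 volume := (Lp.memLp g).indicator hTm
  have hGi : Integrable (T.indicator (g : Rd d → ℂ)) := by
    rw [integrable_indicator_iff hTm]
    have : IsFiniteMeasure (volume.restrict T) := ⟨by simpa using hTfin⟩
    exact ((Lp.memLp g).restrict T).integrable (by norm_num)
  set G := T.indicator (g : Rd d → ℂ) with hGdef
  have hfG : f = 𝓕⁻ G := by
    have h1 : hG2.toLp G = g := by
      apply Lp.ext
      filter_upwards [hG2.coeFn_toLp, hgT] with x hx hx'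
      rw [hx, ← hx']
    have h2 := fourierInv_toLp_ae_eq hGi hG2
    rw [h1, hg, FourierTransform.fourierInv_fourier_eq] at h2
    exact (hfc.ae_eq_iff_eq volume (continuous_fourierInv hGi)).mp
      (h.coeFn_toLp.symm.trans h2)
  have hfin : ∀ x, f x = invHat (fun ξ => (fourierConst d : ℂ) * G ((2 * Real.pi)⁻¹ • ξ)) x := by
    intro x
    rw [hfG, Real.fourierInv_eq', ← fourierConst_sq_smul_integral, invHat, sq, mul_assoc,
      ← integral_const_mul (fourierConst d : ℂ)]
    congr 1
    refine integral_congr_ae (ae_of_all _ fun ξ => ?_)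
    have hp : (Real.pi : ℂ) ≠ 0 := by exact_mod_cast Real.pi_ne_zero
    simp only [inner_smul_left, smul_eq_mul, real_inner_comm x ξ]
    rw [mul_comm (Complex.exp _), ← mul_assoc]
    congr 2
    simp
    field_simp
  have hGi' : Integrable (fun ξ => G ((2 * Real.pi)⁻¹ • ξ)) :=
    (integrable_comp_smul_iff volume G (by positivity)).mpr hGi
  -- the spectrum is that of Mathlib's transform, rescaled by `1/(2π)`
  refine ⟨fun ξ => (fourierConst d : ℂ) * G ((2 * Real.pi)⁻¹ • ξ), ?_, ?_, ?_, funext hfin⟩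
  · refine MemLp.const_mul ?_ _
    refine ⟨hGi'.1, ?_⟩
    have := lintegral_comp_smul (fun x => ‖G x‖ₑ ^ 2) (by positivity : (0 : ℝ) < (2 * Real.pi)⁻¹)
    have h3 : eLpNorm (fun ξ => G ((2 * Real.pi)⁻¹ • ξ)) 2 volume ^ 2 < ∞ := by
      rw [eLpNorm_two_sq, this, ← eLpNorm_two_sq]
      exact ENNReal.mul_lt_top ENNReal.ofReal_lt_top (ENNReal.pow_lt_top hG2.2)
    by_contra hcon
    rw [not_lt, top_le_iff] at hcon
    rw [hcon] at h3
    simp at h3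
  · exact hGi'.const_mul _
  · intro ξ hξ
    have : (2 * Real.pi)⁻¹ • ξ ∉ T := by
      simp only [hT, mem_preimage, smul_smul, mul_inv_cancel₀ hpi.ne', one_smul]
      exact hξ
    simp only [hGdef, indicator_of_notMem this, mul_zero]

/-! ### Derivatives of stretched exponentials -/

/-- The polynomials `P_k` with
`(d/ds)^k exp(-α s^q) = s^(-k) P_k(α s^q) exp(-α s^q)` for `s > 0`. -/
noncomputable def stretchedPoly (q : ℝ) : ℕ → Polynomial ℝ
  | 0 => 1
  | k + 1 => Polynomial.C q * Polynomial.X * (stretchedPoly q k).derivative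
      - Polynomial.C (k : ℝ) * stretchedPoly q k
      - Polynomial.C q * Polynomial.X * stretchedPoly q k

/-- The constant term vanishes from the first derivative on; this cancels the singularity of `s⁻¹`
at the origin. -/
lemma stretchedPoly_coeff_zero (q : ℝ) (k : ℕ) : (stretchedPoly q (k + 1)).coeff 0 = 0 := by
  induction k with
  | zero => simp [stretchedPoly]
  | succ k ih =>
    rw [stretchedPoly]
    simp only [Polynomial.coeff_sub, mul_assoc, Polynomial.coeff_C_mul, ih]
    simp

/-- The `k`-th derivative of `exp(-α s^q)` at `s > 0`. -/
noncomputable def stretchedDeriv (q α : ℝ) (k : ℕ) (s : ℝ) : ℝ :=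
  s ^ (-(k : ℝ)) * (stretchedPoly q k).eval (α * s ^ q) * Real.exp (-α * s ^ q)

lemma hasDerivAt_stretchedDeriv (q α : ℝ) (k : ℕ) {s : ℝ} (hs : 0 < s) :
    HasDerivAt (stretchedDeriv q α k) (stretchedDeriv q α (k + 1) s) s := by
  have h1 : HasDerivAt (fun s : ℝ => s ^ (-(k : ℝ))) (-(k : ℝ) * s ^ (-(k : ℝ) - 1)) s :=
    Real.hasDerivAt_rpow_const (Or.inl hs.ne')
  have h2 : HasDerivAt (fun s : ℝ => α * s ^ q) (α * (q * s ^ (q - 1))) s :=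
    (Real.hasDerivAt_rpow_const (Or.inl hs.ne')).const_mul α
  have h3 : HasDerivAt (fun s : ℝ => (stretchedPoly q k).eval (α * s ^ q))
      ((stretchedPoly q k).derivative.eval (α * s ^ q) * (α * (q * s ^ (q - 1)))) s :=
    HasDerivAt.comp (h₂ := fun y => (stretchedPoly q k).eval y) s
      ((stretchedPoly q k).hasDerivAt (α * s ^ q)) h2
  have h4 : HasDerivAt (fun s : ℝ => Real.exp (-α * s ^ q))
      (Real.exp (-α * s ^ q) * (-α * (q * s ^ (q - 1)))) s :=
    ((Real.hasDerivAt_rpow_const (Or.inl hs.ne')).const_mul (-α)).exp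
  refine ((h1.mul h3).mul h4).congr_deriv ?_
  have e1 : s ^ (-(k : ℝ) - 1) = s ^ (-(k : ℝ)) / s := Real.rpow_sub_one hs.ne' _
  have e2 : s ^ (q - 1) = s ^ q / s := Real.rpow_sub_one hs.ne' _
  have e3 : s ^ (-((k + 1 : ℕ) : ℝ)) = s ^ (-(k : ℝ)) / s := by
    rw [← e1]; congr 1; push_cast; ring
  rw [stretchedDeriv, stretchedPoly, e1, e2, e3]
  simp only [Polynomial.eval_sub, Polynomial.eval_mul, Polynomial.eval_C, Polynomial.eval_X,
    Pi.mul_apply]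
  field_simp
  ring

/-- Weights `s^a Q(α s^q) exp(-α s^q)` with `Q(0) = 0` are integrable on the half-line for
`a ≥ -1`. -/
lemma integrableOn_rpow_mul_eval_mul_exp {q α a : ℝ} (hq : 0 < q) (hα : 0 < α) (ha : -1 ≤ a)
    {Q : Polynomial ℝ} (hQ : Q.coeff 0 = 0) :
    IntegrableOn (fun s : ℝ => s ^ a * Q.eval (α * s ^ q) * Real.exp (-α * s ^ q)) (Ioi 0) := by
  have h : IntegrableOn (fun s : ℝ => ∑ i ∈ Finset.range (Q.natDegree + 1),
      (Q.coeff i * α ^ i) * (s ^ (a + q * i) * Real.exp (-α * s ^ q))) (Ioi 0) := by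
    refine integrable_finsetSum _ fun i _ => ?_
    rcases Nat.eq_zero_or_pos i with rfl | hi
    · simp [hQ]
    · refine (integrableOn_rpow_mul_exp_neg_mul_rpow ?_ hq hα).const_mul _
      have : 0 < q * i := by positivity
      linarith
  refine h.congr_fun (fun s hs => ?_) measurableSet_Ioi
  have hs' : (0 : ℝ) < s := hs
  simp only
  rw [Polynomial.eval_eq_sum_range, Finset.mul_sum, Finset.sum_mul]
  refine Finset.sum_congr rfl fun i _ => ?_
  rw [Real.rpow_add hs', Real.rpow_mul hs'.le, Real.rpow_natCast, mul_pow]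
  ring

lemma measurable_stretchedDeriv (q α : ℝ) (k : ℕ) : Measurable (stretchedDeriv q α k) := by
  unfold stretchedDeriv
  have : Measurable fun s : ℝ => (stretchedPoly q k).eval (α * s ^ q) :=
    (stretchedPoly q k).continuous.measurable.comp (by fun_prop)
  fun_prop

lemma stretchedDeriv_mul_pow (q α : ℝ) (k : ℕ) {s : ℝ} (hs : 0 < s) :
    s ^ k * stretchedDeriv q α k s =
      (stretchedPoly q k).eval (α * s ^ q) * Real.exp (-α * s ^ q) := by
  rw [stretchedDeriv, Real.rpow_neg hs.le, Real.rpow_natCast]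
  have : s ^ k ≠ 0 := by positivity
  field_simp

lemma integrableOn_sub_pow_mul_stretchedDeriv {q α : ℝ} (hq : 0 < q) (hα : 0 < α) (k : ℕ)
    {u : ℝ} (hu : 0 < u) :
    IntegrableOn (fun s => (s - u) ^ k * stretchedDeriv q α (k + 1) s) (Ioi u) := by
  have h := (integrableOn_rpow_mul_eval_mul_exp hq hα le_rfl
    (stretchedPoly_coeff_zero q k)).mono_set (Ioi_subset_Ioi hu.le)
  refine Integrable.mono h ?_ ?_
  · exact ((by fun_prop : Measurable fun s : ℝ => (s - u) ^ k).mul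
      (measurable_stretchedDeriv q α (k + 1))).aestronglyMeasurable
  · refine (ae_restrict_iff' measurableSet_Ioi).mpr (ae_of_all _ fun s hs => ?_)
    have hs' : u < s := hs
    have h0 : 0 < s := hu.trans hs'
    have e : s ^ (-1 : ℝ) * (stretchedPoly q (k + 1)).eval (α * s ^ q) * Real.exp (-α * s ^ q)
        = s ^ k * stretchedDeriv q α (k + 1) s := by
      rw [mul_assoc, ← stretchedDeriv_mul_pow q α (k + 1) h0, Real.rpow_neg_one, pow_succ]
      field_simp
    rw [e, norm_mul, norm_mul]
    refine mul_le_mul_of_nonneg_right ?_ (norm_nonneg _)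
    rw [Real.norm_of_nonneg (by have := sub_pos.mpr hs'; positivity),
      Real.norm_of_nonneg (by positivity)]
    exact pow_le_pow_left₀ (sub_nonneg.mpr hs'.le) (by linarith) k

lemma tendsto_sub_pow_mul_stretchedDeriv {q α : ℝ} (hq : 0 < q) (hα : 0 < α) (k : ℕ)
    {u : ℝ} (hu : 0 < u) :
    Tendsto (fun s => (s - u) ^ k * stretchedDeriv q α k s) atTop (𝓝 0) := by
  have h1 : Tendsto (fun s : ℝ => α * s ^ q) atTop atTop :=
    (tendsto_rpow_atTop hq).const_mul_atTop hα
  have h2 := ((stretchedPoly q k).tendsto_div_exp_atTop.comp h1).norm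
  rw [norm_zero] at h2
  refine squeeze_zero_norm' ?_ h2
  filter_upwards [eventually_gt_atTop u] with s hs
  have h0 : 0 < s := hu.trans hs
  have e : (stretchedPoly q k).eval (α * s ^ q) / Real.exp (α * s ^ q)
      = s ^ k * stretchedDeriv q α k s := by
    rw [stretchedDeriv_mul_pow q α k h0, neg_mul, Real.exp_neg, div_eq_mul_inv]
  simp only [Function.comp]
  rw [e, norm_mul, norm_mul]
  refine mul_le_mul_of_nonneg_right ?_ (norm_nonneg _)
  rw [Real.norm_of_nonneg (by have := sub_pos.mpr hs; positivity),
    Real.norm_of_nonneg (by positivity)]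
  exact pow_le_pow_left₀ (sub_nonneg.mpr hs.le) (by linarith) k

/-- Taylor's formula at infinity, by repeated integration by parts. -/
lemma integral_sub_pow_mul_stretchedDeriv {q α : ℝ} (hq : 0 < q) (hα : 0 < α) (k : ℕ)
    {u : ℝ} (hu : 0 < u) :
    ∫ s in Ioi u, (s - u) ^ k * stretchedDeriv q α (k + 1) s =
      (-1) ^ (k + 1) * (k.factorial : ℝ) * Real.exp (-α * u ^ q) := by
  have hcont : ∀ k, ContinuousWithinAt (fun s => (s - u) ^ k * stretchedDeriv q α k s) (Ici u) u :=
    fun k => (((continuous_id.sub continuous_const).pow k).continuousAt.mul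
      (hasDerivAt_stretchedDeriv q α k hu).continuousAt).continuousWithinAt
  induction k with
  | zero =>
    have h := integral_Ioi_of_hasDerivAt_of_tendsto (hcont 0)
      (f' := fun s => (s - u) ^ 0 * stretchedDeriv q α (0 + 1) s)
      (fun s hs => by
        simpa using hasDerivAt_stretchedDeriv q α 0 (hu.trans hs))
      (integrableOn_sub_pow_mul_stretchedDeriv hq hα 0 hu)
      (tendsto_sub_pow_mul_stretchedDeriv hq hα 0 hu)
    rw [h]
    simp [stretchedDeriv, stretchedPoly]
  | succ k ih =>
    have hi1 := (integrableOn_sub_pow_mul_stretchedDeriv hq hα k hu).const_mul ((k : ℝ) + 1)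
    have hi2 := integrableOn_sub_pow_mul_stretchedDeriv hq hα (k + 1) hu
    have h := integral_Ioi_of_hasDerivAt_of_tendsto (hcont (k + 1))
      (f' := fun s => ((k : ℝ) + 1) * ((s - u) ^ k * stretchedDeriv q α (k + 1) s)
        + (s - u) ^ (k + 1) * stretchedDeriv q α (k + 1 + 1) s)
      (fun s hs => by
        have h1 := (((hasDerivAt_id s).sub_const u).pow (k + 1)).mul
          (hasDerivAt_stretchedDeriv q α (k + 1) (hu.trans hs))
        refine h1.congr_deriv ?_
        simp
        ring)
      (hi1.add hi2)
      (tendsto_sub_pow_mul_stretchedDeriv hq hα (k + 1) hu)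
    rw [integral_add hi1 hi2, integral_const_mul, ih] at h
    simp only [sub_self, zero_pow (Nat.succ_ne_zero k), zero_mul] at h
    rw [Nat.factorial_succ]
    push_cast
    rw [eq_neg_of_add_eq_zero_right h]
    ring

/-- A stretched exponential is a superposition of truncated powers `(1 - u/s)_+^k`, with a density
that is integrable on the half-line. -/
lemma exp_eq_integral_truncated_pow {q α : ℝ} (hq : 0 < q) (hα : 0 < α) {k : ℕ}
    (hk : k ≠ 0) {u : ℝ} (hu : 0 < u) :
    Real.exp (-α * u ^ q) = ((-1) ^ (k + 1) * (k.factorial : ℝ))⁻¹ *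
      ∫ s in Ioi (0 : ℝ), max 0 (1 - u / s) ^ k *
        (s ^ (-1 : ℝ) * (stretchedPoly q (k + 1)).eval (α * s ^ q) * Real.exp (-α * s ^ q)) := by
  have hne : ((-1) ^ (k + 1) * (k.factorial : ℝ)) ≠ 0 := by positivity
  rw [eq_inv_mul_iff_mul_eq₀ hne, ← integral_sub_pow_mul_stretchedDeriv hq hα k hu]
  -- the truncated power vanishes for `s ≤ u`
  have h := setIntegral_eq_of_subset_of_forall_sdiff_eq_zero (μ := volume)
    (f := fun s : ℝ => max 0 (1 - u / s) ^ k *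
      (s ^ (-1 : ℝ) * (stretchedPoly q (k + 1)).eval (α * s ^ q) * Real.exp (-α * s ^ q)))
    measurableSet_Ioi (Ioi_subset_Ioi hu.le) (by
      rintro s ⟨hs, hsu⟩
      have h0 : (0 : ℝ) < s := hs
      have h1 : s ≤ u := not_lt.mp hsu
      have : 1 - u / s ≤ 0 := by rw [sub_nonpos, one_le_div h0]; exact h1
      simp only [max_eq_left this, zero_pow hk, zero_mul])
  rw [h]
  refine setIntegral_congr_fun measurableSet_Ioi fun s hs => ?_
  have hs' : u < s := hs
  have h0 : 0 < s := hu.trans hs'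
  have h1 : 0 ≤ 1 - u / s := by rw [sub_nonneg, div_le_one h0]; exact hs'.le
  have h2 := stretchedDeriv_mul_pow q α (k + 1) h0
  rw [max_eq_right h1, mul_assoc (s ^ (-1 : ℝ)), ← h2, Real.rpow_neg_one, one_sub_div h0.ne',
    div_pow, pow_succ]
  field_simp

/-! ### Integrability of the kernel -/

lemma contDiff_max_zero_pow (n : ℕ) : ContDiff ℝ n (fun x : ℝ => max 0 x ^ (n + 1)) := by
  have hd : ∀ n : ℕ, ∀ x : ℝ, HasDerivAt (fun x : ℝ => max 0 x ^ (n + 2))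
      (((n + 2 : ℕ) : ℝ) * max 0 x ^ (n + 1)) x := by
    intro n x
    rcases lt_trichotomy x 0 with hx | rfl | hx
    · rw [max_eq_left hx.le]
      have : HasDerivAt (fun _ : ℝ => (0 : ℝ)) 0 x := hasDerivAt_const _ _
      refine (this.congr_of_eventuallyEq ?_).congr_deriv (by simp)
      filter_upwards [Iio_mem_nhds hx] with y hy
      rw [max_eq_left (le_of_lt hy)]
      simp
    · have h : HasDerivAt (fun x : ℝ => max 0 x ^ (n + 2)) 0 0 := by
        rw [hasDerivAt_iff_isLittleO_nhds_zero]
        simp only [zero_add, max_self, ne_eq, Nat.add_eq_zero_iff, OfNat.ofNat_ne_zero, and_false,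
          not_false_eq_true, zero_pow, sub_zero, smul_zero]
        have h2 : (fun h : ℝ => h ^ (n + 2)) =o[𝓝 0] fun h : ℝ => h :=
          Asymptotics.isLittleO_pow_id (by omega)
        refine Asymptotics.IsBigO.trans_isLittleO (Asymptotics.isBigO_of_le _ fun y => ?_) h2
        rw [norm_pow, norm_pow]
        refine pow_le_pow_left₀ (norm_nonneg _) ?_ _
        rw [Real.norm_of_nonneg (le_max_left 0 y)]
        exact max_le (norm_nonneg y) (le_abs_self y)
      simpa using h
    · rw [max_eq_right hx.le]
      refine ((hasDerivAt_pow (n + 2) x).congr_of_eventuallyEq ?_).congr_deriv (by simp)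
      filter_upwards [Ioi_mem_nhds hx] with y hy
      rw [max_eq_right (le_of_lt hy)]
  induction n with
  | zero =>
    simp only [Nat.cast_zero, zero_add, pow_one, contDiff_zero]
    fun_prop
  | succ n ih =>
    push_cast
    rw [contDiff_succ_iff_deriv]
    refine ⟨fun x => (hd n x).differentiableAt, by simp, ?_⟩
    rw [funext fun x => (hd n x).deriv]
    exact contDiff_const.mul ih

/-- The truncated power `(1 - ‖ξ‖²)_+^n`. -/
noncomputable def truncatedPower (d n : ℕ) (ξ : Rd d) : ℂ :=
  ((max 0 (1 - ‖ξ‖ ^ 2) ^ n : ℝ) : ℂ)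

lemma contDiff_truncatedPower (d n : ℕ) : ContDiff ℝ n (truncatedPower d (n + 1)) := by
  refine Complex.ofRealCLM.contDiff.comp ((contDiff_max_zero_pow n).comp ?_)
  exact contDiff_const.sub (contDiff_norm_sq ℝ)

lemma hasCompactSupport_truncatedPower (d n : ℕ) :
    HasCompactSupport (truncatedPower d (n + 1)) := by
  refine HasCompactSupport.intro (isCompact_closedBall 0 1) fun ξ hξ => ?_
  have h1 : 1 < ‖ξ‖ := by simpa using hξ
  have : 1 - ‖ξ‖ ^ 2 ≤ 0 := by nlinarith
  simp [truncatedPower, max_eq_left this]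

/-- The Fourier transform of a compactly supported function of class `C^(d+1)` is integrable. -/
lemma integrable_fourier_of_hasCompactSupport {d : ℕ} {f : Rd d → ℂ}
    (hf : ContDiff ℝ (d + 1 : ℕ) f) (hc : HasCompactSupport f) : Integrable (𝓕 f) := by
  have hi : Integrable f := hf.continuous.integrable_of_hasCompactSupport hc
  have hbound : ∀ n : ℕ, n ≤ d + 1 → ∃ C, ∀ w, ‖w‖ ^ n * ‖𝓕 f w‖ ≤ C := by
    intro n hn
    have := fun w => Real.pow_mul_norm_iteratedFDeriv_fourier_le (f := f) (K := 0)
      (N := ((d + 1 : ℕ) : ℕ∞)) (by exact_mod_cast hf) (k := 0) (n := n) (by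
        intro k m hk hm
        have hk0 : k = 0 := by simpa using hk
        subst hk0
        have hm' : m ≤ d + 1 := by exact_mod_cast hm
        simp only [pow_zero, one_mul]
        have hfm := hf.continuous_iteratedFDeriv (m := m) (by exact_mod_cast hm')
        exact (hfm.integrable_of_hasCompactSupport (hc.iteratedFDeriv m)).norm) le_rfl
      (by exact_mod_cast hn) w
    simp only [norm_iteratedFDeriv_zero] at this
    exact ⟨_, this⟩
  obtain ⟨C0, h0⟩ := hbound 0 (by omega)
  obtain ⟨C1, h1⟩ := hbound (d + 1) le_rfl
  have hcont : Continuous (𝓕 f) := VectorFourier.fourierIntegral_continuous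
    Real.continuous_fourierChar (L := innerₗ (Rd d)) continuous_inner hi
  have hint : Integrable (fun x : Rd d => (2 ^ d * (C0 + C1)) * (1 + ‖x‖) ^ (-((d : ℝ) + 1))) :=
    (integrable_one_add_norm (by rw [finrank_Rd]; linarith)).const_mul _
  refine hint.mono' hcont.aestronglyMeasurable (ae_of_all _ fun w => ?_)
  have hpos : (0 : ℝ) < 1 + ‖w‖ := by positivity
  have e : (1 + ‖w‖) ^ (-((d : ℝ) + 1)) = ((1 + ‖w‖) ^ (d + 1))⁻¹ := by
    rw [Real.rpow_neg hpos.le]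
    congr 1
    exact_mod_cast Real.rpow_natCast (1 + ‖w‖) (d + 1)
  rw [e, ← div_eq_mul_inv, le_div_iff₀ (by positivity)]
  have h2 : (1 + ‖w‖) ^ (d + 1) ≤ 2 ^ d * (1 ^ (d + 1) + ‖w‖ ^ (d + 1)) :=
    add_pow_le zero_le_one (norm_nonneg w) (d + 1)
  have h0' := h0 w
  have h1' := h1 w
  simp only [pow_zero, one_mul] at h0'
  calc ‖𝓕 f w‖ * (1 + ‖w‖) ^ (d + 1)
      ≤ ‖𝓕 f w‖ * (2 ^ d * (1 ^ (d + 1) + ‖w‖ ^ (d + 1))) := by gcongr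
    _ = 2 ^ d * (‖𝓕 f w‖ + ‖w‖ ^ (d + 1) * ‖𝓕 f w‖) := by ring
    _ ≤ _ := by gcongr

lemma fourier_comp_smul {d : ℕ} (G : Rd d → ℂ) {r : ℝ} (hr : 0 < r) (w : Rd d) :
    𝓕 (fun ξ => G (r⁻¹ • ξ)) w = ((r ^ d : ℝ) : ℂ) * 𝓕 G (r • w) := by
  rw [Real.fourier_eq', Real.fourier_eq']
  have := Measure.integral_comp_inv_smul_of_nonneg volume
    (fun v : Rd d => Complex.exp (((-2 * Real.pi * inner ℝ v (r • w) : ℝ) : ℂ) * Complex.I) • G v)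
    hr.le
  rw [finrank_Rd, Complex.real_smul] at this
  rw [← this]
  refine integral_congr_ae (ae_of_all _ fun v => ?_)
  have : inner ℝ (r⁻¹ • v) (r • w) = inner ℝ v w := by
    rw [inner_smul_left, inner_smul_right, ← mul_assoc]
    simp [hr.ne']
  simp only [this]

/-- The Fourier transform of a superposition of dilates, by Fubini's theorem. -/
lemma fourier_superposition {d : ℕ} {G F : Rd d → ℂ} (hGc : Continuous G)
    (hGi : Integrable G) {ω : ℝ → ℝ} (hωm : Measurable ω)
    (hω' : IntegrableOn (fun s => √s ^ d * ω s) (Ioi 0))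
    (hF : ∀ᵐ ξ, F ξ = ∫ s in Ioi (0 : ℝ), G ((√s)⁻¹ • ξ) * (ω s : ℂ))
    (w : Rd d) :
    𝓕 F w = ∫ s in Ioi (0 : ℝ), (((√s) ^ d : ℝ) : ℂ) * 𝓕 G (√s • w) * (ω s : ℂ) := by
  have hm : Integrable (Function.uncurry fun (ξ : Rd d) (s : ℝ) =>
      Complex.exp (((-2 * Real.pi * inner ℝ ξ w : ℝ) : ℂ) * Complex.I) •
        (G ((√s)⁻¹ • ξ) * (ω s : ℂ))) (volume.prod (volume.restrict (Ioi 0))) := by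
    have hmeas : Measurable (Function.uncurry fun (ξ : Rd d) (s : ℝ) =>
      Complex.exp (((-2 * Real.pi * inner ℝ ξ w : ℝ) : ℂ) * Complex.I) •
        (G ((√s)⁻¹ • ξ) * (ω s : ℂ))) := by
      have : Measurable fun p : Rd d × ℝ => G ((√p.2)⁻¹ • p.1) :=
        hGc.measurable.comp (by fun_prop)
      have h2 : Measurable fun p : Rd d × ℝ =>
          Complex.exp (((-2 * Real.pi * inner ℝ p.1 w : ℝ) : ℂ) * Complex.I) := by
        refine Continuous.measurable ?_
        fun_prop
      have h3 : Measurable fun p : Rd d × ℝ => (ω p.2 : ℂ) := by fun_prop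
      exact h2.smul (this.mul h3)
    rw [integrable_prod_iff' hmeas.aestronglyMeasurable]
    have hn : ∀ (ξ : Rd d) (s : ℝ), ‖Complex.exp (((-2 * Real.pi * inner ℝ ξ w : ℝ) : ℂ) *
        Complex.I) • (G ((√s)⁻¹ • ξ) * (ω s : ℂ))‖ = ‖G ((√s)⁻¹ • ξ)‖ * |ω s| := by
      intro ξ s
      rw [norm_smul, Complex.norm_exp_ofReal_mul_I, one_mul, norm_mul, Complex.norm_real,
        Real.norm_eq_abs]
    constructor
    · refine (ae_restrict_iff' measurableSet_Ioi).mpr (ae_of_all _ fun s hs => ?_)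
      have hs0 : (√s)⁻¹ ≠ 0 := inv_ne_zero (Real.sqrt_pos.mpr hs).ne'
      have h1 : Integrable fun ξ => ‖G ((√s)⁻¹ • ξ)‖ * |ω s| :=
        (((integrable_comp_smul_iff volume G hs0).mpr hGi).norm).mul_const _
      refine h1.mono' (hmeas.comp measurable_prodMk_right).aestronglyMeasurable
        (ae_of_all _ fun ξ => ?_)
      exact (hn ξ s).le
    · simp only [Function.uncurry, hn]
      have h1 : IntegrableOn (fun s => (∫ x, ‖G x‖) * |√s ^ d * ω s|) (Ioi 0) :=
        hω'.abs.const_mul _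
      refine h1.congr_fun (fun s _ => ?_) measurableSet_Ioi
      have h2 : (0 : ℝ) ≤ √s := Real.sqrt_nonneg s
      simp only
      rw [integral_mul_const,
        Measure.integral_comp_inv_smul_of_nonneg volume (fun x => ‖G x‖) h2, finrank_Rd,
        abs_mul, abs_of_nonneg (pow_nonneg h2 d), smul_eq_mul]
      ring
  have e1 : 𝓕 F w = ∫ ξ, ∫ s in Ioi (0 : ℝ),
      Complex.exp (((-2 * Real.pi * inner ℝ ξ w : ℝ) : ℂ) * Complex.I) •
        (G ((√s)⁻¹ • ξ) * (ω s : ℂ)) := by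
    rw [Real.fourier_eq']
    refine integral_congr_ae ?_
    filter_upwards [hF] with ξ hξ
    rw [hξ, integral_smul]
  rw [e1, integral_integral_swap hm]
  refine setIntegral_congr_fun measurableSet_Ioi fun s hs => ?_
  rw [← fourier_comp_smul G (Real.sqrt_pos.mpr hs), Real.fourier_eq', ← integral_mul_const]
  refine integral_congr_ae (ae_of_all _ fun ξ => ?_)
  simp only [smul_eq_mul]
  ring

lemma integrable_superposition {d : ℕ} {H : Rd d → ℂ} (hHc : Continuous H) (hH : Integrable H)
    {ω : ℝ → ℝ} (hωm : Measurable ω) (hω : IntegrableOn ω (Ioi 0)) :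
    Integrable fun w : Rd d =>
      ∫ s in Ioi (0 : ℝ), (((√s) ^ d : ℝ) : ℂ) * H (√s • w) * (ω s : ℂ) := by
  have hI : Integrable (Function.uncurry fun (w : Rd d) (s : ℝ) =>
      (((√s) ^ d : ℝ) : ℂ) * H (√s • w) * (ω s : ℂ)) (volume.prod (volume.restrict (Ioi 0))) := by
    have hmeas : Measurable (Function.uncurry fun (w : Rd d) (s : ℝ) =>
        (((√s) ^ d : ℝ) : ℂ) * H (√s • w) * (ω s : ℂ)) := by
      have : Measurable fun p : Rd d × ℝ => H (√p.2 • p.1) :=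
        hHc.measurable.comp (by fun_prop)
      have h3 : Measurable fun p : Rd d × ℝ => (ω p.2 : ℂ) := by fun_prop
      have h2 : Measurable fun p : Rd d × ℝ => (((√p.2) ^ d : ℝ) : ℂ) := by fun_prop
      exact (h2.mul this).mul h3
    rw [integrable_prod_iff' hmeas.aestronglyMeasurable]
    constructor
    · refine (ae_restrict_iff' measurableSet_Ioi).mpr (ae_of_all _ fun s hs => ?_)
      have h1 : Integrable fun w => H (√s • w) :=
        (integrable_comp_smul_iff volume H (Real.sqrt_pos.mpr hs).ne').mpr hH
      exact (h1.const_mul (((√s) ^ d : ℝ) : ℂ)).mul_const (ω s : ℂ)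
    · have h1 : IntegrableOn (fun s => (∫ x, ‖H x‖) * |ω s|) (Ioi 0) := hω.abs.const_mul _
      refine h1.congr_fun (fun s hs => ?_) measurableSet_Ioi
      have h2 : (0 : ℝ) < √s := Real.sqrt_pos.mpr hs
      simp only [Function.uncurry, norm_mul, Complex.norm_real, Real.norm_eq_abs]
      rw [integral_mul_const, integral_const_mul,
        Measure.integral_comp_smul_of_nonneg volume (fun x => ‖H x‖) _ (hR := h2.le), finrank_Rd,
        abs_of_nonneg (pow_nonneg h2.le d), smul_eq_mul]
      field_simp
  exact hI.integral_prod_left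

/-- A superposition of dilates of a function with integrable Fourier transform has integrable
Fourier transform: dilation does not change the `L¹` norm of the transform. -/
lemma integrable_fourier_of_superposition {d : ℕ} {G F : Rd d → ℂ} (hGc : Continuous G)
    (hGi : Integrable G) (hG : Integrable (𝓕 G)) {ω : ℝ → ℝ} (hωm : Measurable ω)
    (hω : IntegrableOn ω (Ioi 0)) (hω' : IntegrableOn (fun s => √s ^ d * ω s) (Ioi 0))
    (hF : ∀ᵐ ξ, F ξ = ∫ s in Ioi (0 : ℝ), G ((√s)⁻¹ • ξ) * (ω s : ℂ)) : Integrable (𝓕 F) := by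
  have hcont : Continuous (𝓕 G) := VectorFourier.fourierIntegral_continuous
    Real.continuous_fourierChar (L := innerₗ (Rd d)) continuous_inner hGi
  have : 𝓕 F = fun w => ∫ s in Ioi (0 : ℝ), (((√s) ^ d : ℝ) : ℂ) * 𝓕 G (√s • w) * (ω s : ℂ) :=
    funext (fourier_superposition hGc hGi hωm hω' hF)
  rw [this]
  exact integrable_superposition hcont hG hωm hω

/-- The Fourier multiplier `exp(-α‖ξ‖^p)`. -/
noncomputable def stableSymbol (d : ℕ) (p α : ℝ) (ξ : Rd d) : ℝ := Real.exp (-α * ‖ξ‖ ^ p)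

lemma stableKernel_eq_invHat (d : ℕ) (p α : ℝ) :
    stableKernel d p α = invHat fun ξ => (stableSymbol d p α ξ : ℂ) := rfl

lemma continuous_stableSymbol {d : ℕ} {p α : ℝ} (hp : 0 < p) :
    Continuous (stableSymbol d p α) := by
  unfold stableSymbol
  exact Real.continuous_exp.comp
    (continuous_const.mul (continuous_norm.rpow_const fun _ => Or.inr hp.le))

lemma integrable_stableSymbol {d : ℕ} (hd : 1 ≤ d) {p α : ℝ} (hp : 0 < p) (hα : 0 < α) :
    Integrable (stableSymbol d p α) := by
  have : Nontrivial (Rd d) := Module.nontrivial_of_finrank_pos (R := ℝ) (by rw [finrank_Rd]; omega)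
  refine (integrable_fun_norm_addHaar volume (f := fun r => Real.exp (-α * r ^ p))).mpr ?_
  refine (integrableOn_rpow_mul_exp_neg_mul_rpow (s := ((d - 1 : ℕ) : ℝ)) ?_ hp hα).congr_fun
    (fun s _ => ?_) measurableSet_Ioi
  · have : (0 : ℝ) ≤ ((d - 1 : ℕ) : ℝ) := Nat.cast_nonneg _
    linarith
  · simp only [Real.rpow_natCast, smul_eq_mul, finrank_Rd]

/-- The symbol is a superposition of dilates `(1 - ‖ξ‖²/s)_+^k` of the truncated power. -/
lemma integrable_fourier_stableSymbol {d : ℕ} (hd : 1 ≤ d) {p α : ℝ} (hp : 0 < p) (hα : 0 < α) :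
    Integrable (𝓕 fun ξ => (stableSymbol d p α ξ : ℂ)) := by
  have : Nontrivial (Rd d) := Module.nontrivial_of_finrank_pos (R := ℝ) (by rw [finrank_Rd]; omega)
  have hq : 0 < p / 2 := by positivity
  -- the exponent makes the truncated power of class `C^(d+1)`
  set k := d + 2 with hk
  set c : ℝ := ((-1) ^ (k + 1) * (k.factorial : ℝ))⁻¹ with hc
  set ω : ℝ → ℝ := fun s => c * (s ^ (-1 : ℝ) * (stretchedPoly (p / 2) (k + 1)).eval
    (α * s ^ (p / 2)) * Real.exp (-α * s ^ (p / 2))) with hωdef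
  have hωm : Measurable ω := by
    have : Measurable fun s : ℝ => (stretchedPoly (p / 2) (k + 1)).eval (α * s ^ (p / 2)) :=
      (stretchedPoly (p / 2) (k + 1)).continuous.measurable.comp (by fun_prop)
    fun_prop
  have hG := contDiff_truncatedPower d (d + 1)
  have hGs := hasCompactSupport_truncatedPower d (d + 1)
  refine integrable_fourier_of_superposition (G := truncatedPower d k) (ω := ω) hG.continuous
    (hG.continuous.integrable_of_hasCompactSupport hGs)
    (integrable_fourier_of_hasCompactSupport hG hGs) hωm ?_ ?_ ?_
  · exact (integrableOn_rpow_mul_eval_mul_exp hq hα le_rfl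
      (stretchedPoly_coeff_zero _ k)).const_mul c
  · have ha : -1 ≤ (d : ℝ) / 2 - 1 := by
      have : (0 : ℝ) ≤ d / 2 := by positivity
      linarith
    refine IntegrableOn.congr_fun ((integrableOn_rpow_mul_eval_mul_exp hq hα ha
      (stretchedPoly_coeff_zero (p / 2) k)).const_mul c) (fun s hs => ?_) measurableSet_Ioi
    · have hs' : (0 : ℝ) < s := hs
      have e : √s ^ d = s ^ ((d : ℝ) / 2) := by
        rw [Real.sqrt_eq_rpow, ← Real.rpow_natCast, ← Real.rpow_mul hs'.le]
        congr 1; ring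
      simp only [hωdef]
      rw [e, sub_eq_add_neg, Real.rpow_add hs']
      ring
  · have h0 : ∀ᵐ ξ : Rd d, ξ ≠ 0 := by
      rw [ae_iff]; simp
    filter_upwards [h0] with ξ hξ
    have hu : 0 < ‖ξ‖ ^ 2 := by positivity
    have e := exp_eq_integral_truncated_pow hq hα (k := k) (by omega) hu
    have e2 : (‖ξ‖ ^ 2) ^ (p / 2) = ‖ξ‖ ^ p := by
      rw [← Real.rpow_natCast, ← Real.rpow_mul (norm_nonneg _)]
      congr 1
      push_cast
      ring
    rw [e2, ← hc] at e
    rw [stableSymbol, e, ← integral_const_mul, ← integral_complex_ofReal]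
    refine setIntegral_congr_fun measurableSet_Ioi fun s hs => ?_
    have hs' : (0 : ℝ) < s := hs
    have e3 : ‖(√s)⁻¹ • ξ‖ ^ 2 = ‖ξ‖ ^ 2 / s := by
      rw [norm_smul, mul_pow, norm_inv, Real.norm_of_nonneg (Real.sqrt_nonneg s), inv_pow,
        Real.sq_sqrt hs'.le]
      field_simp
    simp only [truncatedPower, e3, hωdef]
    push_cast
    ring

lemma fourierHat_stableKernel {d : ℕ} (hd : 1 ≤ d) {p α : ℝ} (hp : 0 < p) (hα : 0 < α) :
    fourierHat (stableKernel d p α) = fun ξ => (stableSymbol d p α ξ : ℂ) := by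
  rw [stableKernel_eq_invHat]
  exact fourierHat_invHat (Complex.continuous_ofReal.comp (continuous_stableSymbol hp))
    (integrable_stableSymbol hd hp hα).ofReal (integrable_fourier_stableSymbol hd hp hα)

lemma integrable_stableKernel {d : ℕ} (hd : 1 ≤ d) {p α : ℝ} (hp : 0 < p) (hα : 0 < α) :
    Integrable (stableKernel d p α) := by
  rw [stableKernel_eq_invHat]
  set φ : Rd d → ℂ := fun ξ => (stableSymbol d p α ξ : ℂ)
  have h1 : Integrable (𝓕⁻ φ) := by
    have : 𝓕⁻ φ = fun x => 𝓕 φ (-x) := funext fun x => Real.fourierInv_eq_fourier_neg φ x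
    rw [this]
    exact (integrable_fourier_stableSymbol hd hp hα).comp_neg
  have : invHat φ = fun x => (fourierConst d : ℂ) * 𝓕⁻ φ ((2 * Real.pi)⁻¹ • x) :=
    funext (invHat_eq_fourierInv φ)
  rw [this]
  exact ((integrable_comp_smul_iff volume (𝓕⁻ φ) (by positivity)).mpr h1).const_mul _

/-! ### Interpolation by a Riesz sequence in a Hilbert space -/

section RieszSequence

variable {K : Type*} [NormedAddCommGroup K] [InnerProductSpace ℂ K]

lemma summable_smul_of_upper_bound [CompleteSpace K] {E : ℕ → K} {B : ℝ}
    (hup : ∀ (s : Finset ℕ) (c : ℕ → ℂ), ‖∑ j ∈ s, c j • E j‖ ^ 2 ≤ B * ∑ j ∈ s, ‖c j‖ ^ 2)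
    {a : ℕ → ℂ} (ha : Summable fun j => ‖a j‖ ^ 2) : Summable fun j => a j • E j := by
  have hup' : ∀ (s : Finset ℕ) (c : ℕ → ℂ),
      ‖∑ j ∈ s, c j • E j‖ ^ 2 ≤ max B 1 * ∑ j ∈ s, ‖c j‖ ^ 2 := fun s c =>
    (hup s c).trans (mul_le_mul_of_nonneg_right (le_max_left _ _) (by positivity))
  have hB : 0 < max B 1 := lt_max_of_lt_right one_pos
  rw [summable_iff_vanishing_norm]
  intro ε hε
  obtain ⟨s, hs⟩ := (summable_iff_vanishing_norm.mp ha) (ε ^ 2 / max B 1) (by positivity)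
  refine ⟨s, fun t ht => ?_⟩
  have h1 := hs t ht
  rw [Real.norm_of_nonneg (by positivity), lt_div_iff₀ hB, mul_comm] at h1
  exact lt_of_pow_lt_pow_left₀ 2 hε.le ((hup' t a).trans_lt h1)

/-- The lower Riesz bound extends from finite sums to convergent series. -/
lemma mul_tsum_le_norm_sq {E : ℕ → K} {A : ℝ}
    (hlow : ∀ (s : Finset ℕ) (c : ℕ → ℂ), A * ∑ j ∈ s, ‖c j‖ ^ 2 ≤ ‖∑ j ∈ s, c j • E j‖ ^ 2)
    {a : ℕ → ℂ} (ha : Summable fun j => ‖a j‖ ^ 2) {v : K} (hv : HasSum (fun j => a j • E j) v) :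
    A * ∑' j, ‖a j‖ ^ 2 ≤ ‖v‖ ^ 2 :=
  le_of_tendsto_of_tendsto' (ha.hasSum.const_mul A |>.congr fun s => by
    rw [Finset.mul_sum]) (hv.norm.pow 2) fun s => hlow s a

/-- The synthesis operator `a ↦ ∑ a_j E_j` of a Riesz sequence has closed range, so that the
range carries an orthogonal projection. The coefficients of the projection of `u` are the
unique square-summable solution of the Gram system with right-hand side `⟨E_k, u⟩`. -/
lemma exists_gram_solution [CompleteSpace K] {E : ℕ → K} {A B : ℝ} (hA : 0 < A)
    (hlow : ∀ (s : Finset ℕ) (c : ℕ → ℂ), A * ∑ j ∈ s, ‖c j‖ ^ 2 ≤ ‖∑ j ∈ s, c j • E j‖ ^ 2)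
    (hup : ∀ (s : Finset ℕ) (c : ℕ → ℂ), ‖∑ j ∈ s, c j • E j‖ ^ 2 ≤ B * ∑ j ∈ s, ‖c j‖ ^ 2)
    (u : K) :
    ∃ (a : ℕ → ℂ) (v : K), Summable (fun j => ‖a j‖ ^ 2) ∧ HasSum (fun j => a j • E j) v ∧
      (∀ k, inner ℂ (E k) v = inner ℂ (E k) u) ∧
      ∀ b : ℕ → ℂ, Summable (fun j => ‖b j‖ ^ 2) →
        (∀ k, HasSum (fun j => b j * inner ℂ (E k) (E j)) (inner ℂ (E k) u)) → b = a := by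
  have hmem : ∀ x : lp (fun _ : ℕ => ℂ) 2, Summable fun j => ‖x j‖ ^ 2 := fun x => by
    have := (memℓp_gen_iff (p := 2) (by norm_num)).mp (lp.memℓp x)
    simpa using this
  have hnorm : ∀ x : lp (fun _ : ℕ => ℂ) 2, ‖x‖ ^ 2 = ∑' j, ‖x j‖ ^ 2 := fun x => by
    have := lp.norm_rpow_eq_tsum (p := 2) (by norm_num) x
    simpa using this
  have hsum := fun {a : ℕ → ℂ} => summable_smul_of_upper_bound (a := a) hup
  let L : lp (fun _ : ℕ => ℂ) 2 →ₗ[ℂ] K :=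
    { toFun := fun x => ∑' j, x j • E j
      map_add' := fun x y => by
        rw [← (hsum (hmem x)).tsum_add (hsum (hmem y))]
        refine tsum_congr fun j => ?_
        simp [add_smul]
      map_smul' := fun r x => by
        simp only [RingHom.id_apply]
        rw [← (hsum (hmem x)).tsum_const_smul r]
        refine tsum_congr fun j => ?_
        simp [smul_smul] }
  have hL : ∀ x, HasSum (fun j => x j • E j) (L x) := fun x => (hsum (hmem x)).hasSum
  have hLup : ∀ x, ‖L x‖ ≤ √(max B 0) * ‖x‖ := by
    intro x
    have h1 : ‖L x‖ ^ 2 ≤ B * ‖x‖ ^ 2 := by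
      rw [hnorm]
      exact le_of_tendsto_of_tendsto' ((hL x).norm.pow 2)
        ((hmem x).hasSum.const_mul B |>.congr fun s => by rw [Finset.mul_sum]) fun s => hup s x
    refine le_of_sq_le_sq ?_ (by positivity)
    rw [mul_pow, Real.sq_sqrt (le_max_right _ _)]
    exact h1.trans (mul_le_mul_of_nonneg_right (le_max_left _ _) (by positivity))
  let Ψ := L.mkContinuous _ hLup
  have hΨ : ∀ x, Ψ x = L x := fun x => rfl
  have hlow' : ∀ x, A * ‖x‖ ^ 2 ≤ ‖L x‖ ^ 2 := fun x => by
    rw [hnorm]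
    exact mul_tsum_le_norm_sq hlow (hmem x) (hL x)
  have hanti : AntilipschitzWith (Real.toNNReal (√A)⁻¹) Ψ := by
    refine Ψ.antilipschitz_of_bound fun x => ?_
    rw [Real.coe_toNNReal _ (by positivity), inv_mul_eq_div, le_div_iff₀ (by positivity), hΨ]
    refine le_of_sq_le_sq ?_ (norm_nonneg _)
    rw [mul_pow, Real.sq_sqrt hA.le, mul_comm]
    exact hlow' x
  have hclosed : IsClosed (Ψ.range : Set K) := by
    have := hanti.isClosed_range Ψ.uniformContinuous
    exact this
  have : CompleteSpace Ψ.range := hclosed.completeSpace_coe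
  obtain ⟨v, ⟨x, hx⟩, hvo⟩ :=
    Submodule.HasOrthogonalProjection.exists_orthogonal (K := Ψ.range) u
  have hE : ∀ k, E k ∈ Ψ.range := fun k => by
    refine ⟨lp.single 2 k (1 : ℂ), ?_⟩
    have h1 := hL (lp.single 2 k (1 : ℂ))
    have h2 : HasSum (fun j => (lp.single 2 k (1 : ℂ) : lp (fun _ : ℕ => ℂ) 2) j • E j) (E k) := by
      convert hasSum_single k (f := fun j =>
        (lp.single 2 k (1 : ℂ) : lp (fun _ : ℕ => ℂ) 2) j • E j) ?_ using 1
      · simp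
      · intro j hj
        simp [hj]
    exact h1.unique h2
  have horth : ∀ k, inner ℂ (E k) v = inner ℂ (E k) u := fun k => by
    have h3 := (Submodule.mem_orthogonal _ _).mp hvo (E k) (hE k)
    rw [inner_sub_right, sub_eq_zero] at h3
    exact h3.symm
  refine ⟨x, v, hmem x, hx ▸ hL x, horth, fun b hb hbk => ?_⟩
  have hbm : Memℓp b 2 := by
    rw [memℓp_gen_iff (by norm_num)]
    simpa using hb
  let y : lp (fun _ : ℕ => ℂ) 2 := ⟨b, hbm⟩
  have hy : ∀ k, inner ℂ (E k) (L y) = inner ℂ (E k) u := fun k => by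
    have h1 := (hL y).mapL (innerSL ℂ (E k))
    refine HasSum.unique ?_ (hbk k)
    simpa [inner_smul_right] using h1
  have hz : ∀ k, inner ℂ (E k) (L (y - x)) = 0 := fun k => by
    have hx' : L x = v := hx
    rw [map_sub, inner_sub_right, hy, hx', horth, sub_self]
  have hzero : L (y - x) = 0 := by
    have h1 := (hL (y - x)).mapL (innerSL ℂ (L (y - x)))
    have h2 : ∀ j, innerSL ℂ (L (y - x)) ((y - x) j • E j) = 0 := fun j => by
      rw [innerSL_apply_apply, inner_smul_right, ← inner_conj_symm, hz]
      simp
    simp only [h2] at h1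
    have h3 := h1.unique hasSum_zero
    rw [innerSL_apply_apply] at h3
    exact inner_self_eq_zero.mp h3
  have h4 := hlow' (y - x)
  rw [hzero, norm_zero] at h4
  have h5 : ‖y - x‖ = 0 := by
    by_contra hne
    have : 0 < ‖y - x‖ := lt_of_le_of_ne (norm_nonneg _) (Ne.symm hne)
    have : 0 < A * ‖y - x‖ ^ 2 := by positivity
    simp at h4
    linarith
  have h6 : y = x := sub_eq_zero.mp (norm_eq_zero.mp h5)
  exact congrArg (fun z : lp (fun _ : ℕ => ℂ) 2 => (z : ℕ → ℂ)) h6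

end RieszSequence

/-! ### Exponential sums and Riesz bounds -/

/-- The exponential `ξ ↦ exp(-i⟨x, ξ⟩)`. -/
noncomputable def expFun {d : ℕ} (x ξ : Rd d) : ℂ :=
  Complex.exp (-Complex.I * ((inner ℝ x ξ : ℝ) : ℂ))

/-- The finite exponential sum `∑_{j ∈ s} c_j exp(-i⟨x_j, ·⟩)`. -/
noncomputable def expSum {d : ℕ} (X : ℕ → Rd d) (s : Finset ℕ) (c : ℕ → ℂ) (ξ : Rd d) : ℂ :=
  ∑ j ∈ s, c j * expFun (X j) ξ

/-- Finite exponential sums are comparable in `L₂(Z)` to the `ℓ₂`-norm of their coefficients. -/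
def HasRieszBounds {d : ℕ} (Z : Set (Rd d)) (X : ℕ → Rd d) (R : ℝ) : Prop :=
  ∀ (s : Finset ℕ) (c : ℕ → ℂ),
    ENNReal.ofReal ((R ^ 2)⁻¹ * ∑ j ∈ s, ‖c j‖ ^ 2) ≤ ∫⁻ ξ in Z, ‖expSum X s c ξ‖ₑ ^ 2 ∧
    ∫⁻ ξ in Z, ‖expSum X s c ξ‖ₑ ^ 2 ≤ ENNReal.ofReal (R ^ 2 * ∑ j ∈ s, ‖c j‖ ^ 2)

lemma norm_expFun {d : ℕ} (x ξ : Rd d) : ‖expFun x ξ‖ = 1 := by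
  rw [expFun, neg_mul, mul_comm, ← neg_mul, ← Complex.ofReal_neg, Complex.norm_exp_ofReal_mul_I]

lemma continuous_expFun {d : ℕ} (x : Rd d) : Continuous (expFun x) := by
  unfold expFun
  fun_prop

lemma continuous_expSum {d : ℕ} (X : ℕ → Rd d) (s : Finset ℕ) (c : ℕ → ℂ) :
    Continuous (expSum X s c) :=
  continuous_finsetSum _ fun _ _ => continuous_const.mul (continuous_expFun _)

lemma conj_expFun {d : ℕ} (x ξ : Rd d) :
    (starRingEnd ℂ) (expFun x ξ) = Complex.exp (Complex.I * ((inner ℝ x ξ : ℝ) : ℂ)) := by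
  rw [expFun, ← Complex.exp_conj]
  simp

lemma expFun_add {d : ℕ} (x ξ v : Rd d) : expFun x (ξ + v) = expFun x v * expFun x ξ := by
  rw [expFun, expFun, expFun, ← Complex.exp_add, inner_add_right]
  congr 1
  push_cast
  ring

lemma conj_expFun_mul_expFun {d : ℕ} (x y ξ : Rd d) :
    expFun y ξ * (starRingEnd ℂ) (expFun x ξ)
      = Complex.exp (Complex.I * ((inner ℝ (x - y) ξ : ℝ) : ℂ)) := by
  rw [conj_expFun, expFun, ← Complex.exp_add, inner_sub_left]
  congr 1
  push_cast
  ring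

lemma enorm_norm_sq_eq_lintegral {T : Type*} [MeasurableSpace T] {μ : Measure T}
    (x : Lp ℂ 2 μ) {g : T → ℂ} (h : (x : T → ℂ) =ᵐ[μ] g) :
    ENNReal.ofReal (‖x‖ ^ 2) = ∫⁻ t, ‖g t‖ₑ ^ 2 ∂μ := by
  rw [ENNReal.ofReal_pow (norm_nonneg _), ofReal_norm, Lp.enorm_def, eLpNorm_congr_ae h,
    eLpNorm_two_sq]

lemma coeFn_sum_smul_ae_eq {d : ℕ} {μ : Measure (Rd d)} {X : ℕ → Rd d} {e : ℕ → Lp ℂ 2 μ}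
    (he : ∀ j, (e j : Rd d → ℂ) =ᵐ[μ] expFun (X j)) (s : Finset ℕ) (c : ℕ → ℂ) :
    ((∑ j ∈ s, c j • e j : Lp ℂ 2 μ) : Rd d → ℂ) =ᵐ[μ] expSum X s c := by
  classical
  induction s using Finset.induction_on with
  | empty =>
    simp only [Finset.sum_empty]
    filter_upwards [Lp.coeFn_zero ℂ 2 μ] with ξ hξ
    rw [hξ]
    simp [expSum]
  | insert j s hj ih =>
    rw [Finset.sum_insert hj]
    filter_upwards [Lp.coeFn_add (c j • e j) (∑ j ∈ s, c j • e j), Lp.coeFn_smul (c j) (e j),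
      he j, ih] with ξ h1 h2 h3 h4
    rw [h1, Pi.add_apply, h2, Pi.smul_apply, h3, h4, expSum, expSum, Finset.sum_insert hj,
      smul_eq_mul]

lemma IsRieszBasis.exists_finset_bounds {H : Type*} [NormedAddCommGroup H] [InnerProductSpace ℂ H]
    {e : ℕ → H} (h : IsRieszBasis e) : ∃ R : ℝ, 0 < R ∧ ∀ (s : Finset ℕ) (c : ℕ → ℂ),
      (R ^ 2)⁻¹ * ∑ j ∈ s, ‖c j‖ ^ 2 ≤ ‖∑ j ∈ s, c j • e j‖ ^ 2 ∧
      ‖∑ j ∈ s, c j • e j‖ ^ 2 ≤ R ^ 2 * ∑ j ∈ s, ‖c j‖ ^ 2 := by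
  classical
  obtain ⟨R, hR, hb⟩ := h.bounds
  refine ⟨R, hR, fun s c => ?_⟩
  have hz : ∀ j ∉ s, (if j ∈ s then c j else 0) = 0 := fun j hj => by simp [hj]
  have h1 : HasSum (fun j => ‖if j ∈ s then c j else 0‖ ^ 2) (∑ j ∈ s, ‖c j‖ ^ 2) := by
    have := hasSum_sum_of_ne_finset_zero (L := .unconditional ℕ) (s := s)
      (f := fun j => ‖if j ∈ s then c j else 0‖ ^ 2) fun j hj => by simp [hj]
    convert this using 1
    exact Finset.sum_congr rfl fun j hj => by simp [hj]
  have h2 : HasSum (fun j => (if j ∈ s then c j else 0) • e j) (∑ j ∈ s, c j • e j) := by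
    have := hasSum_sum_of_ne_finset_zero (L := .unconditional ℕ) (s := s)
      (f := fun j => (if j ∈ s then c j else 0) • e j) fun j hj => by simp [hj]
    convert this using 1
    exact Finset.sum_congr rfl fun j hj => by simp [hj]
  obtain ⟨-, h3, h4⟩ := hb (fun j => if j ∈ s then c j else 0) h1.summable
  rw [h1.tsum_eq, h2.tsum_eq] at h3 h4
  have hq : 0 ≤ ∑ j ∈ s, ‖c j‖ ^ 2 := by positivity
  constructor
  · have := pow_le_pow_left₀ (by positivity) h3 2
    rwa [mul_pow, Real.sq_sqrt hq, div_pow, one_pow, one_div] at this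
  · have := pow_le_pow_left₀ (norm_nonneg _) h4 2
    rwa [mul_pow, Real.sq_sqrt hq] at this

lemma hasRieszBounds_of_finset_bounds {d : ℕ} {Z : Set (Rd d)} {X : ℕ → Rd d}
    {e : ℕ → Lp ℂ 2 (volume.restrict Z)}
    (he : ∀ j, (e j : Rd d → ℂ) =ᵐ[volume.restrict Z] expFun (X j)) {R : ℝ}
    (h : ∀ (s : Finset ℕ) (c : ℕ → ℂ),
      (R ^ 2)⁻¹ * ∑ j ∈ s, ‖c j‖ ^ 2 ≤ ‖∑ j ∈ s, c j • e j‖ ^ 2 ∧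
      ‖∑ j ∈ s, c j • e j‖ ^ 2 ≤ R ^ 2 * ∑ j ∈ s, ‖c j‖ ^ 2) : HasRieszBounds Z X R := by
  intro s c
  rw [← enorm_norm_sq_eq_lintegral _ (coeFn_sum_smul_ae_eq he s c)]
  exact ⟨ENNReal.ofReal_le_ofReal (h s c).1, ENNReal.ofReal_le_ofReal (h s c).2⟩

/-! ### Riesz bounds in weighted spaces, by averaging over translates -/

lemma expSum_add {d : ℕ} (X : ℕ → Rd d) (s : Finset ℕ) (c : ℕ → ℂ) (z v : Rd d) :
    expSum X s c (z + v) = expSum X s (fun j => c j * expFun (X j) v) z :=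
  Finset.sum_congr rfl fun j _ => by rw [expFun_add, mul_assoc]

/-- Riesz bounds on `Z` hold with the same constant on every translate of `Z`, since a translation
only changes the phases of the coefficients. -/
lemma HasRieszBounds.translate {d : ℕ} {Z : Set (Rd d)} {X : ℕ → Rd d} {R : ℝ}
    (h : HasRieszBounds Z X R) (s : Finset ℕ) (c : ℕ → ℂ) (v : Rd d) :
    ENNReal.ofReal ((R ^ 2)⁻¹ * ∑ j ∈ s, ‖c j‖ ^ 2) ≤ ∫⁻ z in Z, ‖expSum X s c (z + v)‖ₑ ^ 2 ∧
    ∫⁻ z in Z, ‖expSum X s c (z + v)‖ₑ ^ 2 ≤ ENNReal.ofReal (R ^ 2 * ∑ j ∈ s, ‖c j‖ ^ 2) := by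
  have := h s (fun j => c j * expFun (X j) v)
  simpa only [expSum_add, norm_mul, norm_expFun, mul_one] using this

/-- Exchange of the order of integration in an average over the translates `v + Z`. -/
lemma lintegral_mul_lintegral_translate {d : ℕ} {Z : Set (Rd d)} {q W : Rd d → ℝ≥0∞}
    (hq : Measurable q) (hW : Measurable W) :
    ∫⁻ v, W v * ∫⁻ z in Z, q (z + v) = ∫⁻ ξ, q ξ * ∫⁻ z in Z, W (ξ - z) := by
  have h1 : ∀ v, W v * ∫⁻ z in Z, q (z + v) = ∫⁻ z in Z, W v * q (z + v) := fun v =>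
    (lintegral_const_mul _ (by fun_prop)).symm
  have h2 : ∀ ξ, q ξ * ∫⁻ z in Z, W (ξ - z) = ∫⁻ z in Z, q ξ * W (ξ - z) := fun ξ =>
    (lintegral_const_mul _ (by fun_prop)).symm
  simp_rw [h1, h2]
  rw [lintegral_lintegral_swap (by fun_prop),
    lintegral_lintegral_swap (f := fun ξ z => q ξ * W (ξ - z)) (by fun_prop)]
  refine lintegral_congr fun z => ?_
  rw [← lintegral_add_left_eq_self (fun ξ => q ξ * W (ξ - z)) z]
  refine lintegral_congr fun v => ?_
  rw [add_sub_cancel_left, mul_comm]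

lemma measurable_enorm_expSum_sq {d : ℕ} (X : ℕ → Rd d) (s : Finset ℕ) (c : ℕ → ℂ) :
    Measurable fun ξ => ‖expSum X s c ξ‖ₑ ^ 2 :=
  ((continuous_expSum X s c).measurable.enorm).pow_const 2

/-- The lower Riesz bound on `Z`, averaged over the translates of `Z` with density `W`. -/
lemma HasRieszBounds.lower_weighted {d : ℕ} {Z : Set (Rd d)} (hZ : MeasurableSet Z)
    (hZf : volume Z ≠ ∞) {X : ℕ → Rd d} {R : ℝ}
    (h : HasRieszBounds Z X R) {W F : Rd d → ℝ≥0∞} (hW : Measurable W)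
    (hWF : ∀ ξ, ∀ z ∈ Z, W (ξ - z) ≤ F ξ) (s : Finset ℕ) (c : ℕ → ℂ) :
    (∫⁻ v, W v) * ENNReal.ofReal ((R ^ 2)⁻¹ * ∑ j ∈ s, ‖c j‖ ^ 2) ≤
      (∫⁻ ξ, F ξ * ‖expSum X s c ξ‖ₑ ^ 2) * volume Z := by
  rw [← lintegral_mul_const _ hW, ← lintegral_mul_const' _ _ hZf]
  calc ∫⁻ v, W v * ENNReal.ofReal ((R ^ 2)⁻¹ * ∑ j ∈ s, ‖c j‖ ^ 2)
      ≤ ∫⁻ v, W v * ∫⁻ z in Z, ‖expSum X s c (z + v)‖ₑ ^ 2 :=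
        lintegral_mono fun v => mul_le_mul_right (h.translate s c v).1 _
    _ = ∫⁻ ξ, ‖expSum X s c ξ‖ₑ ^ 2 * ∫⁻ z in Z, W (ξ - z) :=
        lintegral_mul_lintegral_translate (measurable_enorm_expSum_sq X s c) hW
    _ ≤ ∫⁻ ξ, F ξ * ‖expSum X s c ξ‖ₑ ^ 2 * volume Z := by
        refine lintegral_mono fun ξ => ?_
        have h1 : ∫⁻ z in Z, W (ξ - z) ≤ F ξ * volume Z := by
          rw [← setLIntegral_const]
          exact setLIntegral_mono' hZ fun z hz => hWF ξ z hz
        calc ‖expSum X s c ξ‖ₑ ^ 2 * ∫⁻ z in Z, W (ξ - z)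
            ≤ ‖expSum X s c ξ‖ₑ ^ 2 * (F ξ * volume Z) := mul_le_mul_right h1 _
          _ = _ := by ring

/-- The upper Riesz bound on `Z`, averaged over the translates of `Z` with density `W`. -/
lemma HasRieszBounds.upper_weighted {d : ℕ} {Z : Set (Rd d)} (hZ : MeasurableSet Z)
    (hZf : volume Z ≠ ∞) {X : ℕ → Rd d} {R : ℝ}
    (h : HasRieszBounds Z X R) {W F : Rd d → ℝ≥0∞} (hW : Measurable W)
    (hWF : ∀ ξ, ∀ z ∈ Z, F ξ ≤ W (ξ - z)) (s : Finset ℕ) (c : ℕ → ℂ) :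
    (∫⁻ ξ, F ξ * ‖expSum X s c ξ‖ₑ ^ 2) * volume Z ≤
      (∫⁻ v, W v) * ENNReal.ofReal (R ^ 2 * ∑ j ∈ s, ‖c j‖ ^ 2) := by
  rw [← lintegral_mul_const _ hW, ← lintegral_mul_const' _ _ hZf]
  calc ∫⁻ ξ, F ξ * ‖expSum X s c ξ‖ₑ ^ 2 * volume Z
      ≤ ∫⁻ ξ, ‖expSum X s c ξ‖ₑ ^ 2 * ∫⁻ z in Z, W (ξ - z) := by
        refine lintegral_mono fun ξ => ?_
        have h1 : F ξ * volume Z ≤ ∫⁻ z in Z, W (ξ - z) := by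
          rw [← setLIntegral_const]
          exact setLIntegral_mono' hZ fun z hz => hWF ξ z hz
        calc F ξ * ‖expSum X s c ξ‖ₑ ^ 2 * volume Z
            = ‖expSum X s c ξ‖ₑ ^ 2 * (F ξ * volume Z) := by ring
          _ ≤ _ := mul_le_mul_right h1 _
    _ = ∫⁻ v, W v * ∫⁻ z in Z, ‖expSum X s c (z + v)‖ₑ ^ 2 :=
        (lintegral_mul_lintegral_translate (measurable_enorm_expSum_sq X s c) hW).symm
    _ ≤ ∫⁻ v, W v * ENNReal.ofReal (R ^ 2 * ∑ j ∈ s, ‖c j‖ ^ 2) :=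
        lintegral_mono fun v => mul_le_mul_right (h.translate s c v).2 _

/-! ### Frame bounds for the weight of the kernel -/

/-- The mass `∫ exp(-α‖ξ‖^p) dξ`. -/
noncomputable def stableMass (d : ℕ) (p α : ℝ) : ℝ := ∫ ξ : Rd d, stableSymbol d p α ξ

lemma stableSymbol_pos {d : ℕ} (p α : ℝ) (ξ : Rd d) : 0 < stableSymbol d p α ξ := Real.exp_pos _

lemma lintegral_stableSymbol {d : ℕ} (hd : 1 ≤ d) {p α : ℝ} (hp : 0 < p) (hα : 0 < α) :
    ∫⁻ ξ, ENNReal.ofReal (stableSymbol d p α ξ) = ENNReal.ofReal (stableMass d p α) :=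
  (ofReal_integral_eq_lintegral_ofReal (integrable_stableSymbol hd hp hα)
    (ae_of_all _ fun ξ => (stableSymbol_pos p α ξ).le)).symm

lemma stableMass_pos {d : ℕ} (hd : 1 ≤ d) {p α : ℝ} (hp : 0 < p) (hα : 0 < α) :
    0 < stableMass d p α :=
  (integral_pos_iff_support_of_nonneg (fun ξ => (stableSymbol_pos p α ξ).le)
    (integrable_stableSymbol hd hp hα)).mpr (by
      have : Function.support (stableSymbol d p α) = univ :=
        Function.support_eq_univ (stableSymbol_pos p α · |>.ne')
      rw [this]
      exact isOpen_univ.measure_pos _ univ_nonempty)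

lemma add_one_rpow_le {p x : ℝ} (hp : 0 < p) (hx : 0 ≤ x) :
    (x + 1) ^ p ≤ 2 ^ p * (x ^ p + 1) := by
  rcases le_total x 1 with h | h
  · have h1 : (x + 1) ^ p ≤ 2 ^ p := Real.rpow_le_rpow (by linarith) (by linarith) hp.le
    have h2 : 0 ≤ x ^ p := Real.rpow_nonneg hx p
    have h3 : (0 : ℝ) < 2 ^ p := Real.rpow_pos_of_pos two_pos p
    nlinarith
  · have h1 : (x + 1) ^ p ≤ (2 * x) ^ p := Real.rpow_le_rpow (by linarith) (by linarith) hp.le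
    rw [Real.mul_rpow two_pos.le hx] at h1
    have h3 : (0 : ℝ) < 2 ^ p := Real.rpow_pos_of_pos two_pos p
    nlinarith

lemma stableSymbol_smul {d : ℕ} {p α r : ℝ} (hr : 0 ≤ r) (ξ : Rd d) :
    stableSymbol d p α (r • ξ) = Real.exp (-α * (r ^ p * ‖ξ‖ ^ p)) := by
  rw [stableSymbol, norm_smul, Real.norm_of_nonneg hr, Real.mul_rpow hr (norm_nonneg _)]

/-- The lower frame constant of the exponentials in `L₂(exp(-α‖ξ‖^p) dξ)`. -/
noncomputable def lowerFrameConst {d : ℕ} (Z : Set (Rd d)) (R p α : ℝ) : ℝ :=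
  Real.exp (-(2 ^ p * α)) * (2 ^ d)⁻¹ * stableMass d p α * (R ^ 2)⁻¹ / (volume Z).toReal

/-- The upper frame constant of the exponentials in `L₂(exp(-α‖ξ‖^p) dξ)`. -/
noncomputable def upperFrameConst {d : ℕ} (Z : Set (Rd d)) (R p α : ℝ) : ℝ :=
  Real.exp α * 2 ^ d * stableMass d p α * R ^ 2 / (volume Z).toReal

/-- The averaging density is `exp(-2^p α) exp(-α‖2v‖^p)`, which is dominated by the weight at all
points of `v + Z`. -/
lemma HasRieszBounds.lower_stable {d : ℕ} (hd : 1 ≤ d) {p α : ℝ} (hp : 0 < p) (hα : 0 < α)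
    {Z : Set (Rd d)} (hZ : MeasurableSet Z) (hZ1 : Z ⊆ Metric.closedBall 0 1)
    (hZ0 : volume Z ≠ 0) {X : ℕ → Rd d} {R : ℝ} (h : HasRieszBounds Z X R)
    (s : Finset ℕ) (c : ℕ → ℂ) :
    ENNReal.ofReal (lowerFrameConst Z R p α * ∑ j ∈ s, ‖c j‖ ^ 2) ≤
      ∫⁻ ξ, ENNReal.ofReal (stableSymbol d p α ξ) * ‖expSum X s c ξ‖ₑ ^ 2 := by
  have hZf : volume Z ≠ ∞ := ((measure_mono hZ1).trans_lt measure_closedBall_lt_top).ne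
  have hm : Measurable (stableSymbol d p α) := (continuous_stableSymbol hp).measurable
  have h2p : (0 : ℝ) < 2 ^ p := Real.rpow_pos_of_pos two_pos p
  have key := h.lower_weighted hZ hZf
    (W := fun v => ENNReal.ofReal (Real.exp (-(2 ^ p * α))) *
      ENNReal.ofReal (stableSymbol d p α ((2 : ℝ) • v)))
    (F := fun ξ => ENNReal.ofReal (stableSymbol d p α ξ)) (by fun_prop) (by
      intro ξ z hz
      rw [← ENNReal.ofReal_mul (Real.exp_pos _).le]
      refine ENNReal.ofReal_le_ofReal ?_
      rw [stableSymbol_smul two_pos.le, ← Real.exp_add, stableSymbol]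
      refine Real.exp_le_exp.mpr ?_
      have hz1 : ‖z‖ ≤ 1 := by simpa using hZ1 hz
      have h1 : ‖ξ‖ ≤ ‖ξ - z‖ + 1 := by
        have := norm_add_le (ξ - z) z
        rw [sub_add_cancel] at this
        linarith
      have h3 : ‖ξ‖ ^ p ≤ 2 ^ p * (‖ξ - z‖ ^ p + 1) :=
        (Real.rpow_le_rpow (norm_nonneg _) h1 hp.le).trans (add_one_rpow_le hp (norm_nonneg _))
      nlinarith) s c
  rw [lintegral_const_mul _ (by fun_prop),
    lintegral_comp_smul (fun v => ENNReal.ofReal (stableSymbol d p α v)) two_pos,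
    lintegral_stableSymbol hd hp hα, ← ENNReal.ofReal_mul (by positivity),
    ← ENNReal.ofReal_mul (by positivity), ← ENNReal.ofReal_mul (by
      have := (stableMass_pos hd hp hα).le
      positivity), ← ENNReal.div_le_iff hZ0 hZf] at key
  refine le_trans (le_of_eq ?_) key
  conv_rhs => rw [← ENNReal.ofReal_toReal hZf]
  rw [← ENNReal.ofReal_div_of_pos (ENNReal.toReal_pos hZ0 hZf), lowerFrameConst]
  congr 1
  ring

/-- The averaging density is `exp(α) exp(-α‖v/2‖^p)`, which dominates the weight at all points of
`v + Z`. -/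
lemma HasRieszBounds.upper_stable {d : ℕ} (hd : 1 ≤ d) {p α : ℝ} (hp : 0 < p) (hα : 0 < α)
    {Z : Set (Rd d)} (hZ : MeasurableSet Z) (hZ1 : Z ⊆ Metric.closedBall 0 1)
    (hZ0 : volume Z ≠ 0) {X : ℕ → Rd d} {R : ℝ} (h : HasRieszBounds Z X R)
    (s : Finset ℕ) (c : ℕ → ℂ) :
    ∫⁻ ξ, ENNReal.ofReal (stableSymbol d p α ξ) * ‖expSum X s c ξ‖ₑ ^ 2 ≤
      ENNReal.ofReal (upperFrameConst Z R p α * ∑ j ∈ s, ‖c j‖ ^ 2) := by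
  have hZf : volume Z ≠ ∞ := ((measure_mono hZ1).trans_lt measure_closedBall_lt_top).ne
  have hm : Measurable (stableSymbol d p α) := (continuous_stableSymbol hp).measurable
  have h2p : (0 : ℝ) < 2 ^ p := Real.rpow_pos_of_pos two_pos p
  have key := h.upper_weighted hZ hZf
    (W := fun v => ENNReal.ofReal (Real.exp α) *
      ENNReal.ofReal (stableSymbol d p α ((2⁻¹ : ℝ) • v)))
    (F := fun ξ => ENNReal.ofReal (stableSymbol d p α ξ)) (by fun_prop) (by
      intro ξ z hz
      rw [← ENNReal.ofReal_mul (Real.exp_pos _).le]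
      refine ENNReal.ofReal_le_ofReal ?_
      rw [stableSymbol_smul (by norm_num), ← Real.exp_add, stableSymbol]
      refine Real.exp_le_exp.mpr ?_
      have hz1 : ‖z‖ ≤ 1 := by simpa using hZ1 hz
      have h1 : ‖ξ - z‖ ≤ ‖ξ‖ + 1 := by
        have := norm_sub_le ξ z
        linarith
      have h3 : ‖ξ - z‖ ^ p ≤ 2 ^ p * (‖ξ‖ ^ p + 1) :=
        (Real.rpow_le_rpow (norm_nonneg _) h1 hp.le).trans (add_one_rpow_le hp (norm_nonneg _))
      have h4 : (2⁻¹ : ℝ) ^ p * ‖ξ - z‖ ^ p ≤ ‖ξ‖ ^ p + 1 := by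
        rw [Real.inv_rpow two_pos.le, inv_mul_le_iff₀ h2p]
        exact h3
      nlinarith) s c
  rw [lintegral_const_mul _ (by fun_prop),
    lintegral_comp_smul (fun v => ENNReal.ofReal (stableSymbol d p α v)) (by norm_num),
    lintegral_stableSymbol hd hp hα, ← ENNReal.ofReal_mul (by positivity),
    ← ENNReal.ofReal_mul (by positivity), ← ENNReal.ofReal_mul (by
      have := (stableMass_pos hd hp hα).le
      positivity), ← ENNReal.le_div_iff_mul_le (Or.inl hZ0) (Or.inl hZf)] at key
  refine key.trans (le_of_eq ?_)
  conv_lhs => rw [← ENNReal.ofReal_toReal hZf]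
  rw [← ENNReal.ofReal_div_of_pos (ENNReal.toReal_pos hZ0 hZf), upperFrameConst]
  congr 1
  rw [inv_pow, inv_inv]
  ring

/-! ### The native space -/

/-- The measure `exp(-α‖ξ‖^p) dξ`. -/
noncomputable def stableMeasure (d : ℕ) (p α : ℝ) : Measure (Rd d) :=
  volume.withDensity fun ξ => ENNReal.ofReal (stableSymbol d p α ξ)

/-- The native Hilbert space of the kernel, on the Fourier side: an element `w` represents the
function with Fourier transform `exp(-α‖ξ‖^p) w(ξ)`. -/
abbrev NativeSpace (d : ℕ) (p α : ℝ) : Type := Lp ℂ 2 (stableMeasure d p α)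

/-- The Fourier transform of the function represented by an element of the native space. -/
noncomputable def nativeHat {d : ℕ} {p α : ℝ} (w : NativeSpace d p α) (ξ : Rd d) : ℂ :=
  (stableSymbol d p α ξ : ℂ) * w ξ

section NativeSpace

variable {d : ℕ} {p α : ℝ}

lemma stableSymbol_le_one (hα : 0 < α) (ξ : Rd d) : stableSymbol d p α ξ ≤ 1 := by
  rw [stableSymbol, Real.exp_le_one_iff]
  have := Real.rpow_nonneg (norm_nonneg ξ) p
  nlinarith

lemma measurable_ofReal_stableSymbol (hp : 0 < p) :
    Measurable fun ξ => ENNReal.ofReal (stableSymbol d p α ξ) :=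
  (continuous_stableSymbol hp).measurable.ennreal_ofReal

lemma enorm_stableSymbol (ξ : Rd d) :
    ‖(stableSymbol d p α ξ : ℂ)‖ₑ = ENNReal.ofReal (stableSymbol d p α ξ) := by
  rw [← ofReal_norm, Complex.norm_real, Real.norm_of_nonneg (stableSymbol_pos p α ξ).le]

lemma isFiniteMeasure_stableMeasure (hd : 1 ≤ d) (hp : 0 < p) (hα : 0 < α) :
    IsFiniteMeasure (stableMeasure d p α) := by
  refine ⟨?_⟩
  rw [stableMeasure, withDensity_apply _ MeasurableSet.univ, setLIntegral_univ,
    lintegral_stableSymbol hd hp hα]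
  exact ENNReal.ofReal_lt_top

lemma stableMeasure_univ (hd : 1 ≤ d) (hp : 0 < p) (hα : 0 < α) :
    stableMeasure d p α univ = ENNReal.ofReal (stableMass d p α) := by
  rw [stableMeasure, withDensity_apply _ MeasurableSet.univ, setLIntegral_univ,
    lintegral_stableSymbol hd hp hα]

lemma stableMeasure_absolutelyContinuous : stableMeasure d p α ≪ volume :=
  withDensity_absolutelyContinuous _ _

lemma absolutelyContinuous_stableMeasure (hp : 0 < p) : volume ≪ stableMeasure d p α :=
  withDensity_absolutelyContinuous' (measurable_ofReal_stableSymbol hp).aemeasurable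
    (ae_of_all _ fun ξ => by simpa using stableSymbol_pos p α ξ)

lemma lintegral_stableMeasure (hp : 0 < p) (g : Rd d → ℝ≥0∞) :
    ∫⁻ ξ, g ξ ∂(stableMeasure d p α) = ∫⁻ ξ, ENNReal.ofReal (stableSymbol d p α ξ) * g ξ :=
  lintegral_withDensity_eq_lintegral_mul_non_measurable _ (measurable_ofReal_stableSymbol hp)
    (ae_of_all _ fun _ => ENNReal.ofReal_lt_top) g

lemma setLIntegral_stableMeasure (hp : 0 < p) {S : Set (Rd d)} (hS : MeasurableSet S)
    (g : Rd d → ℝ≥0∞) :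
    ∫⁻ ξ in S, g ξ ∂(stableMeasure d p α)
      = ∫⁻ ξ in S, ENNReal.ofReal (stableSymbol d p α ξ) * g ξ :=
  setLIntegral_withDensity_eq_setLIntegral_mul_non_measurable _
    (measurable_ofReal_stableSymbol hp) g hS (ae_of_all _ fun _ => ENNReal.ofReal_lt_top)

lemma integral_stableMeasure (hp : 0 < p) (g : Rd d → ℂ) :
    ∫ ξ, g ξ ∂(stableMeasure d p α) = ∫ ξ, (stableSymbol d p α ξ : ℂ) * g ξ := by
  rw [stableMeasure, integral_withDensity_eq_integral_toReal_smul
    (measurable_ofReal_stableSymbol hp) (ae_of_all _ fun _ => ENNReal.ofReal_lt_top)]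
  refine integral_congr_ae (ae_of_all _ fun ξ => ?_)
  simp only [ENNReal.toReal_ofReal (stableSymbol_pos p α ξ).le, Complex.real_smul]

lemma integrable_stableMeasure_iff (hp : 0 < p) (g : Rd d → ℂ) :
    Integrable g (stableMeasure d p α) ↔ Integrable fun ξ => (stableSymbol d p α ξ : ℂ) * g ξ := by
  rw [stableMeasure, integrable_withDensity_iff_integrable_smul'
    (measurable_ofReal_stableSymbol hp) (ae_of_all _ fun _ => ENNReal.ofReal_lt_top)]
  refine integrable_congr (ae_of_all _ fun ξ => ?_)
  simp only [ENNReal.toReal_ofReal (stableSymbol_pos p α ξ).le, Complex.real_smul]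

lemma enorm_sq_eq_lintegral (hp : 0 < p) (w : NativeSpace d p α) :
    ‖w‖ₑ ^ 2 = ∫⁻ ξ, ENNReal.ofReal (stableSymbol d p α ξ) * ‖w ξ‖ₑ ^ 2 := by
  rw [Lp.enorm_def, eLpNorm_two_sq, lintegral_stableMeasure hp]

lemma enorm_nativeHat (w : NativeSpace d p α) (ξ : Rd d) :
    ‖nativeHat w ξ‖ₑ = ENNReal.ofReal (stableSymbol d p α ξ) * ‖w ξ‖ₑ := by
  rw [nativeHat, enorm_mul, enorm_stableSymbol]

lemma aestronglyMeasurable_native (hp : 0 < p) (w : NativeSpace d p α) :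
    AEStronglyMeasurable (w : Rd d → ℂ) volume :=
  (Lp.aestronglyMeasurable w).mono_ac (absolutelyContinuous_stableMeasure hp)

lemma integrable_nativeHat (hd : 1 ≤ d) (hp : 0 < p) (hα : 0 < α) (w : NativeSpace d p α) :
    Integrable (nativeHat w) := by
  have := isFiniteMeasure_stableMeasure hd hp hα
  exact (integrable_stableMeasure_iff hp _).mp ((Lp.memLp w).integrable (by norm_num))

/-- On a set where the symbol is at most `ε`, the `L²`-norm of the Fourier transform is controlled
by the native norm. -/
lemma setLIntegral_enorm_nativeHat_sq_le (hp : 0 < p) (w : NativeSpace d p α) {S : Set (Rd d)}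
    (hS : MeasurableSet S) {ε : ℝ} (hε : ∀ ξ ∈ S, stableSymbol d p α ξ ≤ ε) :
    ∫⁻ ξ in S, ‖nativeHat w ξ‖ₑ ^ 2 ≤ ENNReal.ofReal ε * ‖w‖ₑ ^ 2 := by
  rw [enorm_sq_eq_lintegral hp, ← lintegral_const_mul' _ _ ENNReal.ofReal_ne_top]
  refine (setLIntegral_mono' hS fun ξ hξ => ?_).trans (setLIntegral_le_lintegral S _)
  rw [enorm_nativeHat, mul_pow, sq (ENNReal.ofReal (stableSymbol d p α ξ)), mul_assoc]
  exact mul_le_mul_left (ENNReal.ofReal_le_ofReal (hε ξ hξ)) _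

lemma eLpNorm_nativeHat_le (hp : 0 < p) (hα : 0 < α) (w : NativeSpace d p α) :
    eLpNorm (nativeHat w) 2 volume ≤ ‖w‖ₑ := by
  have := setLIntegral_enorm_nativeHat_sq_le hp w MeasurableSet.univ
    (fun ξ _ => stableSymbol_le_one hα ξ)
  rw [setLIntegral_univ, ENNReal.ofReal_one, one_mul, ← eLpNorm_two_sq] at this
  exact (ENNReal.pow_le_pow_left_iff two_ne_zero).mp this

lemma memLp_nativeHat (hp : 0 < p) (hα : 0 < α) (w : NativeSpace d p α) :
    MemLp (nativeHat w) 2 volume :=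
  ⟨(Complex.continuous_ofReal.comp (continuous_stableSymbol hp)).aestronglyMeasurable.mul
    (aestronglyMeasurable_native hp w),
    (eLpNorm_nativeHat_le hp hα w).trans_lt enorm_lt_top⟩

lemma memLp_expFun {μ : Measure (Rd d)} [IsFiniteMeasure μ] (x : Rd d) : MemLp (expFun x) 2 μ :=
  MemLp.of_bound (continuous_expFun x).aestronglyMeasurable 1
    (ae_of_all _ fun ξ => (norm_expFun x ξ).le)

/-- The exponential `exp(-i⟨x, ·⟩)` as an element of the native space; it represents the translate
of the kernel by `x`. -/
noncomputable def nativeExp (p α : ℝ) [IsFiniteMeasure (stableMeasure d p α)] (x : Rd d) :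
    NativeSpace d p α :=
  (memLp_expFun x).toLp (expFun x)

lemma coeFn_nativeExp [IsFiniteMeasure (stableMeasure d p α)] (x : Rd d) :
    (nativeExp p α x : Rd d → ℂ) =ᵐ[stableMeasure d p α] expFun x :=
  MemLp.coeFn_toLp _

/-- Reproducing property. -/
lemma fourierConst_mul_inner_nativeExp (hp : 0 < p) [IsFiniteMeasure (stableMeasure d p α)]
    (x : Rd d) (w : NativeSpace d p α) :
    (fourierConst d : ℂ) * inner ℂ (nativeExp p α x) w = invHat (nativeHat w) x := by
  rw [invHat, L2.inner_def]
  congr 1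
  rw [integral_congr_ae (g := fun ξ => w ξ * (starRingEnd ℂ) (expFun x ξ)) (by
    filter_upwards [coeFn_nativeExp (p := p) (α := α) x] with ξ hξ
    rw [hξ, RCLike.inner_apply']
    ring), integral_stableMeasure hp]
  refine integral_congr_ae (ae_of_all _ fun ξ => ?_)
  simp only [conj_expFun, nativeHat, mul_assoc]

lemma fourierConst_mul_inner_nativeExp_nativeExp (hp : 0 < p)
    [IsFiniteMeasure (stableMeasure d p α)] (x y : Rd d) :
    (fourierConst d : ℂ) * inner ℂ (nativeExp p α x) (nativeExp p α y)
      = stableKernel d p α (x - y) := by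
  rw [stableKernel_eq_invHat, invHat, L2.inner_def]
  congr 1
  rw [integral_congr_ae (g := fun ξ => expFun y ξ * (starRingEnd ℂ) (expFun x ξ)) (by
    filter_upwards [coeFn_nativeExp (p := p) (α := α) x, coeFn_nativeExp (p := p) (α := α) y]
      with ξ hξ hξ'
    rw [hξ, hξ', RCLike.inner_apply']
    ring), integral_stableMeasure hp]
  refine integral_congr_ae (ae_of_all _ fun ξ => ?_)
  simp only [conj_expFun_mul_expFun]

lemma nativeHat_sub (hp : 0 < p) (v w : NativeSpace d p α) :
    nativeHat (v - w) =ᵐ[volume] fun ξ => nativeHat v ξ - nativeHat w ξ := by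
  filter_upwards [(absolutelyContinuous_stableMeasure hp).ae_le (Lp.coeFn_sub v w)] with ξ hξ
  rw [nativeHat, hξ, Pi.sub_apply, nativeHat, nativeHat, mul_sub]

/-- Band-limited functions belong to the native space. -/
lemma exists_nativeHat_eq (hp : 0 < p) (hα : 0 < α) {r : ℝ} {φ : Rd d → ℂ}
    (hφ : MemLp φ 2 volume) (hs : ∀ ξ, ξ ∉ Metric.closedBall 0 r → φ ξ = 0) :
    ∃ u : NativeSpace d p α, nativeHat u =ᵐ[volume] φ := by
  have hmem : MemLp (fun ξ => (stableSymbol d p α ξ : ℂ)⁻¹ * φ ξ) 2 (stableMeasure d p α) := by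
    refine ⟨AEStronglyMeasurable.mono_ac stableMeasure_absolutelyContinuous
      ((Continuous.inv₀ (Complex.continuous_ofReal.comp (continuous_stableSymbol hp)) fun ξ => by
        simpa using (stableSymbol_pos p α ξ).ne').aestronglyMeasurable.mul hφ.1), ?_⟩
    have h1 : eLpNorm (fun ξ => (stableSymbol d p α ξ : ℂ)⁻¹ * φ ξ) 2 (stableMeasure d p α) ^ 2
        ≤ ENNReal.ofReal (Real.exp (α * r ^ p)) * eLpNorm φ 2 volume ^ 2 := by
      rw [eLpNorm_two_sq, lintegral_stableMeasure hp, eLpNorm_two_sq,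
        ← lintegral_const_mul' _ _ ENNReal.ofReal_ne_top]
      refine lintegral_mono fun ξ => ?_
      by_cases hξ : ξ ∈ Metric.closedBall 0 r
      · have hF := stableSymbol_pos p α ξ
        have h2 : ‖(stableSymbol d p α ξ : ℂ)⁻¹‖ₑ = ENNReal.ofReal (stableSymbol d p α ξ)⁻¹ := by
          rw [← ofReal_norm, norm_inv, Complex.norm_real, Real.norm_of_nonneg hF.le]
        rw [enorm_mul, mul_pow, h2, ← mul_assoc, ← ENNReal.ofReal_pow (by positivity),
          ← ENNReal.ofReal_mul hF.le]
        refine mul_le_mul_left (ENNReal.ofReal_le_ofReal ?_) _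
        have e : stableSymbol d p α ξ * (stableSymbol d p α ξ)⁻¹ ^ 2
            = Real.exp (α * ‖ξ‖ ^ p) := by
          rw [sq, ← mul_assoc, mul_inv_cancel₀ hF.ne', one_mul, stableSymbol, ← Real.exp_neg]
          congr 1; ring
        rw [e]
        refine Real.exp_le_exp.mpr (mul_le_mul_of_nonneg_left ?_ hα.le)
        exact Real.rpow_le_rpow (norm_nonneg _) (by simpa using hξ) hp.le
      · simp [hs ξ hξ]
    have h2 : ENNReal.ofReal (Real.exp (α * r ^ p)) * eLpNorm φ 2 volume ^ 2 < ∞ :=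
      ENNReal.mul_lt_top ENNReal.ofReal_lt_top (ENNReal.pow_lt_top hφ.2)
    by_contra hcon
    rw [not_lt, top_le_iff] at hcon
    rw [hcon] at h1
    simp only [ne_eq, OfNat.ofNat_ne_zero, not_false_eq_true, ENNReal.top_pow, top_le_iff] at h1
    exact h2.ne h1
  refine ⟨hmem.toLp _, ?_⟩
  filter_upwards [(absolutelyContinuous_stableMeasure hp).ae_le hmem.coeFn_toLp] with ξ hξ
  rw [nativeHat, hξ, mul_inv_cancel_left₀]
  simpa using (stableSymbol_pos p α ξ).ne'

/-- The Cauchy-Schwarz inequality. -/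
lemma lintegral_enorm_mul_enorm_le {T : Type*} [MeasurableSpace T] {μ : Measure T} {f g : T → ℂ}
    (hf : AEStronglyMeasurable f μ) (hg : AEStronglyMeasurable g μ) :
    ∫⁻ t, ‖f t‖ₑ * ‖g t‖ₑ ∂μ ≤ eLpNorm f 2 μ * eLpNorm g 2 μ := by
  have := ENNReal.lintegral_mul_le_Lp_mul_Lq μ (p := 2) (q := 2)
    (Real.HolderConjugate.two_two) hf.enorm hg.enorm
  simpa [eLpNorm_eq_lintegral_rpow_enorm_toReal] using this

/-- The inner product with a function represented by `φ` is an unweighted integral. -/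
lemma enorm_inner_le_lintegral (hp : 0 < p) (w u : NativeSpace d p α) {φ : Rd d → ℂ}
    (hu : nativeHat u =ᵐ[volume] φ) :
    ‖(inner ℂ w u : ℂ)‖ₑ ≤ ∫⁻ ξ, ‖w ξ‖ₑ * ‖φ ξ‖ₑ := by
  rw [L2.inner_def, integral_stableMeasure hp]
  refine (enorm_integral_le_lintegral_enorm _).trans (le_of_eq (lintegral_congr_ae ?_))
  filter_upwards [hu] with ξ hξ
  rw [← hξ, RCLike.inner_apply', nativeHat, enorm_mul, enorm_mul, enorm_mul, RCLike.enorm_conj]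
  ring

end NativeSpace

/-! ### Consequences of orthogonality in the native space -/

section Estimates

variable {d : ℕ} {p α : ℝ}

/-- If `w = v - u` with `w ⊥ v` and `u` represents a function with spectrum `φ` in `βB₂`, the
squared native norm `‖w‖² = -⟨w, u⟩` is controlled linearly by the `L²`-norm. -/
lemma native_enorm_sq_le (hp : 0 < p) (hα : 0 < α) {β : ℝ} {w u : NativeSpace d p α}
    {φ : Rd d → ℂ} (hφ : MemLp φ 2 volume) (hs : ∀ ξ, ξ ∉ Metric.closedBall 0 β → φ ξ = 0)
    (hu : nativeHat u =ᵐ[volume] φ) (hw : inner ℂ w (w + u) = 0) :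
    ‖w‖ₑ ^ 2 ≤ ENNReal.ofReal (Real.exp (α * β ^ p)) *
      (eLpNorm (nativeHat w) 2 volume * eLpNorm φ 2 volume) := by
  have h1 : ‖w‖ₑ ^ 2 = ‖(inner ℂ w u : ℂ)‖ₑ := by
    rw [inner_add_right, add_eq_zero_iff_eq_neg, inner_self_eq_norm_sq_to_K] at hw
    have h2 := congrArg (fun z : ℂ => ‖z‖ₑ) hw
    simp only [enorm_neg] at h2
    rw [← h2, enorm_pow]
    congr 1
    rw [← ofReal_norm, ← ofReal_norm]
    simp
  rw [h1]
  refine (enorm_inner_le_lintegral hp w u hu).trans ?_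
  refine le_trans ?_ (mul_le_mul_right (lintegral_enorm_mul_enorm_le
    (memLp_nativeHat hp hα w).1 hφ.1) _)
  rw [← lintegral_const_mul' _ _ ENNReal.ofReal_ne_top]
  refine lintegral_mono fun ξ => ?_
  by_cases hξ : ξ ∈ Metric.closedBall 0 β
  · rw [enorm_nativeHat, ← mul_assoc, ← mul_assoc, ← ENNReal.ofReal_mul (Real.exp_pos _).le]
    refine mul_le_mul_left ?_ _
    have h3 : 1 ≤ Real.exp (α * β ^ p) * stableSymbol d p α ξ := by
      rw [stableSymbol, ← Real.exp_add]
      refine Real.one_le_exp ?_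
      have : ‖ξ‖ ^ p ≤ β ^ p := Real.rpow_le_rpow (norm_nonneg _) (by simpa using hξ) hp.le
      nlinarith
    calc ‖w ξ‖ₑ = 1 * ‖w ξ‖ₑ := (one_mul _).symm
      _ ≤ _ := mul_le_mul_left (ENNReal.one_le_ofReal.mpr h3) _
  · simp [hs ξ hξ]

/-- A vector is bounded by its pairings with finite linear combinations of a Riesz basis. -/
lemma IsRieszBasis.norm_le_of_forall_inner_le {H : Type*} [NormedAddCommGroup H]
    [InnerProductSpace ℂ H] {e : ℕ → H} (h : IsRieszBasis e) {y : H} {M : ℝ} (hM : 0 ≤ M)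
    (hy : ∀ (s : Finset ℕ) (c : ℕ → ℂ),
      ‖(inner ℂ (∑ j ∈ s, c j • e j) y : ℂ)‖ ≤ M * ‖∑ j ∈ s, c j • e j‖) : ‖y‖ ≤ M := by
  obtain ⟨a, ⟨-, ha⟩, -⟩ := h.existsUnique_expansion y
  have h1 : ‖(inner ℂ y y : ℂ)‖ ≤ M * ‖y‖ :=
    le_of_tendsto_of_tendsto' ((Filter.Tendsto.inner ha tendsto_const_nhds).norm)
      (ha.norm.const_mul M) fun s => hy s a
  rw [inner_self_eq_norm_sq_to_K] at h1
  simp only [norm_pow, RCLike.norm_ofReal, abs_norm] at h1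
  rcases eq_or_lt_of_le (norm_nonneg y) with h0 | h0
  · rw [← h0]; exact hM
  · nlinarith

/-- Outside `δB₂` the symbol for `α ≥ 1` is dominated by the symbol for `α = 1`, with an
exponentially small factor. -/
lemma stableSymbol_le_of_le_norm (hp : 0 < p) (hα : 1 ≤ α) {δ : ℝ} (hδ : 0 ≤ δ) {ξ : Rd d}
    (hξ : δ ≤ ‖ξ‖) :
    stableSymbol d p α ξ ≤ Real.exp (-(α - 1) * δ ^ p) * stableSymbol d p 1 ξ := by
  rw [stableSymbol, stableSymbol, ← Real.exp_add]
  refine Real.exp_le_exp.mpr ?_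
  have : δ ^ p ≤ ‖ξ‖ ^ p := Real.rpow_le_rpow hδ hξ hp.le
  nlinarith

/-- The upper frame bound for `α = 1` controls exponential sums outside `Z` for all `α ≥ 1`, with
the exponentially small factor by which the symbols differ there. -/
lemma setLIntegral_compl_expSum_le (hd : 1 ≤ d) (hp : 0 < p) (hα : 1 ≤ α) {δ : ℝ} (hδ : 0 ≤ δ)
    {Z : Set (Rd d)} (hZ : MeasurableSet Z) (hδZ : Metric.closedBall 0 δ ⊆ Z)
    (hZ1 : Z ⊆ Metric.closedBall 0 1) (hZ0 : volume Z ≠ 0) {X : ℕ → Rd d} {R : ℝ}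
    (h : HasRieszBounds Z X R) (s : Finset ℕ) (c : ℕ → ℂ) :
    ∫⁻ ξ in Zᶜ, ‖expSum X s c ξ‖ₑ ^ 2 ∂(stableMeasure d p α) ≤
      ENNReal.ofReal (Real.exp (-(α - 1) * δ ^ p) * upperFrameConst Z R p 1 *
        ∑ j ∈ s, ‖c j‖ ^ 2) := by
  rw [setLIntegral_stableMeasure hp hZ.compl, mul_assoc, ENNReal.ofReal_mul (Real.exp_pos _).le]
  refine le_trans ?_ (mul_le_mul_right (h.upper_stable hd hp one_pos hZ hZ1 hZ0 s c) _)
  rw [← lintegral_const_mul' _ _ ENNReal.ofReal_ne_top]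
  refine (setLIntegral_mono' hZ.compl fun ξ hξ => ?_).trans (setLIntegral_le_lintegral _ _)
  rw [← mul_assoc, ← ENNReal.ofReal_mul (Real.exp_pos _).le]
  refine mul_le_mul_left (ENNReal.ofReal_le_ofReal ?_) _
  have : δ ≤ ‖ξ‖ := by
    by_contra hcon
    exact hξ (hδZ (by simpa using (not_le.mp hcon).le))
  exact stableSymbol_le_of_le_norm hp hα hδ this

lemma upperFrameConst_nonneg {Z : Set (Rd d)} {R : ℝ} (hd : 1 ≤ d) (hp : 0 < p) (hα : 0 < α) :
    0 ≤ upperFrameConst Z R p α := by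
  have := (stableMass_pos hd hp hα).le
  unfold upperFrameConst
  positivity

/-- If `w` is orthogonal to all exponentials, its Fourier transform on `Z` is controlled by the
part outside `Z`, where the symbol is exponentially small. -/
lemma setLIntegral_nativeHat_le_of_orthogonal (hd : 1 ≤ d) (hp : 0 < p) (hα : 1 ≤ α) {δ : ℝ}
    (hδ : 0 ≤ δ) {Z : Set (Rd d)} (hZ : MeasurableSet Z) (hδZ : Metric.closedBall 0 δ ⊆ Z)
    (hZ1 : Z ⊆ Metric.closedBall 0 1) (hZ0 : volume Z ≠ 0) {X : ℕ → Rd d} {R : ℝ} (hR : 0 < R)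
    {e : ℕ → Lp ℂ 2 (volume.restrict Z)}
    (he : ∀ j, (e j : Rd d → ℂ) =ᵐ[volume.restrict Z] expFun (X j)) (hb : IsRieszBasis e)
    (hRb : ∀ (s : Finset ℕ) (c : ℕ → ℂ),
      (R ^ 2)⁻¹ * ∑ j ∈ s, ‖c j‖ ^ 2 ≤ ‖∑ j ∈ s, c j • e j‖ ^ 2 ∧
      ‖∑ j ∈ s, c j • e j‖ ^ 2 ≤ R ^ 2 * ∑ j ∈ s, ‖c j‖ ^ 2)
    [IsFiniteMeasure (stableMeasure d p α)] {w : NativeSpace d p α}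
    (hw : ∀ j, inner ℂ (nativeExp p α (X j)) w = 0) :
    ∫⁻ ξ in Z, ‖nativeHat w ξ‖ₑ ^ 2 ≤
      ENNReal.ofReal (Real.exp (-(α - 1) * δ ^ p) * upperFrameConst Z R p 1 * R ^ 2) *
        ‖w‖ₑ ^ 2 := by
  have hα0 : 0 < α := one_pos.trans_le hα
  have hRB := hasRieszBounds_of_finset_bounds he hRb
  set D : ℝ := Real.exp (-(α - 1) * δ ^ p) * upperFrameConst Z R p 1 with hD
  have hD0 : 0 ≤ D := mul_nonneg (Real.exp_pos _).le (upperFrameConst_nonneg hd hp one_pos)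
  have hmem : MemLp (nativeHat w) 2 (volume.restrict Z) := (memLp_nativeHat hp hα0 w).restrict Z
  set y : Lp ℂ 2 (volume.restrict Z) := hmem.toLp _ with hy
  have hbound : ‖y‖ ≤ √(D * R ^ 2) * ‖w‖ := by
    refine hb.norm_le_of_forall_inner_le (by positivity) fun s c => ?_
    have hQ : ∑ j ∈ s, ‖c j‖ ^ 2 ≤ R ^ 2 * ‖∑ j ∈ s, c j • e j‖ ^ 2 := by
      have := (hRb s c).1
      rwa [inv_mul_le_iff₀ (by positivity)] at this
    -- the pairing over the whole space vanishes, so the pairings over `Z` and `Zᶜ` cancel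
    have hint : Integrable (fun ξ => (starRingEnd ℂ) (expSum X s c ξ) * w ξ)
        (stableMeasure d p α) := by
      refine (L2.integrable_inner (𝕜 := ℂ) (∑ j ∈ s, c j • nativeExp p α (X j)) w).congr ?_
      filter_upwards [coeFn_sum_smul_ae_eq (fun j => coeFn_nativeExp (X j)) s c] with ξ hξ
      rw [hξ, RCLike.inner_apply']
    have htot : ∫ ξ, (stableSymbol d p α ξ : ℂ) * ((starRingEnd ℂ) (expSum X s c ξ) * w ξ) = 0 := by
      rw [← integral_stableMeasure hp]
      have h0 : inner ℂ (∑ j ∈ s, c j • nativeExp p α (X j)) w = 0 := by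
        rw [sum_inner]
        exact Finset.sum_eq_zero fun j _ => by rw [inner_smul_left, hw, mul_zero]
      rw [← h0, L2.inner_def]
      refine integral_congr_ae ?_
      filter_upwards [coeFn_sum_smul_ae_eq (fun j => coeFn_nativeExp (X j)) s c] with ξ hξ
      rw [hξ, RCLike.inner_apply']
    have hinner : inner ℂ (∑ j ∈ s, c j • e j) y =
        ∫ ξ in Z, (stableSymbol d p α ξ : ℂ) * ((starRingEnd ℂ) (expSum X s c ξ) * w ξ) := by
      rw [L2.inner_def]
      refine integral_congr_ae ?_
      filter_upwards [coeFn_sum_smul_ae_eq he s c, hmem.coeFn_toLp] with ξ h1 h2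
      rw [h1, h2, RCLike.inner_apply', nativeHat]
      ring
    rw [← integral_add_compl hZ ((integrable_stableMeasure_iff hp _).mp hint), ← hinner,
      add_eq_zero_iff_eq_neg] at htot
    have h1 : ‖(inner ℂ (∑ j ∈ s, c j • e j) y : ℂ)‖ₑ ≤
        eLpNorm (expSum X s c) 2 ((stableMeasure d p α).restrict Zᶜ) * ‖w‖ₑ := by
      rw [htot, enorm_neg]
      refine (enorm_integral_le_lintegral_enorm _).trans ?_
      have h2 : ∫⁻ ξ in Zᶜ, ‖(stableSymbol d p α ξ : ℂ) *
          ((starRingEnd ℂ) (expSum X s c ξ) * w ξ)‖ₑ =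
          ∫⁻ ξ in Zᶜ, ‖expSum X s c ξ‖ₑ * ‖w ξ‖ₑ ∂(stableMeasure d p α) := by
        rw [setLIntegral_stableMeasure hp hZ.compl]
        refine lintegral_congr fun ξ => ?_
        rw [enorm_mul, enorm_mul, enorm_stableSymbol, RCLike.enorm_conj]
      rw [h2]
      refine (lintegral_enorm_mul_enorm_le (continuous_expSum X s c).aestronglyMeasurable
        (Lp.aestronglyMeasurable w).restrict).trans ?_
      refine mul_le_mul_right ?_ _
      rw [Lp.enorm_def]
      exact eLpNorm_restrict_le _ _ _ _
    have h2 : eLpNorm (expSum X s c) 2 ((stableMeasure d p α).restrict Zᶜ) ^ 2 ≤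
        ENNReal.ofReal (D * (R ^ 2 * ‖∑ j ∈ s, c j • e j‖ ^ 2)) := by
      rw [eLpNorm_two_sq]
      exact (setLIntegral_compl_expSum_le hd hp hα hδ hZ hδZ hZ1 hZ0 hRB s c).trans
        (ENNReal.ofReal_le_ofReal (mul_le_mul_of_nonneg_left hQ hD0))
    have h3 : ‖(inner ℂ (∑ j ∈ s, c j • e j) y : ℂ)‖ ^ 2 ≤
        D * (R ^ 2 * ‖∑ j ∈ s, c j • e j‖ ^ 2) * ‖w‖ ^ 2 := by
      rw [← ENNReal.ofReal_le_ofReal_iff (by positivity), ENNReal.ofReal_pow (norm_nonneg _),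
        ofReal_norm, ENNReal.ofReal_mul (by positivity), ENNReal.ofReal_pow (norm_nonneg _),
        ofReal_norm]
      refine (pow_le_pow_left₀ zero_le h1 2).trans ?_
      rw [mul_pow]
      exact mul_le_mul_left h2 _
    refine le_of_sq_le_sq (h3.trans (le_of_eq ?_)) (by positivity)
    rw [mul_pow, mul_pow, Real.sq_sqrt (by positivity)]
    ring
  have h4 : ∫⁻ ξ in Z, ‖nativeHat w ξ‖ₑ ^ 2 = ‖y‖ₑ ^ 2 := by
    rw [Lp.enorm_def, eLpNorm_congr_ae hmem.coeFn_toLp, eLpNorm_two_sq]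
  have h5 := pow_le_pow_left₀ (norm_nonneg _) hbound 2
  rw [mul_pow, Real.sq_sqrt (by positivity)] at h5
  rw [h4, ← ofReal_norm, ← ofReal_norm, ← ENNReal.ofReal_pow (norm_nonneg _),
    ← ENNReal.ofReal_pow (norm_nonneg _), ← ENNReal.ofReal_mul (by positivity)]
  exact ENNReal.ofReal_le_ofReal h5

end Estimates

/-! ### The interpolation problem in the native space -/

section Interpolation

variable {d : ℕ} {p α : ℝ}

lemma lowerFrameConst_pos {Z : Set (Rd d)} {R : ℝ} (hd : 1 ≤ d) (hp : 0 < p) (hα : 0 < α)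
    (hZ1 : Z ⊆ Metric.closedBall 0 1) (hZ0 : volume Z ≠ 0) (hR : 0 < R) :
    0 < lowerFrameConst Z R p α := by
  have h1 := stableMass_pos hd hp hα
  have hZf : volume Z ≠ ∞ := ((measure_mono hZ1).trans_lt measure_closedBall_lt_top).ne
  have h2 := ENNReal.toReal_pos hZ0 hZf
  unfold lowerFrameConst
  positivity

lemma HasRieszBounds.native_bounds (hd : 1 ≤ d) (hp : 0 < p) (hα : 0 < α)
    [IsFiniteMeasure (stableMeasure d p α)] {Z : Set (Rd d)} (hZ : MeasurableSet Z)
    (hZ1 : Z ⊆ Metric.closedBall 0 1) (hZ0 : volume Z ≠ 0) {X : ℕ → Rd d} {R : ℝ}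
    (h : HasRieszBounds Z X R) (s : Finset ℕ) (c : ℕ → ℂ) :
    lowerFrameConst Z R p α * ∑ j ∈ s, ‖c j‖ ^ 2 ≤
      ‖∑ j ∈ s, c j • nativeExp p α (X j)‖ ^ 2 ∧
    ‖∑ j ∈ s, c j • nativeExp p α (X j)‖ ^ 2 ≤
      upperFrameConst Z R p α * ∑ j ∈ s, ‖c j‖ ^ 2 := by
  have e := enorm_norm_sq_eq_lintegral _
    (coeFn_sum_smul_ae_eq (fun j => coeFn_nativeExp (p := p) (α := α) (X j)) s c)
  rw [lintegral_stableMeasure hp] at e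
  have hB := upperFrameConst_nonneg (Z := Z) (R := R) hd hp hα
  constructor
  · rw [← ENNReal.ofReal_le_ofReal_iff (by positivity), e]
    exact h.lower_stable hd hp hα hZ hZ1 hZ0 s c
  · rw [← ENNReal.ofReal_le_ofReal_iff (by positivity), e]
    exact h.upper_stable hd hp hα hZ hZ1 hZ0 s c

/-- The interpolation problem for the kernel is the Gram system of the exponentials in the native
space; its solution represents the interpolant as the orthogonal projection `v` of the element
`u` representing `f = invHat φ`. -/
lemma exists_interpolation (hd : 1 ≤ d) (hp : 0 < p) (hα : 0 < α)
    [IsFiniteMeasure (stableMeasure d p α)] {Z : Set (Rd d)} (hZ : MeasurableSet Z)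
    (hZ1 : Z ⊆ Metric.closedBall 0 1) (hZ0 : volume Z ≠ 0) {X : ℕ → Rd d} {R : ℝ} (hR : 0 < R)
    (h : HasRieszBounds Z X R) {φ : Rd d → ℂ} (hφ : MemLp φ 2 volume)
    (hφZ : ∀ ξ, ξ ∉ Z → φ ξ = 0) :
    ∃ (u v : NativeSpace d p α) (a : ℕ → ℂ), nativeHat u =ᵐ[volume] φ ∧
      HasSum (fun j => a j • nativeExp p α (X j)) v ∧
      (∀ k, inner ℂ (nativeExp p α (X k)) (v - u) = 0) ∧
      (∃! b, IsInterpolationCoeff (stableKernel d p α) X (invHat φ) b) ∧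
      ∀ x, HasSum (fun j => interpolationCoeff (stableKernel d p α) X (invHat φ) j *
        stableKernel d p α (x - X j)) (invHat (nativeHat v) x) := by
  obtain ⟨u, hu⟩ := exists_nativeHat_eq hp hα (r := 1) hφ fun ξ hξ => hφZ ξ fun h' => hξ (hZ1 h')
  have hb := h.native_bounds (p := p) (α := α) hd hp hα hZ hZ1 hZ0
  obtain ⟨a, v, ha, hv, hproj, huniq⟩ := exists_gram_solution
    (lowerFrameConst_pos hd hp hα hZ1 hZ0 hR) (fun s c => (hb s c).1) (fun s c => (hb s c).2) u
  have hκ : (fourierConst d : ℂ) ≠ 0 := by exact_mod_cast (fourierConst_pos d).ne'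
  have huf : ∀ x, (fourierConst d : ℂ) * inner ℂ (nativeExp p α x) u = invHat φ x := fun x => by
    rw [fourierConst_mul_inner_nativeExp hp, invHat, invHat]
    congr 1
    refine integral_congr_ae ?_
    filter_upwards [hu] with ξ hξ
    rw [hξ]
  have hval : ∀ x, HasSum (fun j => a j * stableKernel d p α (x - X j))
      (invHat (nativeHat v) x) := fun x => by
    rw [← fourierConst_mul_inner_nativeExp hp]
    have h1 := (hv.mapL (innerSL ℂ (nativeExp p α x))).mul_left (fourierConst d : ℂ)
    simp only [innerSL_apply_apply, inner_smul_right] at h1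
    have e : (fun j => a j * stableKernel d p α (x - X j)) = fun j => (fourierConst d : ℂ) *
        (a j * inner ℂ (nativeExp p α x) (nativeExp p α (X j))) := funext fun j => by
      rw [← fourierConst_mul_inner_nativeExp_nativeExp hp]
      ring
    rw [e]
    exact h1
  have hsol : IsInterpolationCoeff (stableKernel d p α) X (invHat φ) a := by
    refine ⟨ha, fun k => ?_⟩
    have h1 := hval (X k)
    rwa [← fourierConst_mul_inner_nativeExp hp, hproj k, huf] at h1
  have hun : ∀ b, IsInterpolationCoeff (stableKernel d p α) X (invHat φ) b → b = a := by
    intro b ⟨hb1, hb2⟩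
    refine huniq b hb1 fun k => ?_
    have h1 := (hb2 k).mul_left (fourierConst d : ℂ)⁻¹
    rw [← huf, inv_mul_cancel_left₀ hκ] at h1
    have e : (fun j => b j * inner ℂ (nativeExp p α (X k)) (nativeExp p α (X j))) = fun j =>
        (fourierConst d : ℂ)⁻¹ * (b j * stableKernel d p α (X k - X j)) := funext fun j => by
      rw [← fourierConst_mul_inner_nativeExp_nativeExp hp]
      field_simp
    rw [e]
    exact h1
  have hcoeff : interpolationCoeff (stableKernel d p α) X (invHat φ) = a :=
    hun _ (Classical.epsilon_spec ⟨a, hsol⟩)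
  refine ⟨u, v, a, hu, hv, fun k => ?_, ⟨a, hsol, hun⟩, fun x => ?_⟩
  · rw [inner_sub_right, hproj, sub_self]
  · rw [hcoeff]
    exact hval x

lemma inner_eq_zero_of_hasSum {K : Type*} [NormedAddCommGroup K] [InnerProductSpace ℂ K]
    {E : ℕ → K} {a : ℕ → ℂ} {v w : K} (hv : HasSum (fun j => a j • E j) v)
    (hw : ∀ k, inner ℂ (E k) w = 0) : inner ℂ w v = 0 := by
  have h1 := hv.mapL (innerSL ℂ w)
  have h2 : ∀ j, innerSL ℂ w (a j • E j) = 0 := fun j => by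
    rw [innerSL_apply_apply, inner_smul_right, ← inner_conj_symm, hw]
    simp
  simp only [h2] at h1
  simpa using h1.unique hasSum_zero

/-- The native norm of the interpolant, bounded through the lower frame constant. -/
lemma enorm_interpolant_le (hd : 1 ≤ d) (hp : 0 < p) (hα : 0 < α)
    [IsFiniteMeasure (stableMeasure d p α)] {Z : Set (Rd d)} (hZ : MeasurableSet Z)
    (hZ1 : Z ⊆ Metric.closedBall 0 1) (hZ0 : volume Z ≠ 0) {X : ℕ → Rd d} {R : ℝ} (hR : 0 < R)
    (h : HasRieszBounds Z X R) {φ : Rd d → ℂ} (hφ : MemLp φ 2 volume)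
    (hφZ : ∀ ξ, ξ ∉ Z → φ ξ = 0) {u v : NativeSpace d p α} {a : ℕ → ℂ}
    (hu : nativeHat u =ᵐ[volume] φ) (hv : HasSum (fun j => a j • nativeExp p α (X j)) v)
    (hw : ∀ k, inner ℂ (nativeExp p α (X k)) (v - u) = 0) :
    ‖v‖ₑ ≤ ENNReal.ofReal √(R ^ 2 / lowerFrameConst Z R p α) * eLpNorm φ 2 volume := by
  have hA := lowerFrameConst_pos hd hp hα hZ1 hZ0 hR
  set A := lowerFrameConst Z R p α
  set Φ := (eLpNorm φ 2 volume).toReal with hΦ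
  have hΦ' : eLpNorm φ 2 volume = ENNReal.ofReal Φ := (ENNReal.ofReal_toReal hφ.2.ne).symm
  set M := √(R ^ 2 / A) * Φ with hM
  have hM0 : 0 ≤ M := by positivity
  have hb := h.native_bounds (p := p) (α := α) hd hp hα hZ hZ1 hZ0
  have key : ∀ s : Finset ℕ, ‖(inner ℂ (∑ j ∈ s, a j • nativeExp p α (X j)) u : ℂ)‖ ≤
      M * ‖∑ j ∈ s, a j • nativeExp p α (X j)‖ := by
    intro s
    set x := ∑ j ∈ s, a j • nativeExp p α (X j)
    have hx := (absolutelyContinuous_stableMeasure hp).ae_le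
      (coeFn_sum_smul_ae_eq (fun j => coeFn_nativeExp (p := p) (α := α) (X j)) s a)
    have h1 : ‖(inner ℂ x u : ℂ)‖ₑ ≤
        eLpNorm (expSum X s a) 2 (volume.restrict Z) * eLpNorm φ 2 volume := by
      refine (enorm_inner_le_lintegral hp x u hu).trans ?_
      have h2 : ∫⁻ ξ, ‖x ξ‖ₑ * ‖φ ξ‖ₑ = ∫⁻ ξ in Z, ‖expSum X s a ξ‖ₑ * ‖φ ξ‖ₑ := by
        rw [← lintegral_indicator hZ]
        refine lintegral_congr_ae ?_
        filter_upwards [hx] with ξ hξ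
        rw [hξ]
        by_cases hξZ : ξ ∈ Z
        · rw [indicator_of_mem hξZ]
        · rw [indicator_of_notMem hξZ, hφZ ξ hξZ]
          simp
      rw [h2]
      refine (lintegral_enorm_mul_enorm_le (continuous_expSum X s a).aestronglyMeasurable
        hφ.1.restrict).trans ?_
      exact mul_le_mul_right (eLpNorm_restrict_le _ _ _ _) _
    have hQ : ∑ j ∈ s, ‖a j‖ ^ 2 ≤ ‖x‖ ^ 2 / A := by
      rw [le_div_iff₀ hA, mul_comm]
      exact (hb s a).1
    have h3 : eLpNorm (expSum X s a) 2 (volume.restrict Z) ^ 2 ≤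
        ENNReal.ofReal (R ^ 2 * (‖x‖ ^ 2 / A)) := by
      rw [eLpNorm_two_sq]
      exact (h s a).2.trans (ENNReal.ofReal_le_ofReal
        (mul_le_mul_of_nonneg_left hQ (by positivity)))
    have h4 : ‖(inner ℂ x u : ℂ)‖ ^ 2 ≤ R ^ 2 * (‖x‖ ^ 2 / A) * Φ ^ 2 := by
      rw [← ENNReal.ofReal_le_ofReal_iff (by positivity), ENNReal.ofReal_pow (norm_nonneg _),
        ofReal_norm, ENNReal.ofReal_mul (by positivity), ENNReal.ofReal_pow (by positivity)]
      refine (pow_le_pow_left₀ zero_le h1 2).trans ?_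
      rw [mul_pow, hΦ']
      exact mul_le_mul_left h3 _
    refine le_of_sq_le_sq (h4.trans (le_of_eq ?_)) (by positivity)
    rw [hM, mul_pow, mul_pow, Real.sq_sqrt (by positivity)]
    ring
  -- as `v` is the projection of `u`, this bounds `‖v‖² = ⟨v, u⟩`
  have h1 : ‖(inner ℂ v u : ℂ)‖ ≤ M * ‖v‖ :=
    le_of_tendsto_of_tendsto' ((Filter.Tendsto.inner hv tendsto_const_nhds).norm)
      (hv.norm.const_mul M) key
  have h2 : inner ℂ v u = inner ℂ v v := by
    have h3 := inner_eq_zero_of_hasSum hv hw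
    have h4 : inner ℂ v (v - u) = 0 := by rw [← inner_conj_symm, h3, map_zero]
    rw [inner_sub_right, sub_eq_zero] at h4
    exact h4.symm
  rw [h2, inner_self_eq_norm_sq_to_K] at h1
  simp only [norm_pow, RCLike.norm_ofReal, abs_norm] at h1
  have h5 : ‖v‖ ≤ M := by
    rcases eq_or_lt_of_le (norm_nonneg v) with h0 | h0
    · rw [← h0]; exact hM0
    · nlinarith
  rw [hΦ', ← ENNReal.ofReal_mul (by positivity), ← ofReal_norm]
  exact ENNReal.ofReal_le_ofReal h5

lemma enorm_invHat_le (φ : Rd d → ℂ) (x : Rd d) :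
    ‖invHat φ x‖ₑ ≤ ENNReal.ofReal (fourierConst d) * ∫⁻ ξ, ‖φ ξ‖ₑ := by
  rw [invHat, enorm_mul]
  have h1 : ‖(fourierConst d : ℂ)‖ₑ = ENNReal.ofReal (fourierConst d) := by
    rw [← ofReal_norm, Complex.norm_real, Real.norm_of_nonneg (fourierConst_pos d).le]
  rw [h1]
  refine mul_le_mul_right ((enorm_integral_le_lintegral_enorm _).trans (le_of_eq ?_)) _
  refine lintegral_congr fun ξ => ?_
  rw [enorm_mul, ← conj_expFun, RCLike.enorm_conj, ← ofReal_norm (expFun x ξ), norm_expFun]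
  simp

/-- Cauchy-Schwarz against the constant function. -/
lemma lintegral_enorm_le_sqrt_mul {T : Type*} [MeasurableSpace T] {μ : Measure T} {f : T → ℂ}
    (hf : AEStronglyMeasurable f μ) {m : ℝ} (hm : 0 ≤ m) (hμ : μ univ ≤ ENNReal.ofReal m) :
    ∫⁻ t, ‖f t‖ₑ ∂μ ≤ ENNReal.ofReal √m * eLpNorm f 2 μ := by
  have h1 := lintegral_enorm_mul_enorm_le (μ := μ) (f := fun _ => (1 : ℂ))
    aestronglyMeasurable_const hf
  simp only [enorm_one, one_mul] at h1
  refine h1.trans (mul_le_mul_left ?_ _)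
  rw [← ENNReal.pow_le_pow_left_iff two_ne_zero, eLpNorm_two_sq,
    ← ENNReal.ofReal_pow (Real.sqrt_nonneg _), Real.sq_sqrt hm]
  simpa using hμ

lemma lintegral_enorm_nativeHat_le (hd : 1 ≤ d) (hp : 0 < p) (hα : 0 < α)
    (w : NativeSpace d p α) :
    ∫⁻ ξ, ‖nativeHat w ξ‖ₑ ≤ ENNReal.ofReal √(stableMass d p α) * ‖w‖ₑ := by
  simp_rw [enorm_nativeHat]
  rw [← lintegral_stableMeasure hp, Lp.enorm_def]
  exact lintegral_enorm_le_sqrt_mul (Lp.aestronglyMeasurable w) (stableMass_pos hd hp hα).le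
    (stableMeasure_univ hd hp hα).le

end Interpolation

/-! ### Error estimates on the Fourier side -/

section ErrorEstimates

variable {d : ℕ} {p α : ℝ}

/-- The constant of the decay estimate `eLpNorm_nativeHat_sq_le_of_orthogonal`. -/
noncomputable def decayConst {d : ℕ} (Z : Set (Rd d)) (R p δ : ℝ) : ℝ :=
  Real.exp (δ ^ p) * upperFrameConst Z R p 1 * R ^ 2 + 1

lemma decayConst_pos (hd : 1 ≤ d) (hp : 0 < p) (Z : Set (Rd d)) (R δ : ℝ) :
    0 < decayConst Z R p δ := by
  have := upperFrameConst_nonneg (Z := Z) (R := R) hd hp one_pos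
  unfold decayConst
  positivity

lemma le_norm_of_notMem {Z : Set (Rd d)} {δ : ℝ} (hδZ : Metric.closedBall 0 δ ⊆ Z) {ξ : Rd d}
    (hξ : ξ ∉ Z) : δ ≤ ‖ξ‖ := by
  by_contra hcon
  exact hξ (hδZ (by simpa using (not_le.mp hcon).le))

/-- If `w` is orthogonal to all exponentials, the ratio of its `L²`-norm to its native norm decays
exponentially in `α`. -/
lemma eLpNorm_nativeHat_sq_le_of_orthogonal (hd : 1 ≤ d) (hp : 0 < p) (hα : 1 ≤ α) {δ : ℝ}
    (hδ : 0 ≤ δ) {Z : Set (Rd d)} (hZ : MeasurableSet Z) (hδZ : Metric.closedBall 0 δ ⊆ Z)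
    (hZ1 : Z ⊆ Metric.closedBall 0 1) (hZ0 : volume Z ≠ 0) {X : ℕ → Rd d} {R : ℝ} (hR : 0 < R)
    {e : ℕ → Lp ℂ 2 (volume.restrict Z)}
    (he : ∀ j, (e j : Rd d → ℂ) =ᵐ[volume.restrict Z] expFun (X j)) (hb : IsRieszBasis e)
    (hRb : ∀ (s : Finset ℕ) (c : ℕ → ℂ),
      (R ^ 2)⁻¹ * ∑ j ∈ s, ‖c j‖ ^ 2 ≤ ‖∑ j ∈ s, c j • e j‖ ^ 2 ∧
      ‖∑ j ∈ s, c j • e j‖ ^ 2 ≤ R ^ 2 * ∑ j ∈ s, ‖c j‖ ^ 2)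
    [IsFiniteMeasure (stableMeasure d p α)] {w : NativeSpace d p α}
    (hw : ∀ j, inner ℂ (nativeExp p α (X j)) w = 0) :
    eLpNorm (nativeHat w) 2 volume ^ 2 ≤
      ENNReal.ofReal (decayConst Z R p δ * Real.exp (-(α * δ ^ p))) * ‖w‖ₑ ^ 2 := by
  have hU := upperFrameConst_nonneg (Z := Z) (R := R) hd hp one_pos
  rw [eLpNorm_two_sq, ← lintegral_add_compl _ hZ]
  refine (add_le_add (setLIntegral_nativeHat_le_of_orthogonal hd hp hα hδ hZ hδZ hZ1 hZ0 hR he hb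
    hRb hw) (setLIntegral_enorm_nativeHat_sq_le hp w hZ.compl (ε := Real.exp (-(α * δ ^ p)))
      fun ξ hξ => ?_)).trans (le_of_eq ?_)
  · rw [stableSymbol, neg_mul]
    refine Real.exp_le_exp.mpr (neg_le_neg (mul_le_mul_of_nonneg_left ?_ (by linarith)))
    exact Real.rpow_le_rpow hδ (le_norm_of_notMem hδZ hξ) hp.le
  · rw [← add_mul, ← ENNReal.ofReal_add (by positivity) (by positivity), decayConst]
    congr 2
    rw [show -(α - 1) * δ ^ p = δ ^ p + -(α * δ ^ p) by ring, Real.exp_add]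
    ring

/-- The `L¹`-norm outside `Z` is exponentially small compared to the native norm, since the mass of
the weight outside `δB₂` is. -/
lemma setLIntegral_compl_enorm_nativeHat_le (hd : 1 ≤ d) (hp : 0 < p) (hα : 1 ≤ α) {δ : ℝ}
    (hδ : 0 ≤ δ) {Z : Set (Rd d)} (hZ : MeasurableSet Z) (hδZ : Metric.closedBall 0 δ ⊆ Z)
    (w : NativeSpace d p α) :
    ∫⁻ ξ in Zᶜ, ‖nativeHat w ξ‖ₑ ≤
      ENNReal.ofReal √(Real.exp (-(α - 1) * δ ^ p) * stableMass d p 1) * ‖w‖ₑ := by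
  simp_rw [enorm_nativeHat]
  rw [← setLIntegral_stableMeasure hp hZ.compl]
  have hN := (stableMass_pos hd hp one_pos).le
  refine (lintegral_enorm_le_sqrt_mul (Lp.aestronglyMeasurable w).restrict
    (m := Real.exp (-(α - 1) * δ ^ p) * stableMass d p 1) (by positivity) ?_).trans ?_
  · rw [Measure.restrict_apply_univ, stableMeasure, withDensity_apply _ hZ.compl,
      ENNReal.ofReal_mul (by positivity), ← lintegral_stableSymbol hd hp one_pos,
      ← lintegral_const_mul' _ _ ENNReal.ofReal_ne_top]
    refine (setLIntegral_mono' hZ.compl fun ξ hξ => ?_).trans (setLIntegral_le_lintegral _ _)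
    rw [← ENNReal.ofReal_mul (Real.exp_pos _).le]
    exact ENNReal.ofReal_le_ofReal
      (stableSymbol_le_of_le_norm hp hα hδ (le_norm_of_notMem hδZ hξ))
  · rw [Lp.enorm_def]
    exact mul_le_mul_right (eLpNorm_restrict_le _ _ _ _) _

/-- Two coupled inequalities bound `H` and `W` linearly in `F`. -/
lemma le_mul_of_sq_le {H W F D E : ℝ} (hH : 0 ≤ H) (hF : 0 ≤ F) (hD : 0 ≤ D) (hE : 0 ≤ E)
    (h1 : H ^ 2 ≤ D * W ^ 2) (h2 : W ^ 2 ≤ E * (H * F)) :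
    H ≤ D * E * F ∧ W ≤ √D * E * F := by
  have h3 : H ≤ D * E * F := by
    rcases eq_or_lt_of_le hH with h0 | h0
    · rw [← h0]; positivity
    · have : H * H ≤ D * E * F * H := by nlinarith [mul_le_mul_of_nonneg_left h2 hD]
      exact le_of_mul_le_mul_right this h0
  refine ⟨h3, le_of_sq_le_sq ?_ (by positivity)⟩
  rw [mul_pow, mul_pow, Real.sq_sqrt hD]
  have := mul_le_mul_of_nonneg_right h3 (mul_nonneg hE hF)
  nlinarith

/-- The constant of the `L¹`-estimate `error_le_of_one_le`. -/
noncomputable def supConst {d : ℕ} (Z : Set (Rd d)) (R p δ : ℝ) : ℝ :=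
  √(volume Z).toReal * decayConst Z R p δ +
    √(Real.exp (δ ^ p) * stableMass d p 1) * √(decayConst Z R p δ)

/-- The interpolation error on the Fourier side for `α ≥ 1`. -/
lemma error_le_of_one_le (hd : 1 ≤ d) (hp : 0 < p) (hα : 1 ≤ α) {δ β : ℝ}
    (hδ : 0 ≤ δ) {Z : Set (Rd d)} (hZ : MeasurableSet Z) (hδZ : Metric.closedBall 0 δ ⊆ Z)
    (hZ1 : Z ⊆ Metric.closedBall 0 1) (hZ0 : volume Z ≠ 0) {X : ℕ → Rd d} {R : ℝ} (hR : 0 < R)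
    {e : ℕ → Lp ℂ 2 (volume.restrict Z)}
    (he : ∀ j, (e j : Rd d → ℂ) =ᵐ[volume.restrict Z] expFun (X j)) (hb : IsRieszBasis e)
    (hRb : ∀ (s : Finset ℕ) (c : ℕ → ℂ),
      (R ^ 2)⁻¹ * ∑ j ∈ s, ‖c j‖ ^ 2 ≤ ‖∑ j ∈ s, c j • e j‖ ^ 2 ∧
      ‖∑ j ∈ s, c j • e j‖ ^ 2 ≤ R ^ 2 * ∑ j ∈ s, ‖c j‖ ^ 2)
    [IsFiniteMeasure (stableMeasure d p α)] {φ : Rd d → ℂ} (hφ : MemLp φ 2 volume)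
    (hs : ∀ ξ, ξ ∉ Metric.closedBall 0 β → φ ξ = 0) {u w : NativeSpace d p α}
    (hu : nativeHat u =ᵐ[volume] φ) (hwu : inner ℂ w (w + u) = 0)
    (hw : ∀ j, inner ℂ (nativeExp p α (X j)) w = 0) :
    eLpNorm (nativeHat w) 2 volume ≤
      ENNReal.ofReal (decayConst Z R p δ * Real.exp (α * (β ^ p - δ ^ p))) *
        eLpNorm φ 2 volume ∧
    ∫⁻ ξ, ‖nativeHat w ξ‖ₑ ≤
      ENNReal.ofReal (supConst Z R p δ * Real.exp (α * (β ^ p - δ ^ p))) *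
        eLpNorm φ 2 volume := by
  have hα0 : 0 < α := one_pos.trans_le hα
  have hK := decayConst_pos hd hp Z R δ
  have hN := stableMass_pos hd hp one_pos
  have hZf : volume Z ≠ ∞ := ((measure_mono hZ1).trans_lt measure_closedBall_lt_top).ne
  set K := decayConst Z R p δ with hKdef
  have hH' := memLp_nativeHat hp hα0 w
  set H := (eLpNorm (nativeHat w) 2 volume).toReal with hHdef
  have hHe : eLpNorm (nativeHat w) 2 volume = ENNReal.ofReal H :=
    (ENNReal.ofReal_toReal hH'.2.ne).symm
  set F := (eLpNorm φ 2 volume).toReal with hFdef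
  have hFe : eLpNorm φ 2 volume = ENNReal.ofReal F := (ENNReal.ofReal_toReal hφ.2.ne).symm
  have hH0 : 0 ≤ H := ENNReal.toReal_nonneg
  have hF0 : 0 ≤ F := ENNReal.toReal_nonneg
  set D := K * Real.exp (-(α * δ ^ p)) with hDdef
  set E := Real.exp (α * β ^ p) with hEdef
  have h1 : H ^ 2 ≤ D * ‖w‖ ^ 2 := by
    have := eLpNorm_nativeHat_sq_le_of_orthogonal hd hp hα hδ hZ hδZ hZ1 hZ0 hR he hb hRb hw
    rwa [hHe, ← ofReal_norm, ← ENNReal.ofReal_pow hH0, ← ENNReal.ofReal_pow (norm_nonneg _),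
      ← ENNReal.ofReal_mul (by positivity), ENNReal.ofReal_le_ofReal_iff (by positivity)] at this
  have h2 : ‖w‖ ^ 2 ≤ E * (H * F) := by
    have := native_enorm_sq_le hp hα0 hφ hs hu hwu
    rwa [hHe, hFe, ← ofReal_norm, ← ENNReal.ofReal_pow (norm_nonneg _),
      ← ENNReal.ofReal_mul hH0, ← ENNReal.ofReal_mul (by positivity),
      ENNReal.ofReal_le_ofReal_iff (by positivity)] at this
  obtain ⟨h3, h4⟩ := le_mul_of_sq_le hH0 hF0 (by positivity) (by positivity) h1 h2
  have hexp : Real.exp (α * (β ^ p - δ ^ p)) = Real.exp (-(α * δ ^ p)) * E := by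
    rw [hEdef, ← Real.exp_add]
    congr 1; ring
  constructor
  · rw [hHe, hFe, ← ENNReal.ofReal_mul (by positivity), hexp]
    refine ENNReal.ofReal_le_ofReal (h3.trans (le_of_eq ?_))
    rw [hDdef]; ring
  · rw [← lintegral_add_compl _ hZ]
    have h5 : ∫⁻ ξ in Z, ‖nativeHat w ξ‖ₑ ≤ ENNReal.ofReal (√(volume Z).toReal * H) := by
      rw [ENNReal.ofReal_mul (Real.sqrt_nonneg _), ← hHe]
      refine (lintegral_enorm_le_sqrt_mul hH'.1.restrict ENNReal.toReal_nonneg ?_).trans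
        (mul_le_mul_right (eLpNorm_restrict_le _ _ _ _) _)
      rw [Measure.restrict_apply_univ, ENNReal.ofReal_toReal hZf]
    have h6 := setLIntegral_compl_enorm_nativeHat_le hd hp hα hδ hZ hδZ w
    rw [← ofReal_norm, ← ENNReal.ofReal_mul (Real.sqrt_nonneg _)] at h6
    refine (add_le_add h5 h6).trans ?_
    rw [← ENNReal.ofReal_add (by positivity) (by positivity), hFe,
      ← ENNReal.ofReal_mul (by unfold supConst; positivity)]
    refine ENNReal.ofReal_le_ofReal ?_
    refine (add_le_add (mul_le_mul_of_nonneg_left h3 (Real.sqrt_nonneg _))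
      (mul_le_mul_of_nonneg_left h4 (Real.sqrt_nonneg _))).trans (le_of_eq ?_)
    have e1 : Real.exp (-(α - 1) * δ ^ p) * stableMass d p 1 =
        Real.exp (δ ^ p) * stableMass d p 1 * Real.exp (-(α * δ ^ p)) := by
      rw [show -(α - 1) * δ ^ p = δ ^ p + -(α * δ ^ p) by ring, Real.exp_add]
      ring
    have e2 := Real.mul_self_sqrt (Real.exp_pos (-(α * δ ^ p))).le
    rw [supConst, hexp, e1, Real.sqrt_mul (by positivity), hDdef, Real.sqrt_mul hK.le, ← hKdef]
    linear_combination √(Real.exp (δ ^ p) * stableMass d p 1) * √K * E * F * e2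

lemma stableMass_anti (hd : 1 ≤ d) (hp : 0 < p) (hα : 0 < α) (hα1 : α ≤ 1) :
    stableMass d p 1 ≤ stableMass d p α := by
  refine integral_mono (integrable_stableSymbol hd hp one_pos)
    (integrable_stableSymbol hd hp hα) fun ξ => Real.exp_le_exp.mpr ?_
  have := Real.rpow_nonneg (norm_nonneg ξ) p
  nlinarith

lemma lowerFrameConst_anti (hd : 1 ≤ d) (hp : 0 < p) (hα : 0 < α) (hα1 : α ≤ 1)
    (Z : Set (Rd d)) (R : ℝ) : lowerFrameConst Z R p 1 ≤ lowerFrameConst Z R p α := by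
  have h1 := stableMass_anti hd hp hα hα1
  have h2 := stableMass_pos hd hp one_pos
  have h3 : Real.exp (-(2 ^ p * 1)) ≤ Real.exp (-(2 ^ p * α)) := by
    refine Real.exp_le_exp.mpr (neg_le_neg (mul_le_mul_of_nonneg_left hα1 ?_))
    positivity
  unfold lowerFrameConst
  gcongr

/-- The interpolation error on the Fourier side for `α ≤ 1`. The bound of the supremum stays finite
as `α → 0` since the mass of the weight cancels against the lower frame constant. -/
lemma error_le_of_le_one (hd : 1 ≤ d) (hp : 0 < p) (hα : 0 < α) (hα1 : α ≤ 1)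
    [IsFiniteMeasure (stableMeasure d p α)] {Z : Set (Rd d)} (hZ : MeasurableSet Z)
    (hZ1 : Z ⊆ Metric.closedBall 0 1) (hZ0 : volume Z ≠ 0) {X : ℕ → Rd d} {R : ℝ} (hR : 0 < R)
    (h : HasRieszBounds Z X R) {φ : Rd d → ℂ} (hφ : MemLp φ 2 volume)
    (hφZ : ∀ ξ, ξ ∉ Z → φ ξ = 0) {u v : NativeSpace d p α} {a : ℕ → ℂ}
    (hu : nativeHat u =ᵐ[volume] φ) (hv : HasSum (fun j => a j • nativeExp p α (X j)) v)
    (hw : ∀ k, inner ℂ (nativeExp p α (X k)) (v - u) = 0) :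
    eLpNorm (nativeHat (v - u)) 2 volume ≤
      ENNReal.ofReal (√(R ^ 2 / lowerFrameConst Z R p 1) + 1) * eLpNorm φ 2 volume ∧
    ∫⁻ ξ, ‖nativeHat (v - u) ξ‖ₑ ≤
      ENNReal.ofReal (√(R ^ 4 * Real.exp (2 ^ p) * 2 ^ d * (volume Z).toReal) +
        √(volume Z).toReal) * eLpNorm φ 2 volume := by
  have hZf : volume Z ≠ ∞ := ((measure_mono hZ1).trans_lt measure_closedBall_lt_top).ne
  have hV := ENNReal.toReal_pos hZ0 hZf
  have hN := stableMass_pos hd hp hα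
  have hA := lowerFrameConst_pos hd hp hα hZ1 hZ0 hR
  have hA1 := lowerFrameConst_pos hd hp one_pos hZ1 hZ0 hR
  have hvb := enorm_interpolant_le hd hp hα hZ hZ1 hZ0 hR h hφ hφZ hu hv hw
  have hsub : nativeHat (v - u) =ᵐ[volume] nativeHat v - φ := by
    filter_upwards [nativeHat_sub hp v u, hu] with ξ h1 h2
    rw [h1, h2, Pi.sub_apply]
  have hvm := memLp_nativeHat hp hα v
  constructor
  · rw [eLpNorm_congr_ae hsub]
    refine (eLpNorm_sub_le hvm.1 hφ.1 (by norm_num)).trans ?_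
    rw [ENNReal.ofReal_add (by positivity) zero_le_one, ENNReal.ofReal_one, add_mul, one_mul]
    refine add_le_add ((eLpNorm_nativeHat_le hp hα v).trans (hvb.trans ?_)) le_rfl
    refine mul_le_mul_left (ENNReal.ofReal_le_ofReal (Real.sqrt_le_sqrt ?_)) _
    exact div_le_div_of_nonneg_left (by positivity) hA1 (lowerFrameConst_anti hd hp hα hα1 Z R)
  · have h1 : ∫⁻ ξ, ‖nativeHat (v - u) ξ‖ₑ ≤ ∫⁻ ξ, (‖nativeHat v ξ‖ₑ + ‖φ ξ‖ₑ) := by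
      refine lintegral_mono_ae ?_
      filter_upwards [hsub] with ξ hξ
      rw [hξ, Pi.sub_apply]
      exact enorm_sub_le
    rw [lintegral_add_left' hvm.1.enorm] at h1
    refine h1.trans ?_
    rw [ENNReal.ofReal_add (by positivity) (by positivity), add_mul]
    refine add_le_add ?_ ?_
    · refine (lintegral_enorm_nativeHat_le hd hp hα v).trans
        ((mul_le_mul_right hvb _).trans ?_)
      rw [← mul_assoc, ← ENNReal.ofReal_mul (Real.sqrt_nonneg _), ← Real.sqrt_mul hN.le]
      refine mul_le_mul_left (ENNReal.ofReal_le_ofReal (Real.sqrt_le_sqrt ?_)) _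
      have e : stableMass d p α * (R ^ 2 / lowerFrameConst Z R p α) =
          R ^ 4 * Real.exp (2 ^ p * α) * 2 ^ d * (volume Z).toReal := by
        rw [lowerFrameConst, Real.exp_neg]
        field_simp
      rw [e]
      have : (2 : ℝ) ^ p * α ≤ 2 ^ p := mul_le_of_le_one_right (by positivity) hα1
      gcongr
    · have h2 : ∫⁻ ξ, ‖φ ξ‖ₑ = ∫⁻ ξ in Z, ‖φ ξ‖ₑ := by
        rw [← lintegral_indicator hZ]
        refine lintegral_congr fun ξ => ?_
        by_cases hξZ : ξ ∈ Z
        · rw [indicator_of_mem hξZ]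
        · rw [indicator_of_notMem hξZ, hφZ ξ hξZ, enorm_zero]
      rw [h2]
      refine (lintegral_enorm_le_sqrt_mul hφ.1.restrict ENNReal.toReal_nonneg ?_).trans
        (mul_le_mul_right (eLpNorm_restrict_le _ _ _ _) _)
      rw [Measure.restrict_apply_univ, ENNReal.ofReal_toReal hZf]

end ErrorEstimates

/-! ### The interpolant and its error -/

section Interpolant

variable {d : ℕ} {p : ℝ}

lemma invHat_congr_ae {φ ψ : Rd d → ℂ} (h : φ =ᵐ[volume] ψ) : invHat φ = invHat ψ := by
  funext x
  rw [invHat, invHat]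
  congr 1
  refine integral_congr_ae ?_
  filter_upwards [h] with ξ hξ
  rw [hξ]

lemma integrable_mul_exp_inner {φ : Rd d → ℂ} (hφ : Integrable φ) (x : Rd d) :
    Integrable fun ξ => φ ξ * Complex.exp (Complex.I * ((inner ℝ x ξ : ℝ) : ℂ)) := by
  refine hφ.mul_bdd (c := 1) (Continuous.aestronglyMeasurable (by fun_prop))
    (ae_of_all _ fun ξ => ?_)
  rw [mul_comm, Complex.norm_exp_ofReal_mul_I]

lemma invHat_sub {φ ψ : Rd d → ℂ} (hφ : Integrable φ) (hψ : Integrable ψ) (x : Rd d) :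
    invHat (fun ξ => φ ξ - ψ ξ) x = invHat φ x - invHat ψ x := by
  rw [invHat, invHat, invHat, ← mul_sub, ← integral_sub]
  · simp_rw [sub_mul]
  · exact integrable_mul_exp_inner hφ x
  · exact integrable_mul_exp_inner hψ x

/-- The interpolation problem is uniquely solvable, and the interpolant is the function represented
by the solution in the native space. -/
lemma interpolation_wellPosed (hd : 1 ≤ d) (hp : 0 < p) {α : ℝ} (hα : 0 < α)
    {Z : Set (Rd d)} (hZ : MeasurableSet Z) (hZ1 : Z ⊆ Metric.closedBall 0 1)
    (hZ0 : volume Z ≠ 0) {X : ℕ → Rd d} {R : ℝ} (hR : 0 < R)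
    (h : HasRieszBounds Z X R) {f : Rd d → ℂ} (hf : f ∈ PaleyWiener Z) :
    (∃! a : ℕ → ℂ, IsInterpolationCoeff (stableKernel d p α) X f a) ∧
    (∀ x, Summable fun j =>
      interpolationCoeff (stableKernel d p α) X f j * stableKernel d p α (x - X j)) ∧
    MemLp (interpolant (stableKernel d p α) X f) 2 volume := by
  have := isFiniteMeasure_stableMeasure hd hp hα
  obtain ⟨φ, hφ, -, hφZ, rfl⟩ := PaleyWiener.exists_invHat hZ hZ1 hf
  obtain ⟨u, v, a, -, -, -, hex, hsum⟩ := exists_interpolation hd hp hα hZ hZ1 hZ0 hR h hφ hφZ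
  refine ⟨hex, fun x => (hsum x).summable, ?_⟩
  have e : interpolant (stableKernel d p α) X (invHat φ) = invHat (nativeHat v) :=
    funext fun x => (hsum x).tsum_eq
  rw [e]
  exact memLp_invHat (integrable_nativeHat hd hp hα v) (memLp_nativeHat hp hα v)

/-- The error estimate, in `L₂` and pointwise. -/
lemma exists_error_bound (hd : 1 ≤ d) (hp : 0 < p) {δ β : ℝ} (hδ : 0 ≤ δ) (hδ1 : δ ≤ 1)
    (hβ : 0 ≤ β) (hβδ : β ≤ δ) {Z : Set (Rd d)} (hZ : MeasurableSet Z)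
    (hδZ : Metric.closedBall 0 δ ⊆ Z) (hZ1 : Z ⊆ Metric.closedBall 0 1) (hZ0 : volume Z ≠ 0)
    {X : ℕ → Rd d} {R : ℝ} (hR : 0 < R) {e : ℕ → Lp ℂ 2 (volume.restrict Z)}
    (he : ∀ j, (e j : Rd d → ℂ) =ᵐ[volume.restrict Z] expFun (X j)) (hb : IsRieszBasis e)
    (hRb : ∀ (s : Finset ℕ) (c : ℕ → ℂ),
      (R ^ 2)⁻¹ * ∑ j ∈ s, ‖c j‖ ^ 2 ≤ ‖∑ j ∈ s, c j • e j‖ ^ 2 ∧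
      ‖∑ j ∈ s, c j • e j‖ ^ 2 ≤ R ^ 2 * ∑ j ∈ s, ‖c j‖ ^ 2) :
    ∃ C : ℝ, 0 < C ∧ ∀ α : ℝ, 0 < α → ∀ f ∈ PaleyWiener (Metric.closedBall (0 : Rd d) β),
      eLpNorm (fun x => interpolant (stableKernel d p α) X f x - f x) 2 volume ≤
        ENNReal.ofReal (C * Real.exp (α * (β ^ p + 2 - 3 * δ ^ p))) * eLpNorm f 2 volume ∧
      ∀ x, ‖interpolant (stableKernel d p α) X f x - f x‖ₑ ≤
        ENNReal.ofReal (C * Real.exp (α * (β ^ p + 2 - 3 * δ ^ p))) * eLpNorm f 2 volume := by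
  have hRB := hasRieszBounds_of_finset_bounds he hRb
  have hκ := fourierConst_pos d
  have hK := decayConst_pos hd hp Z R δ
  have hδp : δ ^ p ≤ 1 := Real.rpow_le_one hδ hδ1 hp.le
  have hβp : 0 ≤ β ^ p := Real.rpow_nonneg hβ p
  have hL : 0 ≤ supConst Z R p δ := by unfold supConst; positivity
  set c₁ := decayConst Z R p δ
  set c₂ := supConst Z R p δ
  set c₃ := √(R ^ 2 / lowerFrameConst Z R p 1) + 1 with hc₃
  set c₄ := √(R ^ 4 * Real.exp (2 ^ p) * 2 ^ d * (volume Z).toReal) + √(volume Z).toReal with hc₄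
  have h3 : 0 < c₃ := by positivity
  have h4 : 0 ≤ c₄ := by positivity
  set κ := fourierConst d
  set C := c₁ + κ * c₂ + Real.exp 1 * (c₃ + κ * c₄) with hC
  refine ⟨C, by positivity, fun α hα f hf => ?_⟩
  have := isFiniteMeasure_stableMeasure hd hp hα
  set t := Real.exp (α * (β ^ p + 2 - 3 * δ ^ p)) with ht
  obtain ⟨φ, hφ, hφi, hφβ, rfl⟩ := PaleyWiener.exists_invHat measurableSet_closedBall le_rfl hf
  have hφZ : ∀ ξ, ξ ∉ Z → φ ξ = 0 := fun ξ hξ =>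
    hφβ ξ fun h' => hξ (hδZ (Metric.closedBall_subset_closedBall hβδ h'))
  obtain ⟨u, v, a, hu, hv, hw, -, hsum⟩ := exists_interpolation hd hp hα hZ hZ1 hZ0 hR hRB hφ hφZ
  have hdiff : (fun x => interpolant (stableKernel d p α) X (invHat φ) x - invHat φ x) =
      invHat (nativeHat (v - u)) := by
    funext x
    rw [interpolant, (hsum x).tsum_eq, invHat_congr_ae (nativeHat_sub hp v u),
      invHat_sub (integrable_nativeHat hd hp hα v) (integrable_nativeHat hd hp hα u),
      invHat_congr_ae hu]
  -- both regimes bound the `L²`- and the `L¹`-norm of the error on the Fourier side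
  have key : eLpNorm (nativeHat (v - u)) 2 volume ≤
        ENNReal.ofReal (C * t) * eLpNorm φ 2 volume ∧
      ENNReal.ofReal κ * ∫⁻ ξ, ‖nativeHat (v - u) ξ‖ₑ ≤
        ENNReal.ofReal (C * t) * eLpNorm φ 2 volume := by
    have aux : ∀ {I : ℝ≥0∞} {c b : ℝ}, c ≤ b → I ≤ ENNReal.ofReal c * eLpNorm φ 2 volume →
        I ≤ ENNReal.ofReal b * eLpNorm φ 2 volume := fun hcb hI =>
      hI.trans (mul_le_mul_left (ENNReal.ofReal_le_ofReal hcb) _)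
    have aux' : ∀ {I : ℝ≥0∞} {c b : ℝ}, κ * c ≤ b → I ≤ ENNReal.ofReal c * eLpNorm φ 2 volume →
        ENNReal.ofReal κ * I ≤ ENNReal.ofReal b * eLpNorm φ 2 volume := fun {I c b} hcb hI => by
      refine (mul_le_mul_right hI _).trans ?_
      rw [← mul_assoc, ← ENNReal.ofReal_mul hκ.le]
      exact mul_le_mul_left (ENNReal.ofReal_le_ofReal hcb) _
    have ht0 : 0 < t := Real.exp_pos _
    have e0 : 0 < Real.exp 1 := Real.exp_pos 1
    rcases le_total 1 α with h1 | h1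
    · have hs : Real.exp (α * (β ^ p - δ ^ p)) ≤ t := by
        refine Real.exp_le_exp.mpr (mul_le_mul_of_nonneg_left ?_ hα.le)
        linarith
      have hwu : inner ℂ (v - u) (v - u + u) = 0 := by
        rw [sub_add_cancel]
        exact inner_eq_zero_of_hasSum hv hw
      obtain ⟨b1, b2⟩ := error_le_of_one_le hd hp h1 hδ hZ hδZ hZ1 hZ0 hR he hb hRb hφ hφβ hu
        hwu hw
      refine ⟨aux ?_ b1, aux' ?_ b2⟩
      · refine mul_le_mul ?_ hs (Real.exp_pos _).le (by positivity)
        have : 0 ≤ κ * c₂ + Real.exp 1 * (c₃ + κ * c₄) := by positivity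
        linarith
      · rw [← mul_assoc]
        refine mul_le_mul ?_ hs (Real.exp_pos _).le (by positivity)
        have : 0 ≤ c₁ + Real.exp 1 * (c₃ + κ * c₄) := by positivity
        linarith
    · have hs : 1 ≤ Real.exp 1 * t := by
        rw [ht, ← Real.exp_add]
        refine Real.one_le_exp ?_
        nlinarith
      obtain ⟨b1, b2⟩ := error_le_of_le_one hd hp hα h1 hZ hZ1 hZ0 hR hRB hφ hφZ hu hv hw
      have hCt : (c₃ + κ * c₄) * (Real.exp 1 * t) ≤ C * t := by
        have : 0 ≤ (c₁ + κ * c₂) * t := by positivity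
        rw [hC]
        linarith
      have h5 : c₃ + κ * c₄ ≤ C * t :=
        (le_mul_of_one_le_right (by positivity) hs).trans hCt
      have h6 : 0 ≤ κ * c₄ := by positivity
      exact ⟨aux (by linarith) b1, aux' (by linarith) b2⟩
  rw [hdiff, eLpNorm_invHat (integrable_nativeHat hd hp hα _) (memLp_nativeHat hp hα _),
    eLpNorm_invHat hφi hφ]
  refine ⟨key.1, fun x => ?_⟩
  rw [congrFun hdiff x]
  exact (enorm_invHat_le _ x).trans key.2

end Interpolant

/-! ### Regularity of the family of kernels -/

section Regular

variable {d : ℕ} {p α : ℝ}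

lemma summable_pow_mul_exp_neg_mul_pow {B c q : ℝ} (hB : 0 < B) (hc : 0 < c) (hq : 1 < q) :
    Summable fun k : ℕ => B ^ (k + 1) * Real.exp (-(c * q ^ k)) := by
  refine summable_of_ratio_test_tendsto_lt_one (l := 0) one_pos
    (Eventually.of_forall fun k => by positivity) ?_
  have e : (fun k : ℕ => ‖B ^ (k + 1 + 1) * Real.exp (-(c * q ^ (k + 1)))‖ /
      ‖B ^ (k + 1) * Real.exp (-(c * q ^ k))‖) =
      fun k : ℕ => B * Real.exp (-(c * (q - 1) * q ^ k)) := funext fun k => by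
    rw [Real.norm_of_nonneg (by positivity), Real.norm_of_nonneg (by positivity),
      div_eq_iff (by positivity), show -(c * q ^ (k + 1)) = -(c * (q - 1) * q ^ k) + -(c * q ^ k) by
        ring, Real.exp_add]
    ring
  rw [e, ← mul_zero B]
  refine Tendsto.const_mul B (Real.tendsto_exp_neg_atTop_nhds_zero.comp ?_)
  exact (tendsto_pow_atTop_atTop_of_one_lt hq).const_mul_atTop (mul_pos hc (by linarith))

lemma enorm_fourierHat_stableKernel (hd : 1 ≤ d) (hp : 0 < p) (hα : 0 < α) (ξ : Rd d) :
    ‖fourierHat (stableKernel d p α) ξ‖ₑ = ENNReal.ofReal (Real.exp (-(α * ‖ξ‖ ^ p))) := by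
  rw [fourierHat_stableKernel hd hp hα, enorm_stableSymbol, stableSymbol, neg_mul]

lemma exp_neg_mul_rpow_le (hp : 0 < p) (hα : 0 < α) {r s : ℝ} (hr : 0 ≤ r) (hrs : r ≤ s) :
    Real.exp (-(α * s ^ p)) ≤ Real.exp (-(α * r ^ p)) :=
  Real.exp_le_exp.mpr (neg_le_neg (mul_le_mul_of_nonneg_left
    (Real.rpow_le_rpow hr hrs hp.le) hα.le))

lemma im_stableKernel (x : Rd d) : (stableKernel d p α x).im = 0 := by
  rw [← Complex.conj_eq_iff_im, stableKernel, map_mul, Complex.conj_ofReal, ← integral_conj,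
    ← integral_neg_eq_self]
  congr 1
  refine integral_congr_ae (ae_of_all _ fun ξ => ?_)
  simp only [map_mul, Complex.conj_ofReal, norm_neg, inner_neg_right, ← Complex.exp_conj,
    Complex.conj_I]
  congr 2
  push_cast
  ring

/-- A majorant of the dyadic sum of the kernel. -/
noncomputable def dyadicMajorant (d : ℕ) (p δ α : ℝ) : ℝ≥0∞ :=
  ∑' k : ℕ, ENNReal.ofReal (((2 : ℝ) ^ ((d : ℝ) / 2)) ^ (k + 1) *
    Real.exp (-(α * δ ^ p * ((2 : ℝ) ^ p) ^ k)))

lemma dyadicMajorant_ne_top (hp : 0 < p) {δ : ℝ} (hδ : 0 < δ) (hα : 0 < α) :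
    dyadicMajorant d p δ α ≠ ∞ :=
  (summable_pow_mul_exp_neg_mul_pow (by positivity) (by positivity)
    (Real.one_lt_rpow one_lt_two hp)).tsum_ofReal_ne_top

lemma dyadicSup_stableKernel_le (hd : 1 ≤ d) (hp : 0 < p) (hα : 0 < α) {δ : ℝ} (hδ : 0 < δ)
    {Z : Set (Rd d)} (hδZ : Metric.closedBall 0 δ ⊆ Z) (k : ℕ) :
    dyadicSup Z (stableKernel d p α) (k + 1) ≤
      ENNReal.ofReal (Real.exp (-(α * δ ^ p * ((2 : ℝ) ^ p) ^ k))) := by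
  refine iSup₂_le fun u hu => ?_
  rw [enorm_fourierHat_stableKernel hd hp hα]
  have hu2 : δ < 2 * ‖u‖ := by
    by_contra hcon
    refine hu.2 ⟨(2 : ℝ) • u, hδZ ?_, ?_⟩
    · rw [mem_closedBall_zero_iff, norm_smul]
      simpa using hcon
    · simp only [smul_smul]
      norm_num
  have h1 : (2 : ℝ) ^ k * δ ≤ ‖(2 : ℝ) ^ (k + 1) • u‖ := by
    rw [norm_smul, norm_pow, Real.norm_two, pow_succ, mul_assoc]
    exact mul_le_mul_of_nonneg_left hu2.le (by positivity)
  refine ENNReal.ofReal_le_ofReal ((exp_neg_mul_rpow_le hp hα (by positivity) h1).trans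
    (le_of_eq ?_))
  rw [Real.mul_rpow (by positivity) hδ.le, ← Real.rpow_natCast, ← Real.rpow_mul two_pos.le,
    mul_comm (k : ℝ) p, Real.rpow_mul two_pos.le, Real.rpow_natCast]
  ring_nf

lemma dyadicSum_stableKernel_le (hd : 1 ≤ d) (hp : 0 < p) (hα : 0 < α) {δ : ℝ} (hδ : 0 < δ)
    {Z : Set (Rd d)} (hδZ : Metric.closedBall 0 δ ⊆ Z) :
    dyadicSum Z (stableKernel d p α) ≤ dyadicMajorant d p δ α := by
  refine ENNReal.tsum_le_tsum fun k => ?_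
  have e : (2 : ℝ≥0∞) ^ (((k + 1 : ℕ) : ℝ) * (d : ℝ) / 2) =
      ENNReal.ofReal (((2 : ℝ) ^ ((d : ℝ) / 2)) ^ (k + 1)) := by
    rw [← Real.rpow_natCast, ← Real.rpow_mul two_pos.le,
      ← ENNReal.ofReal_rpow_of_pos two_pos]
    norm_num
    ring_nf
  rw [e, ENNReal.ofReal_mul (by positivity)]
  exact mul_le_mul_right (dyadicSup_stableKernel_le hd hp hα hδ hδZ k) _

lemma dyadicMajorant_le (hα : 1 ≤ α) {δ : ℝ} (hδ : 0 < δ) (hp : 0 < p) :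
    dyadicMajorant d p δ α ≤ ENNReal.ofReal (Real.exp (δ ^ p)) * dyadicMajorant d p δ 1 *
      ENNReal.ofReal (Real.exp (-(α * δ ^ p))) := by
  rw [mul_right_comm, ← ENNReal.ofReal_mul (by positivity), dyadicMajorant, dyadicMajorant,
    ← ENNReal.tsum_mul_left]
  refine ENNReal.tsum_le_tsum fun k => ?_
  rw [← ENNReal.ofReal_mul (by positivity)]
  refine ENNReal.ofReal_le_ofReal ?_
  rw [mul_left_comm, ← Real.exp_add, ← Real.exp_add]
  refine mul_le_mul_of_nonneg_left (Real.exp_le_exp.mpr ?_) (by positivity)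
  have h1 : 1 ≤ ((2 : ℝ) ^ p) ^ k := one_le_pow₀ (Real.one_le_rpow one_le_two hp.le)
  have h2 : 0 < δ ^ p := by positivity
  nlinarith [mul_nonneg (mul_nonneg (sub_nonneg.mpr hα) (sub_nonneg.mpr h1)) h2.le]

lemma annulusSup_stableKernel_le (hd : 1 ≤ d) (hp : 0 < p) (hα : 0 < α) {δ : ℝ} (hδ : 0 ≤ δ) :
    annulusSup δ (stableKernel d p α) ≤ ENNReal.ofReal (Real.exp (-(α * δ ^ p))) := by
  refine iSup₂_le fun u hu => ?_
  rw [enorm_fourierHat_stableKernel hd hp hα]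
  have : δ < ‖u‖ := by simpa using hu.2
  exact ENNReal.ofReal_le_ofReal (exp_neg_mul_rpow_le hp hα hδ this.le)

/-- The supremum over the half-open annulus is the limit of the values at its inner boundary. -/
lemma le_annulusSup_stableKernel (hd : 1 ≤ d) (hp : 0 < p) (hα : 0 < α) {δ : ℝ} (hδ : 0 ≤ δ)
    (hδ1 : δ < 1) :
    ENNReal.ofReal (Real.exp (-(α * δ ^ p))) ≤ annulusSup δ (stableKernel d p α) := by
  have : Nontrivial (Rd d) := Module.nontrivial_of_finrank_pos (R := ℝ) (by rw [finrank_Rd]; omega)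
  have hc : Continuous fun t : ℝ => ENNReal.ofReal (Real.exp (-(α * t ^ p))) :=
    ENNReal.continuous_ofReal.comp (Real.continuous_exp.comp
      (continuous_const.mul (Real.continuous_rpow_const hp.le)).neg)
  refine le_of_tendsto (hc.continuousAt.tendsto.mono_left (nhdsWithin_le_nhds (s := Ioi δ))) ?_
  filter_upwards [Ioc_mem_nhdsGT hδ1] with t ht
  obtain ⟨u, hu⟩ := exists_norm_eq (Rd d) (hδ.trans ht.1.le)
  rw [← hu, ← enorm_fourierHat_stableKernel hd hp hα]
  refine le_iSup₂ (f := fun u _ => ‖fourierHat (stableKernel d p α) u‖ₑ) u ⟨?_, ?_⟩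
  · simpa [hu] using ht.2
  · simpa [hu] using ht.1

lemma le_ballInf_stableKernel (hd : 1 ≤ d) (hp : 0 < p) (hα : 0 < α) (r : ℝ) :
    ENNReal.ofReal (Real.exp (-(α * r ^ p))) ≤ ballInf r (stableKernel d p α) := by
  refine le_iInf₂ fun u hu => ?_
  rw [enorm_fourierHat_stableKernel hd hp hα]
  exact ENNReal.ofReal_le_ofReal (exp_neg_mul_rpow_le hp hα (norm_nonneg _) (by simpa using hu))

lemma isInterpolator_stableKernel (hd : 1 ≤ d) (hp : 0 < p) (hα : 0 < α) {δ : ℝ} (hδ : 0 < δ)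
    {Z : Set (Rd d)} (hδZ : Metric.closedBall 0 δ ⊆ Z) (hZ1 : Z ⊆ Metric.closedBall 0 1) :
    IsInterpolator Z (stableKernel d p α) where
  real_valued := im_stableKernel
  integrable := integrable_stableKernel hd hp hα
  continuous := continuous_invHat (integrable_stableSymbol hd hp hα).ofReal
  integrable_hat := by
    rw [fourierHat_stableKernel hd hp hα]
    exact (integrable_stableSymbol hd hp hα).ofReal
  hat_nonneg ξ := by
    rw [fourierHat_stableKernel hd hp hα]
    exact ⟨(stableSymbol_pos p α ξ).le, Complex.ofReal_im _⟩
  hat_lower := by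
    refine ⟨Real.exp (-(α * 1 ^ p)), Real.exp_pos _, fun ξ hξ => ?_⟩
    rw [fourierHat_stableKernel hd hp hα, Complex.ofReal_re, stableSymbol, neg_mul]
    exact exp_neg_mul_rpow_le hp hα (norm_nonneg _) (by simpa using hZ1 hξ)
  dyadic_summable := ne_top_of_le_ne_top (dyadicMajorant_ne_top hp hδ hα)
    (dyadicSum_stableKernel_le hd hp hα hδ hδZ)

lemma isRegularFamily_stableKernel (hd : 1 ≤ d) (hp : 0 < p) {δ β : ℝ} (hδ : 0 < δ) (hδ1 : δ < 1)
    (hβ : 0 < β) (hβδ : β ^ p + 2 - 3 * δ ^ p < 0) {Z : Set (Rd d)}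
    (hδZ : Metric.closedBall 0 δ ⊆ Z) (hZ1 : Z ⊆ Metric.closedBall 0 1) :
    IsRegularFamily Z δ β (Ioi 0) (stableKernel d p) where
  beta_pos := hβ
  index_pos := le_rfl
  index_unbounded := not_bddAbove_Ioi 0
  interpolator α hα := isInterpolator_stableKernel hd hp hα hδ hδZ hZ1
  sum_le := by
    refine ⟨(ENNReal.ofReal (Real.exp (δ ^ p)) * dyadicMajorant d p δ 1).toNNReal, ?_⟩
    filter_upwards [eventually_ge_atTop 1] with α hα1 hα
    rw [ENNReal.coe_toNNReal
      (ENNReal.mul_ne_top ENNReal.ofReal_ne_top (dyadicMajorant_ne_top hp hδ one_pos))]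
    exact (dyadicSum_stableKernel_le hd hp hα hδ hδZ).trans ((dyadicMajorant_le hα1 hδ hp).trans
      (mul_le_mul_right (le_annulusSup_stableKernel hd hp hα hδ.le hδ1) _))
  ratio_tendsto := by
    have hlim : Tendsto (fun α : ℝ => ENNReal.ofReal
        (Real.exp (α * (β ^ p + 2 - 3 * δ ^ p)))) (atTop ⊓ 𝓟 (Ioi 0)) (𝓝 0) := by
      rw [← ENNReal.ofReal_zero]
      exact (ENNReal.tendsto_ofReal (Real.tendsto_exp_atBot.comp
        (tendsto_id.atTop_mul_const_of_neg hβδ))).mono_left inf_le_left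
    refine tendsto_of_tendsto_of_tendsto_of_le_of_le' tendsto_const_nhds hlim
      (Eventually.of_forall fun _ => zero_le) ?_
    filter_upwards [mem_inf_of_right (mem_principal_self (Ioi (0 : ℝ)))] with α hα
    refine (ENNReal.div_le_div
      (pow_le_pow_left₀ zero_le (annulusSup_stableKernel_le hd hp hα hδ.le) 3)
      (mul_le_mul' (le_ballInf_stableKernel hd hp hα β)
        (pow_le_pow_left₀ zero_le (le_ballInf_stableKernel hd hp hα 1) 2))).trans (le_of_eq ?_)
    rw [← ENNReal.ofReal_pow (by positivity), ← ENNReal.ofReal_pow (by positivity),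
      ← ENNReal.ofReal_mul (by positivity), ← ENNReal.ofReal_div_of_pos (by positivity),
      ← Real.exp_nat_mul, ← Real.exp_nat_mul, ← Real.exp_add, ← Real.exp_sub, Real.one_rpow]
    congr 2
    push_cast
    ring

end Regular

/-! ### Convergence of the interpolants -/

theorem mainTheorem3 (d : ℕ) (hd : 1 ≤ d) (p δ β : ℝ) (hp : 0 < p)
    (hδ : δ ∈ Ioo ((2 / 3 : ℝ) ^ (1 / p)) 1)
    (hβ : 0 < β) (hβδ : β < (3 * δ ^ p - 2) ^ (1 / p))
    (Z : Set (Rd d)) (hZ : IsSymmetricConvexBody Z)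
    (hδZ : Metric.closedBall (0 : Rd d) δ ⊆ Z) (hZ1 : Z ⊆ Metric.closedBall (0 : Rd d) 1) :
    IsRegularFamily Z δ β (Ioi 0) (stableKernel d p) ∧
    ∀ X : ℕ → Rd d, IsRieszBasisSequence Z X →
      (∀ α : ℝ, 0 < α → ∀ f ∈ PaleyWiener Z,
        (∃! a : ℕ → ℂ, IsInterpolationCoeff (stableKernel d p α) X f a) ∧
        (∀ x, Summable fun j =>
          interpolationCoeff (stableKernel d p α) X f j * stableKernel d p α (x - X j)) ∧
        MemLp (interpolant (stableKernel d p α) X f) 2 volume) ∧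
      (∀ f ∈ PaleyWiener (Metric.closedBall (0 : Rd d) β),
        Tendsto (fun α : ℝ =>
          eLpNorm (fun x => interpolant (stableKernel d p α) X f x - f x) 2 volume)
          atTop (𝓝 0) ∧
        TendstoUniformly (fun α : ℝ => interpolant (stableKernel d p α) X f) f atTop) ∧
      ∃ C : ℝ, 0 < C ∧ ∀ α : ℝ, 0 < α →
        ∀ f ∈ PaleyWiener (Metric.closedBall (0 : Rd d) β),
          max (eLpNorm (fun x => interpolant (stableKernel d p α) X f x - f x) 2 volume)
              (eLpNorm (fun x => interpolant (stableKernel d p α) X f x - f x) ∞ volume) ≤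
            ENNReal.ofReal (C * Real.exp (α * (β ^ p + 2 - 3 * δ ^ p))) *
              eLpNorm f 2 volume := by
  have hp' : 0 < 1 / p := by positivity
  have hpp : ∀ {x : ℝ}, 0 ≤ x → (x ^ (1 / p)) ^ p = x := fun hx => by
    rw [← Real.rpow_mul hx, one_div_mul_cancel hp.ne', Real.rpow_one]
  have hδ0 : 0 < δ := (Real.rpow_pos_of_pos (by norm_num) _).trans hδ.1
  have hδp : 2 / 3 < δ ^ p := by
    have := Real.rpow_lt_rpow (by positivity) hδ.1 hp
    rwa [hpp (by norm_num)] at this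
  have hδp1 : δ ^ p < 1 := Real.rpow_lt_one hδ0.le hδ.2 hp
  have hβp : β ^ p < 3 * δ ^ p - 2 := by
    have := Real.rpow_lt_rpow hβ.le hβδ hp
    rwa [hpp (by linarith)] at this
  have hγ : β ^ p + 2 - 3 * δ ^ p < 0 := by linarith
  have hβδ' : β ≤ δ := by
    refine ((Real.rpow_lt_rpow_iff hβ.le hδ0.le hp).mp ?_).le
    linarith
  have hZm : MeasurableSet Z := hZ.isCompact.isClosed.measurableSet
  have hZ0 : volume Z ≠ 0 :=
    ((Metric.measure_closedBall_pos volume _ hδ0).trans_le (measure_mono hδZ)).ne'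
  refine ⟨isRegularFamily_stableKernel hd hp hδ0 hδ.2 hβ hγ hδZ hZ1, fun X hX => ?_⟩
  obtain ⟨e, he, hb⟩ := hX
  obtain ⟨R, hR, hRb⟩ := hb.exists_finset_bounds
  have hRB : HasRieszBounds Z X R := hasRieszBounds_of_finset_bounds he hRb
  obtain ⟨C, hC, hbound⟩ := exists_error_bound (p := p) hd hp hδ0.le hδ.2.le hβ.le hβδ' hZm hδZ hZ1
    hZ0 hR he hb hRb
  refine ⟨fun α hα f hf => interpolation_wellPosed hd hp hα hZm hZ1 hZ0 hR hRB hf,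
    fun f hf => ?_, C, hC, fun α hα f hf => ?_⟩
  · have hlim : Tendsto (fun α : ℝ => ENNReal.ofReal
        (C * Real.exp (α * (β ^ p + 2 - 3 * δ ^ p))) * eLpNorm f 2 volume) atTop (𝓝 0) := by
      have h1 : Tendsto (fun α : ℝ => C * Real.exp (α * (β ^ p + 2 - 3 * δ ^ p))) atTop (𝓝 0) := by
        rw [← mul_zero C]
        exact (Real.tendsto_exp_atBot.comp
          (tendsto_id.atTop_mul_const_of_neg hγ)).const_mul C
      have h2 := ENNReal.Tendsto.mul_const (b := eLpNorm f 2 volume) (ENNReal.tendsto_ofReal h1)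
        (Or.inr hf.2.choose.2.ne)
      rwa [ENNReal.ofReal_zero, zero_mul] at h2
    constructor
    · refine tendsto_of_tendsto_of_tendsto_of_le_of_le' tendsto_const_nhds hlim
        (Eventually.of_forall fun _ => zero_le) ?_
      filter_upwards [eventually_gt_atTop 0] with α hα
      exact (hbound α hα f hf).1
    · rw [EMetric.tendstoUniformly_iff]
      intro ε hε
      filter_upwards [eventually_gt_atTop 0, hlim.eventually (gt_mem_nhds hε)] with α hα hlt x
      rw [edist_comm, edist_eq_enorm_sub]
      exact ((hbound α hα f hf).2 x).trans_lt hlt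
  · obtain ⟨h1, h2⟩ := hbound α hα f hf
    refine max_le h1 ?_
    rw [eLpNorm_exponent_top]
    exact eLpNormEssSup_le_of_ae_enorm_bound (ae_of_all _ h2)
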